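/- \textbf{Setting (LDTTP-$k$).} $n$ teams ($n$ even) have their homes at points $x_1,\dots,x_n$ of the real line; the distance of two homes is $w(u,v)=|x_u-x_v|$. A feasible schedule is a double round-robin on $2(n-1)$ days (every day each team plays exactly one game; for any two teams $a\ne b$, team $a$ plays exactly once at the home of $b$) such that no two teams meet on two consecutive days and no team has more than $k$ consecutive home games or more than $k$ consecutive away games. Each team starts at home, travels directly from venue to venue, and returns home after its last game; the weight of a schedule is the total distance travelled by all teams. TTP-$2$ is the same for $k=2$. \textbf{The $k$-cycle-packing schedule} ($n\ge 8k^2$). Let $m=2\lfloor n/(4k)\rfloor$ and $n=2mk+2r$. Let $S$ be a set of $2mk$ teams of maximum total weighted degree ($\deg(v)=\sum_u w(u,v)$); list $S$ from left to right on the line and cut it into $2m$ cycles of $k$ consecutive teams. Divide the other $2r$ teams arbitrarily into pairs $R_1,\dots,R_r$. Label the cycles $u_1,\dots,u_{2m}$ uniformly at random and let $U_i=u_{2i-1}\cup u_{2i}$ ($1\le i\le m$) be the super-teams. \emph{Super-games.} In each of $m-1$ slots of $4k$ days there are $m/2$ super-games, arranged in columns $0,\dots,m/2-1$. $U_m$ is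 fixed at the top of column $0$. $U_1,\dots,U_{m-1}$ sit on the circle formed by the bottom of column $0$, the tops of columns $1,2,\dots,m/2-1$ and the bottoms of columns $m/2-1,\dots,1$: in the first slot $U_j$ and $U_{m-1-j}$ are at the top and bottom of column $j\ge1$ and $U_{m-1}$ is at the bottom of column $0$; after each slot all advance by one place in the direction top of column $j$ to top of column $j+1$. The super-game of column $j$ in slot $s$ ($s=0,1,\dots$) is directed from top to bottom if $s+j$ is even and from bottom to top otherwise. The super-games of the last $r$ columns are \emph{right} ones, column $m/2-i$ involving also the pair $R_i$; column $0$, and in the last slot every column that is not right, is \emph{left}; all others are \emph{normal}. Write $x\to y$ for a game of $x$ at the home of $y$, and $\overline{\,\cdot\,}$ for reversing venues. \begin{itemize} \item A normal or left super-game $U_i\to U_j$ consists of the cycle-games $u_{2i-1}\to u_{2j-1}$, $u_{2i}\to u_{2j}$ on the first $2k$ days and $u_{2i-1}\to u_{2j}$, $u_{2i}\to u_{2j-1}$ on the last $2k$ days. With $p_l=\{x_i\to y_{(i+l-2)\bmod k+1}\}_{i=1}^k$ for cycles $(x_1,\dots,x_k)$ and $(y_1,\dots,y_k)$, a normal cycle-game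 is $p_1\cdots p_k\,\overline{p_1}\cdots\overline{p_k}$, where before this the vertices $y$ are relabelled by that one of the $k$ cyclic rotations that minimizes $\sum_i\big(w(x_i,y_i)+w(x_i,y_{(i+k-2)\bmod k+1})\big)$; a left cycle-game is $p_1\cdots p_{k-1}\overline{p_k}\,\overline{p_1}\cdots\overline{p_{k-1}}\,p_k$, without relabelling. \item In a right super-game $U_i\to U_j$ the first team of the pair joins the upper and the second one the lower super-team as its $(2k+1)$-st member. With $p_l=\{x_i\to y_{(2k+2l-i)\bmod(2k+1)+1}\}_{i=1}^{2k+1}$ the games are $p_1\cdots p_{k-2}\,\overline{p_{k-1}}\,p_k$, then these with reversed venues, then $p_{k+1}\cdots p_{2k-2}\,\overline{p_{2k-1}}\,p_{2k}$, then these with reversed venues. The games of $p_{2k+1}$ and $\overline{p_{2k+1}}$ are left out. \end{itemize} \emph{Last $4k+4r-2$ days.} $U_m\cup R_1\cup\dots\cup R_r$ plays an arbitrary TTP-$2$ feasible schedule. For $i=1,\dots,r$, on four successive days with the patterns $s_1,s_2,\overline{s_1},\overline{s_2}$, the teams of $U_1,\dots,U_{m-1}$ play the games left out in the right super-games with $R_i$: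 if $U_{j'}$ denotes the super-team with $j'\equiv j+2i-1\pmod{m-1}$, then the $a$-th team of $U_j$ visits the $(2k+1-a)$-th team of $U_{j'}$ in $s_1$ for $a\le k$ and in $s_2$ for $a>k$. On the remaining $4k-2$ days each $U_j$ ($j<m$) plays an arbitrary TTP-$2$ feasible schedule among its own teams. \textbf{Theorem.} For every integer $k\ge3$ and every $\varepsilon>0$ there is an $N$, depending only on $k$ and $\varepsilon$, such that for every even $n\ge 8k^2$ and every instance of LDTTP-$k$ with $n$ teams the following holds. The ingredients of the construction (a set $S$ with its division into consecutive cycles, and TTP-$2$ feasible schedules for $2k+2r$ and for $2k$ teams) exist; and however they are chosen, \begin{enumerate} \item the consecutive packing is a minimum weight $k$-cycle packing of the complete graph on $S$; \item for every labelling of the cycles the $k$-cycle-packing schedule is a feasible schedule for TTP-$k$; \item if $n\ge N$, the expected weight of the $k$-cycle-packing schedule is at most $\left(\frac{3k-3}{2k-1}+\varepsilon\right)$ times the weight of every feasible schedule; in particular some labelling gives a schedule of approximation ratio $\frac{3k-3}{2k-1}+\varepsilon$. \end{enumerate} For $k=3$ the ratio is $\frac65+\varepsilon$. -/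

import Mathlib

open Finset

namespace LDTTP

/-! ### Tournaments

A schedule on a set `V` of teams is a relation `G d a b`: on day `d` (days are numbered from `0`)
team `a` plays at the home of team `b`. -/

/-- Number of days of a double round-robin on the teams `V`. -/
def days (V : Type*) [Fintype V] : ℕ := 2 * (Fintype.card V - 1)

/-- On day `d` the teams `a` and `b` play each other, at either venue. -/
def Plays {V : Type*} (G : ℕ → V → V → Prop) (d : ℕ) (a b : V) : Prop := G d a b ∨ G d b a

/-- `G` is a feasible schedule for TTP-`k`: a double round-robin in which every team plays one game
a day and which satisfies no-repeat and bounded-by-`k`. -/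
structure IsTTP (k : ℕ) {V : Type*} [Fintype V] (G : ℕ → V → V → Prop) : Prop where
  asymm : ∀ d, d < days V → ∀ a b, G d a b → ¬ G d b a
  one_game : ∀ d, d < days V → ∀ a, ∃! b, Plays G d a b
  double_round : ∀ a b, a ≠ b → ∃! d, d < days V ∧ G d a b
  no_repeat : ∀ d, d + 1 < days V → ∀ a b, Plays G d a b → ¬ Plays G (d + 1) a b
  bounded_away : ∀ d, d + k < days V → ∀ a, ¬ ∀ j, j ≤ k → ∃ b, G (d + j) a b
  bounded_home : ∀ d, d + k < days V → ∀ a, ¬ ∀ j, j ≤ k → ∃ b, G (d + j) b a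

open Classical in
/-- Where team `a` is, as the team whose home it is: at its own home before the first game (time
`0`), at the venue of its game of day `d` at time `d + 1`, and at home again after the last game. -/
noncomputable def venue {V : Type*} [Fintype V] (G : ℕ → V → V → Prop) (a : V) : ℕ → V
  | 0 => a
  | d + 1 => if h : d < days V ∧ ∃ b, G d a b then h.2.choose else a

/-- Total distance travelled by all teams when the home of team `v` is the point `x v` of the real
line; the distance between the homes of `u` and `v` is `|x u - x v|`. -/
noncomputable def travel {V : Type*} [Fintype V] (x : V → ℝ) (G : ℕ → V → V → Prop) : ℝ :=
  ∑ a : V, ∑ d ∈ range (days V + 1), |x (venue G a d) - x (venue G a (d + 1))|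

/-! ### Parameters and teams of the construction -/

/-- The number `m = 2⌊n/(4k)⌋` of super-teams. -/
def numSuper (n k : ℕ) : ℕ := 2 * (n / (4 * k))

/-- The number `r` of team-pairs, `n = 2mk + 2r`. -/
def numPairs (n k : ℕ) : ℕ := (n - 2 * numSuper n k * k) / 2

/-- Labelled teams: `inl (A, h, i)` is the `i`-th team of the `h`-th cycle-team of the super-team
`A`; `inr (i, c)` is the `c`-th team of the team-pair `i`. All indices start at `0`. -/
abbrev Team (k m r : ℕ) : Type := (Fin m × Fin 2 × Fin k) ⊕ (Fin r × Fin 2)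

/-- The teams of one super-team. -/
abbrev SuperTeam (k : ℕ) : Type := Fin 2 × Fin k

/-- The teams of the last super-team together with those of the team-pairs. -/
abbrev FixedTeam (k r : ℕ) : Type := SuperTeam k ⊕ (Fin r × Fin 2)

/-- The position `c` steps after `i` on a cycle with `k` vertices. -/
def rot {k : ℕ} (i : Fin k) (c : ℕ) : Fin k := ⟨(i + c) % k, Nat.mod_lt _ i.pos⟩

/-- The games of a pairing `P` at the home of the second side, with all venues reversed if `rev`. -/
def oriented {V : Type*} (rev : Prop) (P : V → V → Prop) (u v : V) : Prop :=
  (¬ rev ∧ P u v) ∨ (rev ∧ P v u)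

section Construction

variable {k m r : ℕ}

/-! ### Super-games

In slot `s` the super-games form `m/2` columns. The last super-team is fixed at the top of column
`0`; the other `m - 1` super-teams rotate by one position per slot on the circle formed by the
remaining places (bottom of column `0`, tops of columns `1, …, m/2 - 1`, bottoms of columns
`m/2 - 1, …, 1`). The team-pair `i` is fixed at column `m/2 - 1 - i`. The direction of a column
changes from slot to slot, and neighbouring columns have opposite directions. -/

/-- The rotating super-team at position `p` of the circle in slot `s`. -/
def whiteAt (m s p : ℕ) : ℕ := (p + (m - 1 - s) + (m - 2)) % (m - 1)

/-- The super-team at the top of column `j` in slot `s`. -/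
def upper (m s j : ℕ) : ℕ := if j = 0 then m - 1 else whiteAt m s j

/-- The super-team at the bottom of column `j` in slot `s`. -/
def lower (m s j : ℕ) : ℕ := whiteAt m s (m - 1 - j)

/-- The super-game of column `j` in slot `s` is directed from `tailSide` to `headSide`. -/
def tailSide (m s j : ℕ) : ℕ := if Even (s + j) then upper m s j else lower m s j

/-- See `tailSide`. -/
def headSide (m s j : ℕ) : ℕ := if Even (s + j) then lower m s j else upper m s j

/-- Weight of the games between the cycle-teams `(A, h)` and `(B, h')` that depends on the cyclic
relabelling by `c` of the second one: the first and the last leg of the trips of the teams of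
`(A, h)`. -/
noncomputable def shiftCost (z : Team k m r → ℝ) (A : Fin m) (h : Fin 2) (B : Fin m) (h' : Fin 2)
    (c : ℕ) : ℝ :=
  ∑ i : Fin k, (|z (.inl (A, h, i)) - z (.inl (B, h', rot i c))|
    + |z (.inl (A, h, i)) - z (.inl (B, h', rot i (c + k - 1)))|)

/-- The best of the `k` cyclic relabellings (the first one in case of ties). -/
noncomputable def bestShift (z : Team k m r → ℝ) (A : Fin m) (h : Fin 2) (B : Fin m) (h' : Fin 2) :
    ℕ :=
  sInf {c | c < k ∧ ∀ c', c' < k → shiftCost z A h B h' c ≤ shiftCost z A h B h' c'}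

/-- The pairing on day `q < 4k` of a super-game from `X` to `Y` without team-pair. In the first
`2k` days the cycle-teams with the same index meet, then those with different indices; on the days
`l` and `k + l` of a cycle-game, the team `i` of the first cycle-team meets the team `i + l` of the
second one, which is relabelled cyclically by `sh`. -/
def cyclePair (sh : Fin m → Fin 2 → Fin m → Fin 2 → ℕ) (X Y q : ℕ) : Team k m r → Team k m r → Prop
  | .inl (A, h, a), .inl (B, h', b) =>
      (A : ℕ) = X ∧ (B : ℕ) = Y ∧ (h' : ℕ) = (h + q / (2 * k)) % 2 ∧ b = rot a (q % k + sh A h B h')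
  | _, _ => False

/-- The team belongs to the super-team `X` or is the `c`-th team of the team-pair `i`. -/
def onSide (X i c : ℕ) : Team k m r → Prop
  | .inl (A, _) => (A : ℕ) = X
  | .inr (i', c') => (i' : ℕ) = i ∧ (c' : ℕ) = c

/-- Index of a team in its super-team (`< 2k`); a team of a team-pair gets the index `2k`. -/
def extIdx : Team k m r → ℕ
  | .inl (_, h, a) => h * k + a
  | .inr _ => 2 * k

/-- The pairing on day `q < 4k` of the right super-game of column `j` in slot `s`. Each of the two
super-teams is extended by one team of the team-pair of the column (the first one goes to the upper
super-team); the teams with indices `a` and `b` meet in the round `l` if `a + b = 2l` modulo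
`2k + 1`. Round `2k` is left out. -/
def rightPair (s j q : ℕ) (u v : Team k m r) : Prop :=
  onSide (tailSide m s j) (m / 2 - 1 - j) ((s + j) % 2) u ∧
  onSide (headSide m s j) (m / 2 - 1 - j) ((s + j + 1) % 2) v ∧
  (extIdx u + extIdx v) % (2 * k + 1) = (2 * (q / (2 * k) * k + q % k)) % (2 * k + 1)

/-- The games on day `q < 4k` of the super-game of column `j` in slot `s`: right super-games in the
last `r` columns; left ones in column `0` and, in the last slot `m - 2`, in all other columns;
normal ones elsewhere. With `p_l` the games of round `l` and bars for reversed venues, a normal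
cycle-game is `p_1 ⋯ p_k` followed by its reverse, a left cycle-game is the same with `p_k` and its
reverse exchanged, and each half of a right super-game exchanges the last but one round. -/
def superGame (z : Team k m r → ℝ) (s j q : ℕ) (u v : Team k m r) : Prop :=
  if m / 2 - r ≤ j then
    oriented (Xor (k ≤ q % (2 * k)) (q % k = k - 2)) (rightPair s j q) u v
  else if j = 0 ∨ s = m - 2 then
    oriented (Xor (k ≤ q % (2 * k)) (q % k = k - 1))
      (cyclePair (fun _ _ _ _ => 0) (tailSide m s j) (headSide m s j) q) u v
  else
    oriented (k ≤ q % (2 * k))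
      (cyclePair (bestShift z) (tailSide m s j) (headSide m s j) q) u v

/-! ### The games after the super-games -/

/-- The team as a member of the last super-team or of a team-pair, if it is one. -/
def toFixed : Team k m r → Option (FixedTeam k r)
  | .inl (A, p) => if (A : ℕ) + 1 = m then some (.inl p) else none
  | .inr p => some (.inr p)

/-- The left-out round of the right super-games of the team-pair `i` (on four days `q`). The
super-teams `A` and `A + 2i + 1` modulo `m - 1` meet with this team-pair; the teams of `A` with
indices `< k` visit the next super-team on the first day, the others on the second day. -/
def leftoverPair (i q : ℕ) : Team k m r → Team k m r → Prop
  | .inl (A, h, a), .inl (B, h', b) =>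
      (A : ℕ) + 1 < m ∧ (B : ℕ) = (A + (2 * i + 1)) % (m - 1) ∧ (h : ℕ) = q % 2 ∧
        (h * k + a : ℕ) + (h' * k + b) = 2 * k - 1
  | _, _ => False

/-- The games inside the super-teams other than the last one, on day `d`. -/
def insideGame (D : Fin m → ℕ → SuperTeam k → SuperTeam k → Prop) (d : ℕ) :
    Team k m r → Team k m r → Prop
  | .inl (A, p), .inl (B, p') => (A : ℕ) + 1 < m ∧ A = B ∧ D A d p p'
  | _, _ => False

/-- The games on the `d`-th day after the super-games. The last super-team and the team-pairs play a
double round-robin `D₁`; the other super-teams play the left-out rounds of the right super-games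
(`4r` days), and then the double round-robins `D₂ A` inside each of them. -/
def tailGame (D₁ : ℕ → FixedTeam k r → FixedTeam k r → Prop)
    (D₂ : Fin m → ℕ → SuperTeam k → SuperTeam k → Prop) (d : ℕ) (u v : Team k m r) : Prop :=
  (∃ u' v', toFixed u = some u' ∧ toFixed v = some v' ∧ D₁ d u' v') ∨
  (d < 4 * r ∧ oriented (2 ≤ d % 4) (leftoverPair (d / 4) (d % 4)) u v) ∨
  (4 * r ≤ d ∧ insideGame D₂ (d - 4 * r) u v)

/-- The schedule of the cycle packing construction on labelled teams with homes `z`. -/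
def packGame (z : Team k m r → ℝ) (D₁ : ℕ → FixedTeam k r → FixedTeam k r → Prop)
    (D₂ : Fin m → ℕ → SuperTeam k → SuperTeam k → Prop) (d : ℕ) (u v : Team k m r) : Prop :=
  if d < 4 * k * (m - 1) then ∃ j, j < m / 2 ∧ superGame z (d / (4 * k)) j (d % (4 * k)) u v
  else tailGame D₁ D₂ (d - 4 * k * (m - 1)) u v

end Construction

/-! ### The packing and its labellings -/

section Packing

variable {n k : ℕ}

/-- Weighted degree of a team. -/
noncomputable def wdeg (x : Fin n → ℝ) (v : Fin n) : ℝ := ∑ u, |x v - x u|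

/-- Weight of the packing by the `k`-cycles `(f (c, 0), …, f (c, k - 1), f (c, 0))`. -/
noncomputable def packingWeight {l : ℕ} (x : Fin n → ℝ) (f : Fin l × Fin k → Fin n) : ℝ :=
  ∑ c, ∑ i, |x (f (c, i)) - x (f (c, rot i 1))|

/-- An arrangement of the teams: the `i`-th vertex of the `c`-th of `2m` cycles, and the `r`
team-pairs. -/
abbrev Arrangement (n k : ℕ) : Type :=
  (Fin (2 * numSuper n k) × Fin k) ⊕ (Fin (numPairs n k) × Fin 2) ≃ Fin n

/-- The `k`-cycles of the arrangement. -/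
def Arrangement.cycles (en : Arrangement n k) : Fin (2 * numSuper n k) × Fin k → Fin n :=
  fun p => en (.inl p)

/-- The set `S` of teams on the cycles has maximum total weighted degree among all sets of
its size, and the cycles consist of consecutive teams of `S` on the line. -/
structure IsConsecutive (x : Fin n → ℝ) (en : Arrangement n k) : Prop where
  max_degree : ∀ T : Finset (Fin n), #T = #(univ.image en.cycles) →
    ∑ v ∈ T, wdeg x v ≤ ∑ v ∈ univ.image en.cycles, wdeg x v
  sorted : ∀ p q : Fin (2 * numSuper n k) × Fin k,
    (p.1 * k + p.2 : ℕ) ≤ q.1 * k + q.2 → x (en.cycles p) ≤ x (en.cycles q)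

/-- A labelling: which cycle becomes the `h`-th cycle-team of the super-team `A`. -/
abbrev Labelling (n k : ℕ) : Type := Fin (numSuper n k) × Fin 2 ≃ Fin (2 * numSuper n k)

/-- The team of `Fin n` that a labelled team stands for. -/
def assign (en : Arrangement n k) (lab : Labelling n k) :
    Team k (numSuper n k) (numPairs n k) ≃ Fin n :=
  (Equiv.sumCongr ((Equiv.prodAssoc _ _ _).symm.trans (Equiv.prodCongr lab (Equiv.refl _)))
    (Equiv.refl _)).trans en

/-- The cycle packing schedule for the labelling `lab` of the cycles. -/
def cyclePackingSchedule (x : Fin n → ℝ) (en : Arrangement n k) (lab : Labelling n k)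
    (D₁ : ℕ → FixedTeam k (numPairs n k) → FixedTeam k (numPairs n k) → Prop)
    (D₂ : Fin (numSuper n k) → ℕ → SuperTeam k → SuperTeam k → Prop) :
    ℕ → Fin n → Fin n → Prop :=
  fun d a b => packGame (fun t => x (assign en lab t)) D₁ D₂ d
    ((assign en lab).symm a) ((assign en lab).symm b)

/-- Expected value of `f` at a uniformly random labelling of the cycles. -/
noncomputable def expectLabelling (f : Labelling n k → ℝ) : ℝ :=
  (∑ lab, f lab) / Fintype.card (Labelling n k)

end Packing

end LDTTP

/-!
The statement combines the feasibility of the construction with a comparison of its expected weight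
with a lower bound for every feasible schedule, obtained from cuts of the line.

*Feasibility* (`isTTP_packGame`). The super-teams rotate as in the circle method, hence any two of
them share a column in exactly one slot (`exists_slot`, `slot_unique`). By the left-out rounds on the
last days, every ordered pair of teams has a game; since the number of days leaves room for exactly
one game of every ordered pair, uniqueness comes for free (`existsUnique_day_of_exists`).
Bounded-by-`k` means that every team changes between home and away during any `k` successive
transitions (`packGame_change`). In a normal super-game this happens after every `k` days. The
exchanged rounds of left and right super-games create the changes near the slot boundaries where the
regular ones are missing: in column `0`, for the team-pairs, and before the last days. Feasible
schedules for TTP-2 come from a mirrored circle schedule (`exists_isTTP_two`).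

*Cuts*. The line metric is a nonnegative combination of cut metrics (`exists_cuts`), so that linear
inequalities between the sum `Ω` of all distances (`pairSum`), the weight `C` of a packing and the
weight `T` of a schedule need to be verified for cuts only. A cut separating `I` from `J` teams has
`Ω = 2IJ`. The consecutive packing crosses it at most twice, and not at all if the number of teams
of `S` on its left is a multiple of `k`; otherwise every packing crosses it twice. This gives the
optimality of the consecutive packing (`packingWeight_le_of_sorted`). Every team on one side needs
at least `⌈J/k⌉` trips to the other side, so that `T ≥ 2(I⌈J/k⌉ + J⌈I/k⌉)`. Near the ends of the line
all teams belong to `S`, because the weighted degree decreases towards the median; so if `C ≠ 0`,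
then either the smaller side `I` is not divisible by `k`, and the rounding in `⌈I/k⌉` pays for `C`, or
`I` is so large that `C` is negligible. In either case this yields
(`cut_arith`, `IsConsecutive.ratio`)
`(2/k) Ω + 2m(k - 1) C ≤ ((3k - 3)/(2k - 1) + ε) T`.

*Weight of the schedule*. In a normal super-game a team makes trips through whole cycles. Over one
cycle-game these trips use `k - 1` times each of the two cycles, and first and last legs which, for
the best of the `k` rotations, cost at most their average over all rotations (`sum_slotCost_le`).
Summing over all cycle-games gives the left-hand side above, for every labelling
(`travel_packGame_le`). All other games are bounded by return trips. They take place between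
irregular pairs of teams: the pair involves one of the `2r` teams outside `S`, whose weighted degree
is at most the average over `S`, or both teams are in the same cycle, which costs `O(C)`, or they
are in different cycles at one of `O(m)` irregular pairs of places, and a random labelling makes the
expected distance for such a pair of places at most `Ω / (2m(2m - 1))` (`sum_equiv_apply_pair`).
Since `Ω ≤ (k/2) T` and `C = O(T/m)`, these errors are `O(T/m)` in expectation
(`IsConsecutive.expectLabelling_travel_le`, `error_arith`).
-/

namespace LDTTP

/-! ### Feasible schedules -/

section Basic

variable {V W : Type*} [Fintype V] [Fintype W]

theorem Plays.symm {V : Type*} {G : ℕ → V → V → Prop} {d : ℕ} {a b : V} (h : Plays G d a b) :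
    Plays G d b a := Or.symm h

theorem IsTTP.venue_succ {k : ℕ} {G : ℕ → V → V → Prop} (hG : IsTTP k G) {d : ℕ} {a b : V}
    (hd : d < days V) (h : G d a b) : venue G a (d + 1) = b := by
  have hex : d < days V ∧ ∃ b, G d a b := ⟨hd, b, h⟩
  have e : venue G a (d + 1) = hex.2.choose := by
    simp only [venue, dif_pos hex]
  rw [e]
  exact (hG.one_game d hd a).unique (Or.inl hex.2.choose_spec) (Or.inl h)

theorem venue_succ_of_not {G : ℕ → V → V → Prop} {d : ℕ} {a : V}
    (h : ¬ (d < days V ∧ ∃ b, G d a b)) : venue G a (d + 1) = a := by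
  simp only [venue, dif_neg h]

theorem IsTTP.venue_eq_or {k : ℕ} {G : ℕ → V → V → Prop} (hG : IsTTP k G) (d : ℕ) (a : V) :
    (d < days V ∧ G d a (venue G a (d + 1))) ∨
      ((d < days V → ∀ b, ¬ G d a b) ∧ venue G a (d + 1) = a) := by
  by_cases h : d < days V ∧ ∃ b, G d a b
  · obtain ⟨hd, b, hb⟩ := h
    left
    rw [hG.venue_succ hd hb]
    exact ⟨hd, hb⟩
  · right
    exact ⟨fun hd b hb => h ⟨hd, b, hb⟩, venue_succ_of_not h⟩

theorem IsTTP.irrefl {k : ℕ} {G : ℕ → V → V → Prop} (hG : IsTTP k G) {d : ℕ} (hd : d < days V)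
    (a : V) : ¬ G d a a := fun h => hG.asymm d hd a a h h

/-- The schedule `G` with the teams renamed along `e`. -/
def relabel {V W : Type*} (e : V ≃ W) (G : ℕ → V → V → Prop) : ℕ → W → W → Prop :=
  fun d a b => G d (e.symm a) (e.symm b)

theorem days_congr (e : V ≃ W) : days W = days V := by
  simp only [days, Fintype.card_congr e]

theorem IsTTP.relabel {k : ℕ} {G : ℕ → V → V → Prop} (hG : IsTTP k G) (e : V ≃ W) :
    IsTTP k (relabel e G) := by
  have hD := days_congr e
  refine ⟨?_, ?_, ?_, ?_, ?_, ?_⟩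
  · intro d hd a b h
    exact hG.asymm d (hD ▸ hd) _ _ h
  · intro d hd a
    obtain ⟨b, hb, hu⟩ := hG.one_game d (hD ▸ hd) (e.symm a)
    refine ⟨e b, ?_, ?_⟩
    · simpa [Plays, LDTTP.relabel] using hb
    · intro c hc
      rw [← hu (e.symm c) hc]
      simp
  · intro a b hab
    rw [hD]
    exact hG.double_round _ _ (fun h => hab (e.symm.injective h))
  · intro d hd a b h
    exact hG.no_repeat d (hD ▸ hd) _ _ h
  · intro d hd a h
    refine hG.bounded_away d (hD ▸ hd) (e.symm a) (fun j hj => ?_)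
    obtain ⟨b, hb⟩ := h j hj
    exact ⟨_, hb⟩
  · intro d hd a h
    refine hG.bounded_home d (hD ▸ hd) (e.symm a) (fun j hj => ?_)
    obtain ⟨b, hb⟩ := h j hj
    exact ⟨_, hb⟩

theorem IsTTP.venue_relabel {k : ℕ} {G : ℕ → V → V → Prop} (hG : IsTTP k G) (e : V ≃ W) (a : V)
    (t : ℕ) : venue (LDTTP.relabel e G) (e a) t = e (venue G a t) := by
  cases t with
  | zero => rfl
  | succ d =>
    have hD := days_congr e
    rcases hG.venue_eq_or d a with ⟨hd, h⟩ | ⟨h, h'⟩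
    · refine (hG.relabel e).venue_succ (hD ▸ hd) ?_
      simpa [LDTTP.relabel] using h
    · rw [h', venue_succ_of_not]
      rintro ⟨hd, b, hb⟩
      refine h (hD ▸ hd) (e.symm b) ?_
      simpa [LDTTP.relabel] using hb

theorem IsTTP.travel_relabel {k : ℕ} {G : ℕ → V → V → Prop} (hG : IsTTP k G) (e : V ≃ W)
    (x : W → ℝ) : travel x (LDTTP.relabel e G) = travel (fun v => x (e v)) G := by
  unfold travel
  rw [← e.sum_comp, days_congr e]
  simp only [hG.venue_relabel e]

/-- In a tournament with one game per team and day, double-round-robin only needs that every game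
takes place: the days offer exactly as many games as there are ordered pairs of teams. -/
theorem existsUnique_day_of_exists {G : ℕ → V → V → Prop}
    (asymm : ∀ d, d < days V → ∀ a b, G d a b → ¬ G d b a)
    (one_game : ∀ d, d < days V → ∀ a, ∃! b, Plays G d a b)
    (all_games : ∀ a b, a ≠ b → ∃ d, d < days V ∧ G d a b) (a b : V) (hab : a ≠ b) :
    ∃! d, d < days V ∧ G d a b := by
  classical
  have hday : ∀ d ∈ range (days V),
      2 * #{p : V × V | G d p.1 p.2} = Fintype.card V := by
    intro d hd
    rw [mem_range] at hd
    have h1 : #{p : V × V | Plays G d p.1 p.2} = Fintype.card V := by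
      rw [← Finset.card_univ]
      refine Finset.card_bij (fun p _ => p.1) (fun _ _ => mem_univ _) ?_ ?_
      · rintro ⟨p, q⟩ hp ⟨p', q'⟩ hp' h
        simp only [mem_filter, mem_univ, true_and] at hp hp' h
        subst h
        rw [(one_game d hd p).unique hp hp']
      · intro c _
        obtain ⟨c', hc', -⟩ := one_game d hd c
        exact ⟨(c, c'), by simpa using hc', rfl⟩
    have h2 : #{p : V × V | G d p.1 p.2} = #{p : V × V | G d p.2 p.1} := by
      refine Finset.card_bij (fun p _ => p.swap) ?_ ?_ ?_
      · intro p hp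
        simpa using hp
      · intro p _ q _ h
        exact Prod.swap_injective h
      · intro p hp
        exact ⟨p.swap, by simpa using hp, by simp⟩
    have h3 : #{p : V × V | Plays G d p.1 p.2}
        = #{p : V × V | G d p.1 p.2} + #{p : V × V | G d p.2 p.1} := by
      rw [← Finset.card_union_of_disjoint]
      · congr 1
        ext p
        simp only [mem_filter, mem_union, mem_univ, true_and]
        rfl
      · rw [Finset.disjoint_left]
        intro p hp hp'
        simp only [mem_filter, mem_univ, true_and] at hp hp'
        exact asymm d hd _ _ hp hp'
    omega
  set S : Finset (ℕ × (V × V)) :=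
    (range (days V) ×ˢ (univ : Finset (V × V))).filter (fun p => G p.1 p.2.1 p.2.2) with hS
  have hcard : #S = ∑ d ∈ range (days V), #{p : V × V | G d p.1 p.2} := by
    rw [hS, Finset.card_filter, Finset.sum_product]
    simp only [Finset.card_filter]
  have hcard2 : 2 * #S = days V * Fintype.card V := by
    rw [hcard, Finset.mul_sum, Finset.sum_congr rfl hday]
    simp
  have hoff : #(univ : Finset V).offDiag * 2 = 2 * #S := by
    rw [hcard2, Finset.offDiag_card, Finset.card_univ, days, ← Nat.mul_sub_one]
    ring
  have hsurj : Set.SurjOn (fun p : ℕ × (V × V) => p.2) S ((univ : Finset V).offDiag : Set _) := by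
    rintro ⟨c, c'⟩ hc
    simp only [mem_coe, mem_offDiag, mem_univ, true_and] at hc
    obtain ⟨d, hd, h⟩ := all_games c c' hc
    exact ⟨(d, (c, c')), by simp [hS, hd, h], rfl⟩
  have hmaps : Set.MapsTo (fun p : ℕ × (V × V) => p.2) S ((univ : Finset V).offDiag : Set _) := by
    rintro ⟨d, c, c'⟩ hp
    simp only [hS, mem_coe, mem_filter, mem_product, mem_range, mem_univ, and_true] at hp
    simp only [mem_coe, mem_offDiag, mem_univ, true_and]
    rintro rfl
    exact asymm d hp.1 _ _ hp.2 hp.2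
  have hinj := Finset.injOn_of_surjOn_of_card_le _ hmaps hsurj (by omega)
  obtain ⟨d, hd, h⟩ := all_games a b hab
  refine ⟨d, ⟨hd, h⟩, ?_⟩
  rintro d' ⟨hd', h'⟩
  have h1 : (d', (a, b)) ∈ (S : Set (ℕ × (V × V))) := by simp [hS, hd', h']
  have h2 : (d, (a, b)) ∈ (S : Set (ℕ × (V × V))) := by simp [hS, hd, h]
  exact congrArg Prod.fst (hinj h1 h2 rfl)

/-- A criterion for feasibility: every game takes place, and among any `k` successive transitions
from one day to the next every team changes between home and away at least once. -/
theorem IsTTP.of_changes {k : ℕ} {G : ℕ → V → V → Prop}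
    (asymm : ∀ d, d < days V → ∀ a b, G d a b → ¬ G d b a)
    (one_game : ∀ d, d < days V → ∀ a, ∃! b, Plays G d a b)
    (all_games : ∀ a b, a ≠ b → ∃ d, d < days V ∧ G d a b)
    (no_repeat : ∀ d, d + 1 < days V → ∀ a b, Plays G d a b → ¬ Plays G (d + 1) a b)
    (change : ∀ d, d + k < days V → ∀ a, ∃ j, j < k ∧
      ((∃ b, G (d + j) a b) ↔ ¬ ∃ b, G (d + j + 1) a b)) : IsTTP k G := by
  refine ⟨asymm, one_game, existsUnique_day_of_exists asymm one_game all_games, no_repeat, ?_, ?_⟩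
  · intro d hd a h
    obtain ⟨j, hj, hc⟩ := change d hd a
    exact hc.1 (h j hj.le) (h (j + 1) hj)
  · intro d hd a h
    obtain ⟨j, hj, hc⟩ := change d hd a
    have key : ∀ i, i ≤ k → ¬ ∃ b, G (d + i) a b := by
      rintro i hi ⟨b, hb⟩
      obtain ⟨c, hc⟩ := h i hi
      have hdi : d + i < days V := by omega
      have : b = c := (one_game _ hdi a).unique (Or.inl hb) (Or.inr hc)
      subst this
      exact asymm _ hdi _ _ hb hc
    exact key j hj.le (hc.2 (key (j + 1) hj))

/-- In a feasible schedule, among any `k` successive transitions every team changes between home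
and away. -/
theorem IsTTP.exists_change {k : ℕ} {G : ℕ → V → V → Prop} (hG : IsTTP k G) {d : ℕ}
    (hd : d + k < days V) (a : V) : ∃ j, j < k ∧
      ((∃ b, G (d + j) a b) ↔ ¬ ∃ b, G (d + j + 1) a b) := by
  by_contra! hcon
  have hcon' : ∀ j, j < k → ((∃ b, G (d + j) a b) ↔ ∃ b, G (d + (j + 1)) a b) := by
    intro j hj
    have := hcon j hj
    rw [← add_assoc]
    tauto
  have hall : ∀ j, j ≤ k → ((∃ b, G (d + j) a b) ↔ ∃ b, G d a b) := by
    intro j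
    induction j with
    | zero => intro _; rfl
    | succ j ih => intro hj; rw [← hcon' j hj, ih (by omega)]
  by_cases h0 : ∃ b, G d a b
  · exact hG.bounded_away d hd a (fun j hj => (hall j hj).2 h0)
  · refine hG.bounded_home d hd a (fun j hj => ?_)
    obtain ⟨b, hb, -⟩ := hG.one_game (d + j) (by omega) a
    rcases hb with hb | hb
    · exact absurd ((hall j hj).1 ⟨b, hb⟩) h0
    · exact ⟨b, hb⟩

end Basic

/-! ### Feasible schedules for TTP-2 -/

section Two

/-- The teams `u` and `v` meet in round `l` of the circle method on the teams `0, …, 2h - 1`: the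
team `2h - 1` is the centre, and `u + v = 2l` modulo `2h - 1` for the other pairs. -/
def circleMeet (h l u v : ℕ) : Prop :=
  (u + 1 < 2 * h ∧ v + 1 < 2 * h ∧ u ≠ v ∧
    (u + v = 2 * l ∨ u + v + (2 * h - 1) = 2 * l ∨ u + v = 2 * l + (2 * h - 1))) ∨
  (u + 1 = 2 * h ∧ v = l) ∨ (v + 1 = 2 * h ∧ u = l)

/-- The centre team plays round `l` of the circle method at home. -/
def centreHome (h l : ℕ) : Prop := (l % 2 = 1 ∧ l + 3 < 2 * h) ∨ l + 2 = 2 * h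

/-- The team `u` plays round `l` of the circle method at home: for the teams on the circle,
home and away alternate, except around the game against the centre. -/
def circleHome (h l u : ℕ) : Prop :=
  (u + 1 = 2 * h ∧ centreHome h l) ∨ (u + 1 < 2 * h ∧ u = l ∧ ¬ centreHome h l) ∨
  (u + 1 < 2 * h ∧ u < l ∧ (u + l) % 2 = 0) ∨ (u + 1 < 2 * h ∧ l < u ∧ (u + l) % 2 = 1)

/-- The mirrored circle schedule: the second half repeats the first one with venues reversed. -/
def circleGame (h d u v : ℕ) : Prop :=
  (d + 1 < 2 * h ∧ circleMeet h d u v ∧ ¬ circleHome h d u) ∨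
  (2 * h ≤ d + 1 ∧ circleMeet h (d - (2 * h - 1)) u v ∧ circleHome h (d - (2 * h - 1)) u)

theorem circleMeet_comm {h l u v : ℕ} (huv : circleMeet h l u v) : circleMeet h l v u := by
  unfold circleMeet at *
  omega

theorem circleHome_iff {h l u v : ℕ} (hl : l + 1 < 2 * h) (huv : circleMeet h l u v) :
    circleHome h l u ↔ ¬ circleHome h l v := by
  unfold circleMeet at huv
  unfold circleHome
  generalize centreHome h l = c
  by_cases hc : c <;> simp only [hc, not_true_eq_false, not_false_eq_true, and_true, and_false,
    false_or] <;> omega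

theorem exists_circleMeet {h l u : ℕ} (hl : l + 1 < 2 * h) (hu : u < 2 * h) :
    ∃ v, v < 2 * h ∧ circleMeet h l u v := by
  unfold circleMeet
  by_cases h1 : u + 1 = 2 * h
  · exact ⟨l, by omega⟩
  by_cases h2 : u = l
  · exact ⟨2 * h - 1, by omega⟩
  by_cases h3 : 2 * l < u
  · exact ⟨2 * l + (2 * h - 1) - u, by omega⟩
  by_cases h4 : 2 * l - u + 1 < 2 * h
  · exact ⟨2 * l - u, by omega⟩
  · exact ⟨2 * l - u - (2 * h - 1), by omega⟩

theorem circleMeet_unique {h l u v v' : ℕ} (hl : l + 1 < 2 * h)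
    (hv : circleMeet h l u v) (hv' : circleMeet h l u v') : v = v' := by
  unfold circleMeet at *
  omega

theorem exists_round_circleMeet {h u v : ℕ} (hu : u < 2 * h) (hv : v < 2 * h) (huv : u ≠ v) :
    ∃ l, l + 1 < 2 * h ∧ circleMeet h l u v := by
  unfold circleMeet
  by_cases h1 : u + 1 = 2 * h
  · exact ⟨v, by omega⟩
  by_cases h2 : v + 1 = 2 * h
  · exact ⟨u, by omega⟩
  by_cases h3 : (u + v) % 2 = 0
  · exact ⟨(u + v) / 2, by omega⟩
  by_cases h4 : u + v + 1 < 2 * h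
  · exact ⟨(u + v + (2 * h - 1)) / 2, by omega⟩
  · exact ⟨(u + v - (2 * h - 1)) / 2, by omega⟩

theorem circleMeet_ne_succ {h l u v : ℕ} (hh : 3 ≤ h) (hl : l + 2 < 2 * h)
    (hv : circleMeet h l u v) : ¬ circleMeet h (l + 1) u v := by
  unfold circleMeet at *
  omega

theorem circleMeet_ne_wrap {h l u v : ℕ} (hh : 3 ≤ h) (hl : l + 2 = 2 * h)
    (hv : circleMeet h l u v) : ¬ circleMeet h 0 u v := by
  unfold circleMeet at *
  omega

/-- The team `u` is away on day `d` of the mirrored circle schedule. -/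
def circleAway (h d u : ℕ) : Prop :=
  (d + 1 < 2 * h ∧ ¬ circleHome h d u) ∨ (2 * h ≤ d + 1 ∧ circleHome h (d - (2 * h - 1)) u)

theorem circleHome_step {h l u : ℕ} (hu : u + 1 < 2 * h) (h1 : u ≠ l) (h2 : u ≠ l + 1) :
    circleHome h l u ↔ ¬ circleHome h (l + 1) u := by
  unfold circleHome
  generalize centreHome h l = c
  generalize centreHome h (l + 1) = c'
  rcases Nat.lt_or_gt_of_ne h1 with h3 | h3
  · have e1 : ¬ u + 1 = 2 * h := by omega
    have e2 : ¬ u = l + 1 := by omega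
    have e3 : ¬ l < u := by omega
    have e4 : ¬ l + 1 < u := by omega
    have e5 : u < l + 1 := by omega
    simp only [e1, e2, e3, e4, e5, h3, h1, hu, true_and, false_and, and_false, false_or, or_false]
    omega
  · have e1 : ¬ u + 1 = 2 * h := by omega
    have e3 : ¬ u < l := by omega
    have e4 : ¬ u < l + 1 := by omega
    have e5 : l + 1 < u := by omega
    simp only [e1, h2, e3, e4, e5, h3, h1, hu, true_and, false_and, and_false, false_or]
    omega

theorem circleHome_centre {h l u : ℕ} (hu : u + 1 = 2 * h) :
    circleHome h l u ↔ centreHome h l := by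
  unfold circleHome
  constructor
  · rintro (h1 | h1 | h1 | h1)
    · exact h1.2
    all_goals omega
  · exact fun h1 => Or.inl ⟨hu, h1⟩

theorem circleHome_self {h u : ℕ} (hu : u + 1 < 2 * h) :
    circleHome h u u ↔ ¬ centreHome h u := by
  unfold circleHome
  constructor
  · rintro (h1 | h1 | h1 | h1)
    · omega
    · exact h1.2.2
    all_goals omega
  · exact fun h1 => Or.inr (Or.inl ⟨hu, rfl, h1⟩)

theorem circleHome_lt {h l u : ℕ} (hu : u + 1 < 2 * h) (h1 : u < l) :
    circleHome h l u ↔ (u + l) % 2 = 0 := by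
  unfold circleHome
  generalize centreHome h l = c
  constructor
  · rintro (h1 | h1 | h1 | h1) <;> omega
  · exact fun h2 => Or.inr (Or.inr (Or.inl ⟨hu, h1, h2⟩))

theorem circleHome_gt {h l u : ℕ} (hu : u + 1 < 2 * h) (h1 : l < u) :
    circleHome h l u ↔ (u + l) % 2 = 1 := by
  unfold circleHome
  generalize centreHome h l = c
  constructor
  · rintro (h1 | h1 | h1 | h1) <;> omega
  · exact fun h2 => Or.inr (Or.inr (Or.inr ⟨hu, h1, h2⟩))

theorem circleHome_change {h l u : ℕ} (hu : u < 2 * h) (hl : l + 3 < 2 * h) :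
    (circleHome h l u ↔ ¬ circleHome h (l + 1) u) ∨
      (circleHome h (l + 1) u ↔ ¬ circleHome h (l + 2) u) := by
  rcases Nat.lt_or_ge (u + 1) (2 * h) with hc | hc
  · by_cases h1 : u = l
    · exact Or.inr (circleHome_step hc (by omega) (by omega))
    by_cases h2 : u = l + 1
    · subst h2
      have e1 := (circleHome_gt hc (Nat.lt_succ_self l)).2 (by omega)
      have e2 : ¬ circleHome h (l + 2) (l + 1) := by
        rw [circleHome_lt hc (by omega)]; omega
      grind
    · exact Or.inl (circleHome_step hc h1 h2)
  · have hc' : u + 1 = 2 * h := by omega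
    simp only [circleHome_centre hc']
    unfold centreHome
    rcases Nat.mod_two_eq_zero_or_one l with h1 | h1
    · by_cases h2 : l + 5 < 2 * h
      · left; omega
      · right; omega
    · left; omega

/-- Around the middle of the season: rounds `2h - 3`, `2h - 2` and the reversed round `0`, and
rounds `2h - 2` and the reversed rounds `0`, `1`. -/
theorem circleHome_change_wrap {h u : ℕ} (hh : 3 ≤ h) (hu : u < 2 * h) :
    ((circleHome h (2 * h - 3) u ↔ ¬ circleHome h (2 * h - 2) u) ∨
      (circleHome h (2 * h - 2) u ↔ circleHome h 0 u)) ∧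
    ((circleHome h (2 * h - 2) u ↔ circleHome h 0 u) ∨
      (circleHome h 0 u ↔ ¬ circleHome h 1 u)) := by
  have c0 : ¬ centreHome h 0 := by unfold centreHome; omega
  have c1 : centreHome h 1 := by unfold centreHome; omega
  have c2 : ¬ centreHome h (2 * h - 3) := by unfold centreHome; omega
  have c3 : centreHome h (2 * h - 2) := by unfold centreHome; omega
  rcases Nat.lt_or_ge (u + 1) (2 * h) with hc | hc
  · constructor
    · by_cases h1 : u = 2 * h - 3
      · left
        have e := circleHome_self hc
        have e2 := circleHome_lt (l := 2 * h - 2) hc (by omega)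
        have e3 : ¬ (u + (2 * h - 2)) % 2 = 0 := by omega
        rw [h1] at e e2 e3 ⊢
        grind
      by_cases h2 : u = 2 * h - 2
      · right
        have e := circleHome_self hc
        rw [h2] at e ⊢
        have e2 := circleHome_gt (h := h) (l := 0) (u := 2 * h - 2) (by omega) (by omega)
        have e3 : ¬ (2 * h - 2 + 0) % 2 = 1 := by omega
        grind
      · left
        have := circleHome_step (l := 2 * h - 3) hc h1 (by omega)
        rwa [show 2 * h - 3 + 1 = 2 * h - 2 by omega] at this
    · by_cases h1 : u = 0
      · left
        subst h1
        have e := circleHome_self hc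
        have e2 := circleHome_lt (h := h) (l := 2 * h - 2) hc (by omega)
        have e3 : (0 + (2 * h - 2)) % 2 = 0 := by omega
        grind
      by_cases h2 : u = 1
      · right
        subst h2
        have e := circleHome_self hc
        have e2 := circleHome_gt (h := h) (l := 0) hc (by omega)
        grind
      · right
        exact circleHome_step hc h1 h2
  · have hc' : u + 1 = 2 * h := by omega
    simp only [circleHome_centre hc']
    grind

/-- Among any three successive days, every team changes between home and away; this is
bounded-by-`2` for the mirrored circle schedule. -/
theorem circleAway_change {h d u : ℕ} (hh : 3 ≤ h) (hu : u < 2 * h) (hd : d + 4 < 4 * h) :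
    (circleAway h d u ↔ ¬ circleAway h (d + 1) u) ∨
      (circleAway h (d + 1) u ↔ ¬ circleAway h (d + 2) u) := by
  have first : ∀ d, d + 1 < 2 * h → (circleAway h d u ↔ ¬ circleHome h d u) := by
    intro d hd
    unfold circleAway
    have : ¬ 2 * h ≤ d + 1 := by omega
    grind
  have second : ∀ d l, d = l + (2 * h - 1) → (circleAway h d u ↔ circleHome h l u) := by
    rintro d l rfl
    unfold circleAway
    rw [Nat.add_sub_cancel]
    have : ¬ l + (2 * h - 1) + 1 < 2 * h := by omega
    have : 2 * h ≤ l + (2 * h - 1) + 1 := by omega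
    grind
  obtain ⟨w1, w2⟩ := circleHome_change_wrap hh hu
  rcases Nat.lt_or_ge (d + 3) (2 * h) with h1 | h1
  · rw [first _ (by omega), first _ (by omega), first _ (by omega)]
    have := circleHome_change hu h1
    grind
  by_cases h2 : d + 3 = 2 * h
  · rw [first _ (by omega), first _ (by omega), second (d + 2) 0 (by omega),
      show d = 2 * h - 3 by omega, show 2 * h - 3 + 1 = 2 * h - 2 by omega]
    grind
  by_cases h3 : d + 2 = 2 * h
  · rw [first _ (by omega), second (d + 1) 0 (by omega), second (d + 2) 1 (by omega),
      show d = 2 * h - 2 by omega]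
    grind
  · obtain ⟨l, rfl⟩ : ∃ l, d = l + (2 * h - 1) := ⟨d - (2 * h - 1), by omega⟩
    rw [second _ l rfl, second _ (l + 1) (by omega), second _ (l + 2) (by omega)]
    exact circleHome_change hu (by omega)

/-- Double round-robins feasible for TTP-2 exist for every even number of at least six teams. -/
theorem exists_isTTP_two {V : Type*} [Fintype V] {h : ℕ} (hh : 3 ≤ h)
    (hV : Fintype.card V = 2 * h) : ∃ D : ℕ → V → V → Prop, IsTTP 2 D := by
  have e : Fin (2 * h) ≃ V := (finCongr hV.symm).trans (Fintype.equivFin V).symm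
  suffices H : IsTTP 2 (fun d (a b : Fin (2 * h)) => circleGame h d a b) from
    ⟨_, H.relabel e⟩
  have hD : days (Fin (2 * h)) = 4 * h - 2 := by simp only [days, Fintype.card_fin]; omega
  have hplays : ∀ d, d < 4 * h - 2 → ∀ a b : Fin (2 * h),
      Plays (fun d (a b : Fin (2 * h)) => circleGame h d a b) d a b ↔
        circleMeet h (if d + 1 < 2 * h then d else d - (2 * h - 1)) a b := by
    intro d hd a b
    simp only [Plays, circleGame]
    split_ifs with h1
    · constructor
      · rintro ((⟨-, h2, -⟩ | ⟨h2, -⟩) | (⟨-, h2, -⟩ | ⟨h2, -⟩))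
        · exact h2
        · omega
        · exact circleMeet_comm h2
        · omega
      · intro h2
        have h3 := circleHome_iff h1 h2
        by_cases h4 : circleHome h d a
        · exact Or.inr (Or.inl ⟨h1, circleMeet_comm h2, h3.1 h4⟩)
        · exact Or.inl (Or.inl ⟨h1, h2, h4⟩)
    · have h0 : d - (2 * h - 1) + 1 < 2 * h := by omega
      constructor
      · rintro ((⟨h2, -⟩ | ⟨-, h2, -⟩) | (⟨h2, -⟩ | ⟨-, h2, -⟩))
        · omega
        · exact h2
        · omega
        · exact circleMeet_comm h2
      · intro h2
        have h3 := circleHome_iff h0 h2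
        by_cases h4 : circleHome h (d - (2 * h - 1)) a
        · exact Or.inl (Or.inr ⟨by omega, h2, h4⟩)
        · exact Or.inr (Or.inr ⟨by omega, circleMeet_comm h2, by grind⟩)
  have haway : ∀ d, d < 4 * h - 2 → ∀ a : Fin (2 * h),
      (∃ b : Fin (2 * h), circleGame h d a b) ↔ circleAway h d a := by
    intro d hd a
    unfold circleGame circleAway
    constructor
    · rintro ⟨b, ⟨h1, -, h2⟩ | ⟨h1, -, h2⟩⟩
      · exact Or.inl ⟨h1, h2⟩
      · exact Or.inr ⟨h1, h2⟩
    · rintro (⟨h1, h2⟩ | ⟨h1, h2⟩)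
      · obtain ⟨v, hv, hm⟩ := exists_circleMeet h1 a.2
        exact ⟨⟨v, hv⟩, Or.inl ⟨h1, hm, h2⟩⟩
      · obtain ⟨v, hv, hm⟩ := exists_circleMeet (l := d - (2 * h - 1)) (by omega) a.2
        exact ⟨⟨v, hv⟩, Or.inr ⟨h1, hm, h2⟩⟩
  refine IsTTP.of_changes ?_ ?_ ?_ ?_ ?_ <;> rw [hD]
  · rintro d hd a b (⟨h1, h2, h3⟩ | ⟨h1, h2, h3⟩) (⟨h4, h5, h6⟩ | ⟨h4, h5, h6⟩)
    · exact h3 ((circleHome_iff h1 h2).2 h6)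
    · omega
    · omega
    · exact (circleHome_iff (by omega) h2).1 h3 h6
  · intro d hd a
    obtain ⟨v, hv, hm⟩ := exists_circleMeet (h := h)
      (l := if d + 1 < 2 * h then d else d - (2 * h - 1)) (by split_ifs <;> omega) a.2
    refine ⟨⟨v, hv⟩, (hplays d hd _ _).2 hm, ?_⟩
    intro c hc
    have := circleMeet_unique (by split_ifs <;> omega) ((hplays d hd _ _).1 hc) hm
    exact Fin.ext this
  · intro a b hab
    obtain ⟨l, hl, hm⟩ := exists_round_circleMeet a.2 b.2 (fun h => hab (Fin.ext h))
    by_cases hc : circleHome h l a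
    · refine ⟨l + (2 * h - 1), by omega, Or.inr ⟨by omega, ?_, ?_⟩⟩
      · rwa [Nat.add_sub_cancel]
      · rwa [Nat.add_sub_cancel]
    · exact ⟨l, by omega, Or.inl ⟨hl, hm, hc⟩⟩
  · intro d hd a b h1
    rw [hplays _ (by omega)] at h1 ⊢
    rcases lt_trichotomy (d + 2) (2 * h) with h2 | h2 | h2
    · rw [if_pos (by omega)] at h1 ⊢
      exact circleMeet_ne_succ hh h2 h1
    · rw [if_pos (by omega)] at h1
      rw [if_neg (by omega), show d + 1 - (2 * h - 1) = 0 by omega]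
      exact circleMeet_ne_wrap hh h2 h1
    · rw [if_neg (by omega)] at h1 ⊢
      rw [show d + 1 - (2 * h - 1) = d - (2 * h - 1) + 1 by omega]
      exact circleMeet_ne_succ hh (by omega) h1
  · intro d hd a
    rcases circleAway_change hh a.2 (d := d) (by omega) with h1 | h1
    · refine ⟨0, by omega, ?_⟩
      rw [haway _ (by omega), haway _ (by omega)]
      exact h1
    · refine ⟨1, by omega, ?_⟩
      rw [haway _ (by omega), haway _ (by omega)]
      exact h1

end Two

/-! ### The rotation of the super-teams -/

section Super

theorem whiteAt_eq {m s p : ℕ} (hs : s + 1 < m) (hp : p < m) :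
    whiteAt m s p = if s + 1 ≤ p then p - 1 - s else p + m - 2 - s := by
  unfold whiteAt
  split_ifs with h
  · rw [show p + (m - 1 - s) + (m - 2) = (p - 1 - s) + (m - 1) + (m - 1) by omega,
      Nat.add_mod_right, Nat.add_mod_right, Nat.mod_eq_of_lt (by omega)]
  · rw [show p + (m - 1 - s) + (m - 2) = (p + m - 2 - s) + (m - 1) by omega,
      Nat.add_mod_right, Nat.mod_eq_of_lt (by omega)]

theorem upper_zero {m s : ℕ} : upper m s 0 = m - 1 := if_pos rfl

theorem upper_eq {m s j : ℕ} (hs : s + 1 < m) (hj : j < m) (h0 : j ≠ 0) :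
    upper m s j = if s + 1 ≤ j then j - 1 - s else j + m - 2 - s := by
  rw [upper, if_neg h0, whiteAt_eq hs hj]

theorem lower_eq {m s j : ℕ} (hs : s + 1 < m) :
    lower m s j = if s + 1 ≤ m - 1 - j then m - 1 - j - 1 - s else m - 1 - j + m - 2 - s := by
  rw [lower, whiteAt_eq hs (by omega)]

/-- The super-team `A` plays in column `j` in slot `s`. -/
def InColumn (m s j A : ℕ) : Prop := tailSide m s j = A ∨ headSide m s j = A

theorem inColumn_iff {m s j A : ℕ} : InColumn m s j A ↔ upper m s j = A ∨ lower m s j = A := by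
  unfold InColumn tailSide headSide
  split_ifs
  · rfl
  · exact or_comm

variable {μ : ℕ}

theorem upper_lt {s j : ℕ} (hs : s + 1 < 2 * μ) (hj : j < μ) : upper (2 * μ) s j < 2 * μ := by
  by_cases h0 : j = 0
  · subst h0; rw [upper_zero]; omega
  · rw [upper_eq hs (by omega) h0]; split_ifs <;> omega

theorem lower_lt {s j : ℕ} (hs : s + 1 < 2 * μ) (_hj : j < μ) :
    lower (2 * μ) s j + 1 < 2 * μ := by
  rw [lower_eq hs]; split_ifs <;> omega

theorem upper_ne_lower {s j : ℕ} (hs : s + 1 < 2 * μ) (hj : j < μ) :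
    upper (2 * μ) s j ≠ lower (2 * μ) s j := by
  rw [lower_eq hs]
  by_cases h0 : j = 0
  · subst h0; rw [upper_zero]; split_ifs <;> omega
  · rw [upper_eq hs (by omega) h0]; split_ifs <;> omega

theorem tailSide_ne_headSide {s j : ℕ} (hs : s + 1 < 2 * μ) (hj : j < μ) :
    tailSide (2 * μ) s j ≠ headSide (2 * μ) s j := by
  unfold tailSide headSide
  split_ifs
  · exact upper_ne_lower hs hj
  · exact (upper_ne_lower hs hj).symm

theorem tailSide_lt {s j : ℕ} (hs : s + 1 < 2 * μ) (hj : j < μ) :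
    tailSide (2 * μ) s j < 2 * μ := by
  unfold tailSide
  have := upper_lt hs hj
  have := lower_lt hs hj
  split_ifs <;> omega

theorem headSide_lt {s j : ℕ} (hs : s + 1 < 2 * μ) (hj : j < μ) :
    headSide (2 * μ) s j < 2 * μ := by
  unfold headSide
  have := upper_lt hs hj
  have := lower_lt hs hj
  split_ifs <;> omega

theorem InColumn.lt_pred {s j A : ℕ} (hs : s + 1 < 2 * μ) (hj : j < μ) (h0 : j ≠ 0)
    (h : InColumn (2 * μ) s j A) : A + 1 < 2 * μ := by
  rcases inColumn_iff.1 h with rfl | rfl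
  · rw [upper_eq hs (by omega) h0]; split_ifs <;> omega
  · exact lower_lt hs hj

theorem exists_inColumn {s A : ℕ} (hs : s + 1 < 2 * μ) (hA : A < 2 * μ) :
    ∃ j, j < μ ∧ InColumn (2 * μ) s j A := by
  simp only [inColumn_iff]
  by_cases h1 : A + 1 = 2 * μ
  · exact ⟨0, by omega, Or.inl (by rw [upper_zero]; omega)⟩
  have key : ∀ p, 0 < p → p < 2 * μ → (if s + 1 ≤ p then p - 1 - s else p + 2 * μ - 2 - s) = A →
      ∃ j, j < μ ∧ (upper (2 * μ) s j = A ∨ lower (2 * μ) s j = A) := by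
    intro p hp0 hp h
    rcases Nat.lt_or_ge p μ with h2 | h2
    · refine ⟨p, h2, Or.inl ?_⟩
      rw [upper_eq hs hp (by omega)]
      exact h
    · refine ⟨2 * μ - 1 - p, by omega, Or.inr ?_⟩
      rw [lower_eq hs, show 2 * μ - 1 - (2 * μ - 1 - p) = p by omega]
      exact h
  by_cases h2 : A + s + 1 < 2 * μ
  · exact key (A + s + 1) (by omega) h2 (by split_ifs <;> omega)
  · exact key (A + s + 1 - (2 * μ - 1)) (by omega) (by omega) (by split_ifs <;> omega)

theorem inColumn_unique {s j j' A : ℕ} (hs : s + 1 < 2 * μ) (hj : j < μ) (hj' : j' < μ)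
    (h : InColumn (2 * μ) s j A) (h' : InColumn (2 * μ) s j' A) : j = j' := by
  rw [inColumn_iff, lower_eq hs] at h h'
  by_cases h0 : j = 0 <;> by_cases h0' : j' = 0
  · omega
  · subst h0
    rw [upper_zero] at h
    rw [upper_eq hs (by omega) h0'] at h'
    split_ifs at h h' <;> omega
  · subst h0'
    rw [upper_zero] at h'
    rw [upper_eq hs (by omega) h0] at h
    split_ifs at h h' <;> omega
  · rw [upper_eq hs (by omega) h0] at h
    rw [upper_eq hs (by omega) h0'] at h'
    split_ifs at h h' <;> omega

/-- Every super-team takes the upper place of every column but column `0` in some slot. -/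
theorem exists_upper_eq {j A : ℕ} (hj : j < μ) (h0 : j ≠ 0) (hA : A + 1 < 2 * μ) :
    ∃ s, s + 1 < 2 * μ ∧ upper (2 * μ) s j = A := by
  by_cases h : A + 1 ≤ j
  · refine ⟨j - 1 - A, by omega, ?_⟩
    rw [upper_eq (by omega) (by omega) h0]; split_ifs <;> omega
  · refine ⟨j + 2 * μ - 2 - A, by omega, ?_⟩
    rw [upper_eq (by omega) (by omega) h0]; split_ifs <;> omega

theorem exists_lower_eq {j A : ℕ} (hj : j < μ) (hA : A + 1 < 2 * μ) :
    ∃ s, s + 1 < 2 * μ ∧ lower (2 * μ) s j = A := by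
  by_cases h : A + 1 + j ≤ 2 * μ - 1
  · refine ⟨2 * μ - 1 - j - 1 - A, by omega, ?_⟩
    rw [lower_eq (by omega)]; split_ifs <;> omega
  · refine ⟨2 * μ - 1 - j + 2 * μ - 2 - A, by omega, ?_⟩
    rw [lower_eq (by omega)]; split_ifs <;> omega

/-- The place below the upper place of column `j` is held by the super-team that is `2j` behind on
the circle of `2μ - 1` super-teams. -/
theorem lower_eq_of_upper {s j : ℕ} (hs : s + 1 < 2 * μ) (hj : j < μ) (h0 : j ≠ 0) :
    lower (2 * μ) s j = (upper (2 * μ) s j + (2 * μ - 1 - 2 * j)) % (2 * μ - 1) := by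
  have hu := upper_eq hs (by omega : j < 2 * μ) h0
  rw [lower_eq hs]
  by_cases h : upper (2 * μ) s j + (2 * μ - 1 - 2 * j) < 2 * μ - 1
  · rw [Nat.mod_eq_of_lt h]
    split_ifs at hu ⊢ <;> omega
  · rw [Nat.mod_eq_sub_mod (by omega), Nat.mod_eq_of_lt (by split_ifs at hu <;> omega)]
    split_ifs at hu ⊢ <;> omega

theorem exists_slot_of_even {A B : ℕ} (hA : A + 1 < 2 * μ) (hB : B + 1 < 2 * μ)
    (hAB : (B < A ∧ (A - B) % 2 = 0) ∨ (A < B ∧ (A + (2 * μ - 1) - B) % 2 = 0)) :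
    ∃ s j, s + 1 < 2 * μ ∧ j < μ ∧ upper (2 * μ) s j = A ∧ lower (2 * μ) s j = B := by
  obtain ⟨j, hj, h0, h⟩ : ∃ j, j < μ ∧ j ≠ 0 ∧ (2 * j + B = A ∨ 2 * j + B = A + (2 * μ - 1)) := by
    rcases hAB with ⟨h1, h2⟩ | ⟨h1, h2⟩
    · exact ⟨(A - B) / 2, by omega, by omega, by omega⟩
    · exact ⟨(A + (2 * μ - 1) - B) / 2, by omega, by omega, by omega⟩
  obtain ⟨s, hs, hu⟩ := exists_upper_eq hj h0 hA
  refine ⟨s, j, hs, hj, hu, ?_⟩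
  have hu2 := upper_eq hs (by omega : j < 2 * μ) h0
  rw [lower_eq hs]
  split_ifs at hu2 ⊢ <;> omega

/-- Any two super-teams meet in some slot. -/
theorem exists_slot {A B : ℕ} (hA : A < 2 * μ) (hB : B < 2 * μ) (hAB : A ≠ B) :
    ∃ s j, s + 1 < 2 * μ ∧ j < μ ∧ ((tailSide (2 * μ) s j = A ∧ headSide (2 * μ) s j = B) ∨
      (tailSide (2 * μ) s j = B ∧ headSide (2 * μ) s j = A)) := by
  suffices H : ∃ s j, s + 1 < 2 * μ ∧ j < μ ∧ ((upper (2 * μ) s j = A ∧ lower (2 * μ) s j = B) ∨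
      (upper (2 * μ) s j = B ∧ lower (2 * μ) s j = A)) by
    obtain ⟨s, j, hs, hj, h⟩ := H
    refine ⟨s, j, hs, hj, ?_⟩
    unfold tailSide headSide
    split_ifs <;> omega
  have top : ∀ B, B + 1 < 2 * μ → ∃ s j, s + 1 < 2 * μ ∧ j < μ ∧
      upper (2 * μ) s j = 2 * μ - 1 ∧ lower (2 * μ) s j = B := by
    intro B hB
    obtain ⟨s, hs, h⟩ := exists_lower_eq (μ := μ) (j := 0) (by omega) hB
    exact ⟨s, 0, hs, by omega, upper_zero, h⟩
  by_cases h1 : A + 1 = 2 * μ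
  · obtain ⟨s, j, hs, hj, h, h'⟩ := top B (by omega)
    exact ⟨s, j, hs, hj, Or.inl ⟨by omega, h'⟩⟩
  by_cases h2 : B + 1 = 2 * μ
  · obtain ⟨s, j, hs, hj, h, h'⟩ := top A (by omega)
    exact ⟨s, j, hs, hj, Or.inr ⟨by omega, h'⟩⟩
  by_cases h3 : (B < A ∧ (A - B) % 2 = 0) ∨ (A < B ∧ (A + (2 * μ - 1) - B) % 2 = 0)
  · obtain ⟨s, j, hs, hj, h, h'⟩ := exists_slot_of_even (by omega) (by omega) h3
    exact ⟨s, j, hs, hj, Or.inl ⟨h, h'⟩⟩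
  · obtain ⟨s, j, hs, hj, h, h'⟩ := exists_slot_of_even (μ := μ) (A := B) (B := A) (by omega)
      (by omega) (by omega)
    exact ⟨s, j, hs, hj, Or.inr ⟨h, h'⟩⟩

theorem slot_eq_of_same {s j s' j' : ℕ} (hs : s + 1 < 2 * μ) (hj : j < μ) (hs' : s' + 1 < 2 * μ)
    (hj' : j' < μ) (hu : upper (2 * μ) s j = upper (2 * μ) s' j')
    (hl : lower (2 * μ) s j = lower (2 * μ) s' j') : s = s' := by
  have l1 := lower_lt hs hj
  rw [lower_eq hs, lower_eq hs'] at hl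
  by_cases h0 : j = 0 <;> by_cases h0' : j' = 0
  · subst h0 h0'
    split_ifs at hl <;> omega
  · rw [h0, upper_zero, upper_eq hs' (by omega) h0'] at hu
    split_ifs at hu <;> omega
  · rw [h0', upper_zero, upper_eq hs (by omega) h0] at hu
    split_ifs at hu <;> omega
  · rw [upper_eq hs (by omega) h0, upper_eq hs' (by omega) h0'] at hu
    split_ifs at hu hl <;> omega

theorem not_slot_cross {s j s' j' : ℕ} (hs : s + 1 < 2 * μ) (hj : j < μ) (hs' : s' + 1 < 2 * μ)
    (hj' : j' < μ) (hu : upper (2 * μ) s j = lower (2 * μ) s' j')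
    (hl : lower (2 * μ) s j = upper (2 * μ) s' j') : False := by
  have l1 := lower_lt hs hj
  have l2 := lower_lt hs' hj'
  by_cases h0 : j = 0
  · rw [h0, upper_zero] at hu
    omega
  by_cases h0' : j' = 0
  · rw [h0', upper_zero] at hl
    omega
  rw [upper_eq hs (by omega) h0, lower_eq hs'] at hu
  rw [upper_eq hs' (by omega) h0', lower_eq hs] at hl
  split_ifs at hu hl <;> omega

/-- Two super-teams do not meet in two different slots. -/
theorem slot_unique {s j s' j' A B : ℕ} (hs : s + 1 < 2 * μ) (hj : j < μ) (hs' : s' + 1 < 2 * μ)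
    (hj' : j' < μ) (hAB : A ≠ B) (hA : InColumn (2 * μ) s j A) (hB : InColumn (2 * μ) s j B)
    (hA' : InColumn (2 * μ) s' j' A) (hB' : InColumn (2 * μ) s' j' B) : s = s' ∧ j = j' := by
  suffices H : s = s' by
    subst H
    exact ⟨rfl, inColumn_unique hs hj hj' hA hA'⟩
  rw [inColumn_iff] at hA hB hA' hB'
  rcases hA with hA | hA <;> rcases hB with hB | hB <;> rcases hA' with hA' | hA' <;>
    rcases hB' with hB' | hB' <;> first
      | exact absurd (hA.symm.trans hB) hAB
      | exact absurd (hA'.symm.trans hB') hAB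
      | exact slot_eq_of_same hs hj hs' hj' (hA.trans hA'.symm) (hB.trans hB'.symm)
      | exact slot_eq_of_same hs hj hs' hj' (hB.trans hB'.symm) (hA.trans hA'.symm)
      | exact (not_slot_cross hs hj hs' hj' (hA.trans hA'.symm) (hB.trans hB'.symm)).elim
      | exact (not_slot_cross hs hj hs' hj' (hB.trans hB'.symm) (hA.trans hA'.symm)).elim

theorem tailSide_upper_iff {s j : ℕ} (hs : s + 1 < 2 * μ) (hj : j < μ) :
    tailSide (2 * μ) s j = upper (2 * μ) s j ↔ (s + j) % 2 = 0 := by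
  have := upper_ne_lower hs hj
  rw [← Nat.even_iff]
  unfold tailSide
  split_ifs with h
  · simp [h]
  · simp [h, this.symm]

theorem tailSide_lower_iff {s j : ℕ} (hs : s + 1 < 2 * μ) (hj : j < μ) :
    tailSide (2 * μ) s j = lower (2 * μ) s j ↔ (s + j) % 2 = 1 := by
  have := upper_ne_lower hs hj
  rw [← Nat.not_even_iff]
  unfold tailSide
  split_ifs with h
  · simp [h, this]
  · simp [h]

theorem upper_succ {s j : ℕ} (hs : s + 2 < 2 * μ) (hj : j + 1 < μ) (h0 : j ≠ 0) :
    upper (2 * μ) (s + 1) (j + 1) = upper (2 * μ) s j := by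
  rw [upper_eq (by omega) (by omega) (by omega), upper_eq (by omega) (by omega) h0]
  split_ifs <;> omega

theorem lower_succ_of_upper {s : ℕ} (hs : s + 2 < 2 * μ) :
    lower (2 * μ) (s + 1) (μ - 1) = upper (2 * μ) s (μ - 1) := by
  rw [lower_eq (by omega), upper_eq (by omega) (by omega) (by omega)]
  split_ifs <;> omega

theorem lower_succ {s j : ℕ} (hs : s + 2 < 2 * μ) (hj : j + 1 < μ) :
    lower (2 * μ) (s + 1) j = lower (2 * μ) s (j + 1) := by
  rw [lower_eq (by omega), lower_eq (by omega)]
  split_ifs <;> omega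

theorem upper_one_succ {s : ℕ} (hs : s + 2 < 2 * μ) :
    upper (2 * μ) (s + 1) 1 = lower (2 * μ) s 0 := by
  rw [lower_eq (by omega), upper_eq (by omega) (by omega) one_ne_zero]
  split_ifs <;> omega

/-- Outside column `0` a super-team keeps its side from one slot to the next; in column `0` it
changes its side. -/
theorem tailSide_succ {s j j' A : ℕ} (hs : s + 2 < 2 * μ) (hj : j < μ) (hj' : j' < μ)
    (hA : InColumn (2 * μ) s j A) (hA' : InColumn (2 * μ) (s + 1) j' A) :
    (tailSide (2 * μ) (s + 1) j' = A ↔ (tailSide (2 * μ) s j = A ↔ j ≠ 0)) := by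
  have hs1 : s + 1 < 2 * μ := by omega
  have hs2 : s + 1 + 1 < 2 * μ := by omega
  have hcol : ∀ i, i < μ → (upper (2 * μ) (s + 1) i = A ∨ lower (2 * μ) (s + 1) i = A) →
      j' = i := fun i hi h => inColumn_unique hs2 hj' hi hA' (inColumn_iff.2 h)
  rw [inColumn_iff] at hA
  rcases hA with rfl | rfl
  · rw [tailSide_upper_iff hs1 hj]
    by_cases h0 : j = 0
    · subst h0
      have e : upper (2 * μ) (s + 1) 0 = upper (2 * μ) s 0 := by rw [upper_zero, upper_zero]
      rw [hcol 0 hj (Or.inl e), ← e, tailSide_upper_iff hs2 hj]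
      omega
    by_cases h1 : j + 1 < μ
    · have e := upper_succ hs h1 h0
      rw [hcol _ h1 (Or.inl e), ← e, tailSide_upper_iff hs2 h1]
      omega
    · have e := lower_succ_of_upper hs
      obtain rfl : j = μ - 1 := by omega
      rw [hcol _ hj (Or.inr e), ← e, tailSide_lower_iff hs2 hj]
      omega
  · rw [tailSide_lower_iff hs1 hj]
    by_cases h0 : j = 0
    · subst h0
      have e := upper_one_succ hs
      have h1 : 1 < μ := by omega
      rw [hcol _ h1 (Or.inl e), ← e, tailSide_upper_iff hs2 h1]
      omega
    · obtain ⟨i, rfl⟩ := Nat.exists_eq_succ_of_ne_zero h0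
      have e := lower_succ hs hj
      rw [hcol i (by omega) (Or.inr e), ← e, tailSide_lower_iff hs2 (by omega)]
      simp only [Nat.succ_eq_add_one]
      omega

end Super

/-! ### Days of a super-game and pairings -/

section Pairings

theorem rot_rot {k : ℕ} (i : Fin k) (c d : ℕ) : rot (rot i c) d = rot i (c + d) := by
  apply Fin.ext
  simp only [rot, Nat.mod_add_mod, add_assoc]

theorem rot_eq_iff {k : ℕ} (i : Fin k) (c d : ℕ) : rot i c = rot i d ↔ c % k = d % k := by
  simp only [rot, Fin.mk.injEq]
  exact ⟨fun h => Nat.ModEq.add_left_cancel' (i : ℕ) h, fun h => Nat.ModEq.add_left (i : ℕ) h⟩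

theorem rot_left_injective {k : ℕ} (c : ℕ) : Function.Injective (fun i : Fin k => rot i c) := by
  intro i j h
  simp only [rot, Fin.mk.injEq] at h
  have := Nat.ModEq.add_right_cancel' c h
  exact Fin.ext (Nat.ModEq.eq_of_lt_of_lt this i.2 j.2)

theorem exists_rot_eq {k : ℕ} (i j : Fin k) : ∃ c, c < k ∧ rot i c = j := by
  refine ⟨(j + (k - i)) % k, Nat.mod_lt _ i.pos, Fin.ext ?_⟩
  simp only [rot, Nat.add_mod_mod]
  rw [show (i : ℕ) + (j + (k - i)) = j + k by omega, Nat.add_mod_right, Nat.mod_eq_of_lt j.2]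

/-- The days of a super-game are numbered by the half `H`, the part `c` of the half (`0` for the
games, `1` for the games with reversed venues) and the round `l`. -/
theorem day_decode {k H c l : ℕ} (hc : c < 2) (hl : l < k) :
    (2 * k * H + k * c + l) / (2 * k) = H ∧ (k ≤ (2 * k * H + k * c + l) % (2 * k) ↔ c = 1) ∧
      (2 * k * H + k * c + l) % k = l := by
  have h1 : k * c + l < 2 * k := by
    have : k * c ≤ k * 1 := Nat.mul_le_mul_left _ (by omega)
    omega
  refine ⟨?_, ?_, ?_⟩
  · rw [add_assoc, Nat.mul_add_div (by omega), Nat.div_eq_of_lt h1, add_zero]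
  · rw [add_assoc, Nat.mul_add_mod, Nat.mod_eq_of_lt h1]
    interval_cases c <;> omega
  · rw [show 2 * k * H + k * c + l = k * (2 * H + c) + l by ring, Nat.mul_add_mod,
      Nat.mod_eq_of_lt hl]

theorem exists_day_decode {k q : ℕ} (hq : q < 4 * k) :
    ∃ H c l, H < 2 ∧ c < 2 ∧ l < k ∧ q = 2 * k * H + k * c + l := by
  have hk : 0 < k := by omega
  refine ⟨q / (2 * k), q % (2 * k) / k, q % k, ?_, ?_, Nat.mod_lt _ hk, ?_⟩
  · exact Nat.div_lt_of_lt_mul (by omega)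
  · exact Nat.div_lt_of_lt_mul (by have := Nat.mod_lt q (show 0 < 2 * k by omega); omega)
  · have h1 := Nat.div_add_mod q (2 * k)
    have h2 := Nat.div_add_mod (q % (2 * k)) k
    rw [Nat.mod_mod_of_dvd q ⟨2, by ring⟩] at h2
    omega

theorem day_lt {k H c l : ℕ} (hH : H < 2) (hc : c < 2) (hl : l < k) :
    2 * k * H + k * c + l < 4 * k := by
  interval_cases H <;> interval_cases c <;> omega

theorem succ_mod_ne {k q : ℕ} (hk : 2 ≤ k) : (q + 1) % k ≠ q % k := by
  intro h
  have : 1 ≡ 0 [MOD k] := Nat.ModEq.add_left_cancel' q h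
  rw [Nat.ModEq, Nat.mod_eq_of_lt (by omega), Nat.zero_mod] at this
  omega

variable {k m r : ℕ}

@[simp] theorem onSide_inl (X i c : ℕ) (A : Fin m) (p : Fin 2 × Fin k) :
    onSide X i c (.inl (A, p) : Team k m r) ↔ (A : ℕ) = X := Iff.rfl

@[simp] theorem onSide_inr (X i c : ℕ) (p : Fin r × Fin 2) :
    onSide X i c (.inr p : Team k m r) ↔ (p.1 : ℕ) = i ∧ (p.2 : ℕ) = c := Iff.rfl

theorem cyclePair_inl (sh : Fin m → Fin 2 → Fin m → Fin 2 → ℕ) (X Y q : ℕ) (A B : Fin m)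
    (h h' : Fin 2) (a b : Fin k) :
    cyclePair sh X Y q (.inl (A, h, a) : Team k m r) (.inl (B, h', b)) ↔
      (A : ℕ) = X ∧ (B : ℕ) = Y ∧ (h' : ℕ) = (h + q / (2 * k)) % 2 ∧
        b = rot a (q % k + sh A h B h') := Iff.rfl

theorem cyclePair_cases {sh : Fin m → Fin 2 → Fin m → Fin 2 → ℕ} {X Y q : ℕ}
    {u v : Team k m r} (huv : cyclePair sh X Y q u v) :
    ∃ A h a B h' b, u = .inl (A, h, a) ∧ v = .inl (B, h', b) ∧ (A : ℕ) = X ∧ (B : ℕ) = Y ∧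
      (h' : ℕ) = (h + q / (2 * k)) % 2 ∧ b = rot a (q % k + sh A h B h') := by
  rcases u with ⟨A, h, a⟩ | p <;> rcases v with ⟨B, h', b⟩ | p'
  · exact ⟨A, h, a, B, h', b, rfl, rfl, huv⟩
  all_goals exact huv.elim

theorem cyclePair_exists_right (sh : Fin m → Fin 2 → Fin m → Fin 2 → ℕ) {X Y : ℕ} (q : ℕ)
    (hY : Y < m) (A : Fin m) (hA : (A : ℕ) = X) (h : Fin 2) (a : Fin k) :
    ∃ v : Team k m r, cyclePair sh X Y q (.inl (A, h, a)) v :=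
  ⟨.inl (⟨Y, hY⟩, ⟨(h + q / (2 * k)) % 2, Nat.mod_lt _ two_pos⟩, _), hA, rfl, rfl, rfl⟩

theorem cyclePair_exists_left (sh : Fin m → Fin 2 → Fin m → Fin 2 → ℕ) {X Y : ℕ} (q : ℕ)
    (hX : X < m) (B : Fin m) (hB : (B : ℕ) = Y) (h' : Fin 2) (b : Fin k) :
    ∃ u : Team k m r, cyclePair sh X Y q u (.inl (B, h', b)) := by
  set h : Fin 2 := ⟨(h' + q / (2 * k)) % 2, Nat.mod_lt _ two_pos⟩ with hh
  set c := q % k + sh ⟨X, hX⟩ h B h'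
  have hsurj : Function.Surjective (fun i : Fin k => rot i c) :=
    Finite.surjective_of_injective (rot_left_injective c)
  obtain ⟨a, ha⟩ := hsurj b
  refine ⟨.inl (⟨X, hX⟩, h, a), rfl, hB, ?_, ha.symm⟩
  simp only [hh]
  omega

theorem cyclePair_right_unique {sh : Fin m → Fin 2 → Fin m → Fin 2 → ℕ} {X Y q : ℕ}
    {u v v' : Team k m r} (hv : cyclePair sh X Y q u v) (hv' : cyclePair sh X Y q u v') :
    v = v' := by
  obtain ⟨A, h, a, B, h', b, rfl, rfl, e1, e2, e3, e4⟩ := cyclePair_cases hv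
  obtain ⟨A2, h2, a2, B', h'', b', e0, rfl, f1, f2, f3, f4⟩ := cyclePair_cases hv'
  simp only [Sum.inl.injEq, Prod.mk.injEq] at e0
  obtain ⟨rfl, rfl, rfl⟩ := e0
  obtain rfl : B = B' := Fin.ext (e2.trans f2.symm)
  obtain rfl : h' = h'' := Fin.ext (e3.trans f3.symm)
  rw [e4, f4]

theorem cyclePair_left_unique {sh : Fin m → Fin 2 → Fin m → Fin 2 → ℕ} {X Y q : ℕ}
    {u u' v : Team k m r} (hu : cyclePair sh X Y q u v) (hu' : cyclePair sh X Y q u' v) :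
    u = u' := by
  obtain ⟨A, h, a, B, h', b, rfl, rfl, e1, e2, e3, e4⟩ := cyclePair_cases hu
  obtain ⟨A2, h2, a2, B', h'', b', rfl, e0, f1, f2, f3, f4⟩ := cyclePair_cases hu'
  simp only [Sum.inl.injEq, Prod.mk.injEq] at e0
  obtain ⟨rfl, rfl, rfl⟩ := e0
  obtain rfl : A = A2 := Fin.ext (e1.trans f1.symm)
  obtain rfl : h = h2 := by omega
  rw [e4] at f4
  rw [rot_left_injective _ f4]

theorem cyclePair_not_succ {sh : Fin m → Fin 2 → Fin m → Fin 2 → ℕ} {X Y q : ℕ} (hk : 2 ≤ k)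
    {u v : Team k m r} (huv : cyclePair sh X Y q u v) : ¬ cyclePair sh X Y (q + 1) u v := by
  intro huv'
  obtain ⟨A, h, a, B, h', b, rfl, rfl, e1, e2, e3, e4⟩ := cyclePair_cases huv
  rw [cyclePair_inl] at huv'
  rw [e4, rot_eq_iff] at huv'
  have h1 := Nat.ModEq.add_right_cancel' _ huv'.2.2.2
  rw [Nat.ModEq, Nat.mod_mod, Nat.mod_mod] at h1
  exact succ_mod_ne hk h1.symm

theorem cyclePair_exists_day (sh : Fin m → Fin 2 → Fin m → Fin 2 → ℕ) {X Y : ℕ}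
    {A B : Fin m} (hA : (A : ℕ) = X) (hB : (B : ℕ) = Y) (h h' : Fin 2) (a b : Fin k) :
    ∃ H l, H < 2 ∧ l < k ∧ ∀ c, c < 2 →
      cyclePair sh X Y (2 * k * H + k * c + l) (.inl (A, h, a) : Team k m r)
        (.inl (B, h', b)) := by
  obtain ⟨l, hl, e⟩ := exists_rot_eq (rot a (sh A h B h')) b
  refine ⟨(h + h') % 2, l, Nat.mod_lt _ two_pos, hl, fun c hc => ?_⟩
  obtain ⟨e1, -, e3⟩ := day_decode (H := (h + h' : ℕ) % 2) hc hl
  rw [cyclePair_inl, e1, e3]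
  refine ⟨hA, hB, by omega, ?_⟩
  rw [← e, rot_rot, add_comm]

theorem extIdx_inl (A : Fin m) (h : Fin 2) (a : Fin k) :
    extIdx (.inl (A, h, a) : Team k m r) = h * k + a := rfl

theorem extIdx_inr (p : Fin r × Fin 2) : extIdx (.inr p : Team k m r) = 2 * k := rfl

theorem inl_idx_lt (h : Fin 2) (a : Fin k) : (h * k + a : ℕ) < 2 * k := by
  have : (h : ℕ) * k ≤ 1 * k := Nat.mul_le_mul_right _ (by omega)
  omega

theorem extIdx_lt (u : Team k m r) : extIdx u < 2 * k + 1 := by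
  rcases u with ⟨A, h, a⟩ | p
  · have := inl_idx_lt h a
    rw [extIdx_inl]; omega
  · rw [extIdx_inr]; omega

theorem idx_inj {h h' : Fin 2} {a a' : Fin k} (e : (h * k + a : ℕ) = h' * k + a') :
    h = h' ∧ a = a' := by
  have : h = h' := by
    fin_cases h <;> fin_cases h' <;> simp at e ⊢ <;> omega
  subst this
  exact ⟨rfl, Fin.ext (by omega)⟩

theorem extIdx_inj_on_side {X i c : ℕ} {u v : Team k m r} (hu : onSide X i c u)
    (hv : onSide X i c v) (e : extIdx u = extIdx v) : u = v := by
  rcases u with ⟨A, h, a⟩ | p <;> rcases v with ⟨B, h', b⟩ | p'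
  · rw [onSide_inl] at hu hv
    obtain rfl : A = B := Fin.ext (hu.trans hv.symm)
    obtain ⟨rfl, rfl⟩ := idx_inj e
    rfl
  · have := inl_idx_lt h a
    rw [extIdx_inl, extIdx_inr] at e; omega
  · have := inl_idx_lt h' b
    rw [extIdx_inl, extIdx_inr] at e; omega
  · rw [onSide_inr] at hu hv
    have e1 : p.1 = p'.1 := Fin.ext (hu.1.trans hv.1.symm)
    have e2 : p.2 = p'.2 := Fin.ext (hu.2.trans hv.2.symm)
    rw [Prod.ext e1 e2]

theorem exists_extIdx_on_side {X i c b : ℕ} (hX : X < m) (hi : i < r) (hc : c < 2)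
    (hb : b < 2 * k + 1) : ∃ u : Team k m r, onSide X i c u ∧ extIdx u = b := by
  by_cases h1 : b = 2 * k
  · exact ⟨.inr (⟨i, hi⟩, ⟨c, hc⟩), ⟨rfl, rfl⟩, h1.symm⟩
  by_cases h2 : b < k
  · exact ⟨.inl (⟨X, hX⟩, 0, ⟨b, h2⟩), rfl, by simp [extIdx_inl]⟩
  · exact ⟨.inl (⟨X, hX⟩, 1, ⟨b - k, by omega⟩), rfl, by simp only [extIdx_inl, Fin.val_one]; omega⟩

/-- The round played on day `q` of a right super-game. -/
theorem round_lt {q : ℕ} (hq : q < 4 * k) : q / (2 * k) * k + q % k < 2 * k := by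
  obtain ⟨H, c, l, hH, hc, hl, rfl⟩ := exists_day_decode hq
  obtain ⟨e1, -, e3⟩ := day_decode (H := H) hc hl
  rw [e1, e3]
  interval_cases H <;> omega

theorem exists_mod_add {N a c : ℕ} (ha : a < N) : ∃ b, b < N ∧ (a + b) % N = c % N := by
  refine ⟨(c + (N - a)) % N, Nat.mod_lt _ (by omega), ?_⟩
  rw [Nat.add_mod_mod, show a + (c + (N - a)) = c + N by omega, Nat.add_mod_right]

theorem mod_add_cancel {N a b b' : ℕ} (hb : b < N) (hb' : b' < N)
    (h : (a + b) % N = (a + b') % N) : b = b' :=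
  Nat.ModEq.eq_of_lt_of_lt (Nat.ModEq.add_left_cancel' a h) hb hb'

theorem two_mul_mod_inj {l l' : ℕ} (hl : l < 2 * k + 1) (hl' : l' < 2 * k + 1)
    (h : (2 * l) % (2 * k + 1) = (2 * l') % (2 * k + 1)) : l = l' := by
  have hc : Nat.gcd (2 * k + 1) 2 = 1 := by
    rw [Nat.gcd_comm, Nat.gcd_rec, Nat.mul_add_mod]
    norm_num
  exact Nat.ModEq.eq_of_lt_of_lt (Nat.ModEq.cancel_left_of_coprime hc h) hl hl'

theorem exists_two_mul_mod (a : ℕ) :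
    ∃ l, l < 2 * k + 1 ∧ a % (2 * k + 1) = (2 * l) % (2 * k + 1) := by
  refine ⟨(a * (k + 1)) % (2 * k + 1), Nat.mod_lt _ (by omega), ?_⟩
  rw [Nat.mul_mod_mod, show 2 * (a * (k + 1)) = a + (2 * k + 1) * a by ring,
    Nat.add_mul_mod_self_left]

theorem right_round_succ_ne {q : ℕ} (hk : 2 ≤ k) (hq : q + 1 < 4 * k) :
    q / (2 * k) * k + q % k ≠ (q + 1) / (2 * k) * k + (q + 1) % k := by
  obtain ⟨H, c, l, hH, hc, hl, rfl⟩ := exists_day_decode (show q < 4 * k by omega)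
  obtain ⟨e1, -, e3⟩ := day_decode (H := H) hc hl
  rw [e1, e3]
  intro e
  have : (H * k + l) % k = ((2 * k * H + k * c + l + 1) / (2 * k) * k +
      (2 * k * H + k * c + l + 1) % k) % k := by rw [e]
  rw [Nat.mul_add_mod', Nat.mul_add_mod', Nat.mod_mod, Nat.mod_eq_of_lt hl] at this
  exact succ_mod_ne hk (this.symm.trans e3.symm)

end Pairings

/-! ### The super-games -/

section Columns

variable {k μ r : ℕ}

/-- The pairing of the super-game of column `j` in slot `s` on its day `q`, before the venues of
some of the days are reversed. -/
def colPair (z : Team k (2 * μ) r → ℝ) (s j q : ℕ) : Team k (2 * μ) r → Team k (2 * μ) r → Prop :=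
  if μ - r ≤ j then rightPair s j q
  else cyclePair (if j = 0 ∨ s = 2 * μ - 2 then fun _ _ _ _ => 0 else bestShift z)
    (tailSide (2 * μ) s j) (headSide (2 * μ) s j) q

/-- The venues of day `q` of the super-game of column `j` in slot `s` are reversed. -/
def colRev (k μ r s j q : ℕ) : Prop :=
  if μ - r ≤ j then Xor (k ≤ q % (2 * k)) (q % k = k - 2)
  else if j = 0 ∨ s = 2 * μ - 2 then Xor (k ≤ q % (2 * k)) (q % k = k - 1)
  else k ≤ q % (2 * k)

theorem superGame_iff (z : Team k (2 * μ) r → ℝ) (s j q : ℕ) (u v : Team k (2 * μ) r) :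
    superGame z s j q u v ↔ oriented (colRev k μ r s j q) (colPair z s j q) u v := by
  unfold superGame colRev colPair
  rw [Nat.mul_div_cancel_left μ two_pos]
  split_ifs <;> rfl

/-- The team plays in the super-game of column `j` in slot `s` on the side the game starts from. -/
def OnTail (s j : ℕ) (u : Team k (2 * μ) r) : Prop :=
  onSide (tailSide (2 * μ) s j) (μ - 1 - j) ((s + j) % 2) u

/-- The team plays in the super-game of column `j` in slot `s` on the side the game leads to. -/
def OnHead (s j : ℕ) (u : Team k (2 * μ) r) : Prop :=
  onSide (headSide (2 * μ) s j) (μ - 1 - j) ((s + j + 1) % 2) u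

variable {z : Team k (2 * μ) r → ℝ} {s j q : ℕ} {u v : Team k (2 * μ) r}

theorem OnTail.not_onHead (hs : s + 1 < 2 * μ) (hj : j < μ) (h : OnTail s j u) :
    ¬ OnHead s j u := by
  intro h'
  rcases u with ⟨A, p⟩ | p
  · exact tailSide_ne_headSide hs hj (h.symm.trans h')
  · have h1 := h.2
    have h2 := h'.2
    omega

/-- Only right columns contain teams of the team-pairs. -/
theorem onSide_inl_of_not_right {X c : ℕ} (hj : j < μ) (hr : ¬ μ - r ≤ j)
    (h : onSide X (μ - 1 - j) c u) : ∃ A p, u = .inl (A, p) ∧ (A : ℕ) = X := by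
  rcases u with ⟨A, p⟩ | p
  · exact ⟨A, p, rfl, h⟩
  · have h1 := h.1
    have := p.1.2
    omega

theorem colPair_sides (h : colPair z s j q u v) : OnTail s j u ∧ OnHead s j v := by
  unfold colPair at h
  split_ifs at h with h1 <;>
    first
    | (obtain ⟨h2, h3, -⟩ := h
       rw [Nat.mul_div_cancel_left μ two_pos] at h2 h3
       exact ⟨h2, h3⟩)
    | (obtain ⟨A, _, a, B, _, b, rfl, rfl, h2, h3, -, -⟩ := cyclePair_cases h
       exact ⟨h2, h3⟩)

theorem exists_colPair_right (z : Team k (2 * μ) r → ℝ) (q : ℕ) (hs : s + 1 < 2 * μ) (hj : j < μ)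
    (h : OnTail s j u) : ∃ v, colPair z s j q u v := by
  unfold colPair
  by_cases hr : μ - r ≤ j
  · simp only [if_pos hr, rightPair, Nat.mul_div_cancel_left μ two_pos]
    obtain ⟨b, hb, e⟩ := exists_mod_add (c := 2 * (q / (2 * k) * k + q % k)) (extIdx_lt u)
    obtain ⟨v, hv, e'⟩ := exists_extIdx_on_side (headSide_lt hs hj)
      (show μ - 1 - j < r by omega) (Nat.mod_lt (s + j + 1) two_pos) hb
    exact ⟨v, h, hv, by rw [e', e]⟩
  · simp only [if_neg hr]
    obtain ⟨A, ⟨p, a⟩, rfl, hA⟩ := onSide_inl_of_not_right hj hr h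
    exact cyclePair_exists_right _ q (headSide_lt hs hj) A hA p a

theorem exists_colPair_left (z : Team k (2 * μ) r → ℝ) (q : ℕ) (hs : s + 1 < 2 * μ) (hj : j < μ)
    (h : OnHead s j v) : ∃ u, colPair z s j q u v := by
  unfold colPair
  by_cases hr : μ - r ≤ j
  · simp only [if_pos hr, rightPair, Nat.mul_div_cancel_left μ two_pos]
    obtain ⟨b, hb, e⟩ := exists_mod_add (c := 2 * (q / (2 * k) * k + q % k)) (extIdx_lt v)
    obtain ⟨u, hu, e'⟩ := exists_extIdx_on_side (tailSide_lt hs hj)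
      (show μ - 1 - j < r by omega) (Nat.mod_lt (s + j) two_pos) hb
    exact ⟨u, hu, h, by rw [e', add_comm, e]⟩
  · simp only [if_neg hr]
    obtain ⟨A, ⟨p, a⟩, rfl, hA⟩ := onSide_inl_of_not_right hj hr h
    exact cyclePair_exists_left _ q (tailSide_lt hs hj) A hA p a

theorem colPair_right_unique {v' : Team k (2 * μ) r} (h : colPair z s j q u v)
    (h' : colPair z s j q u v') : v = v' := by
  unfold colPair at h h'
  by_cases hr : μ - r ≤ j
  · rw [if_pos hr] at h h'
    exact extIdx_inj_on_side h.2.1 h'.2.1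
      (mod_add_cancel (extIdx_lt _) (extIdx_lt _) (h.2.2.trans h'.2.2.symm))
  · rw [if_neg hr] at h h'
    exact cyclePair_right_unique h h'

theorem colPair_left_unique {u' : Team k (2 * μ) r} (h : colPair z s j q u v)
    (h' : colPair z s j q u' v) : u = u' := by
  unfold colPair at h h'
  by_cases hr : μ - r ≤ j
  · rw [if_pos hr] at h h'
    have h1 := h.2.2
    have h2 := h'.2.2
    rw [add_comm] at h1 h2
    exact extIdx_inj_on_side h.1 h'.1
      (mod_add_cancel (extIdx_lt _) (extIdx_lt _) (h1.trans h2.symm))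
  · rw [if_neg hr] at h h'
    exact cyclePair_left_unique h h'

theorem colPair_not_succ (hk : 2 ≤ k) (hq : q + 1 < 4 * k) (h : colPair z s j q u v) :
    ¬ colPair z s j (q + 1) u v := by
  intro h'
  unfold colPair at h h'
  by_cases hr : μ - r ≤ j
  · rw [if_pos hr] at h h'
    refine right_round_succ_ne hk hq (two_mul_mod_inj ?_ ?_ (h.2.2.symm.trans h'.2.2))
    · have := round_lt (show q < 4 * k by omega); omega
    · have := round_lt hq; omega
  · rw [if_neg hr] at h h'
    exact cyclePair_not_succ hk h h'

/-- The round with index `2k` does not take place in the right super-games. -/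
theorem colPair_not_leftover (hq : q < 4 * k) (hr : μ - r ≤ j) (h : colPair z s j q u v) :
    (extIdx u + extIdx v) % (2 * k + 1) ≠ (2 * (2 * k)) % (2 * k + 1) := by
  unfold colPair at h
  rw [if_pos hr] at h
  rw [h.2.2]
  intro e
  have h1 := round_lt hq
  have := two_mul_mod_inj (k := k) (by omega) (by omega) e
  omega

theorem xor_target (P : ℕ → Prop) (hP : ¬ P 0 ∧ P 1) (R b : Prop) :
    ∃ c, c < 2 ∧ (Xor (P c) R ↔ b) := by
  by_cases hR : R <;> by_cases hb : b
  · exact ⟨0, by omega, by simp [hP.1, hR, hb, Xor]⟩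
  · exact ⟨1, by omega, by simp [hP.2, hR, hb, Xor]⟩
  · exact ⟨1, by omega, by simp [hP.2, hR, hb, Xor]⟩
  · exact ⟨0, by omega, by simp [hP.1, hR, hb, Xor]⟩

/-- Every round of a super-game is played in both parts of its half, with opposite venues. -/
theorem exists_colRev (μ r s j : ℕ) {H l : ℕ} (hl : l < k) (b : Prop) :
    ∃ c, c < 2 ∧ (colRev k μ r s j (2 * k * H + k * c + l) ↔ b) := by
  have key : ∀ c, c < 2 → (colRev k μ r s j (2 * k * H + k * c + l) ↔
      if μ - r ≤ j then Xor (c = 1) (l = k - 2)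
      else if j = 0 ∨ s = 2 * μ - 2 then Xor (c = 1) (l = k - 1) else Xor (c = 1) False) := by
    intro c hc
    obtain ⟨-, e2, e3⟩ := day_decode (H := H) hc hl
    unfold colRev
    rw [e2, e3]
    split_ifs <;> simp [Xor]
  by_cases h1 : μ - r ≤ j
  · obtain ⟨c, hc, h⟩ := xor_target (fun c => c = 1) (by simp) (l = k - 2) b
    exact ⟨c, hc, by rw [key c hc, if_pos h1]; exact h⟩
  by_cases h2 : j = 0 ∨ s = 2 * μ - 2
  · obtain ⟨c, hc, h⟩ := xor_target (fun c => c = 1) (by simp) (l = k - 1) b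
    exact ⟨c, hc, by rw [key c hc, if_neg h1, if_pos h2]; exact h⟩
  · obtain ⟨c, hc, h⟩ := xor_target (fun c => c = 1) (by simp) False b
    exact ⟨c, hc, by rw [key c hc, if_neg h1, if_neg h2]; exact h⟩

/-- Any two teams on the two sides of a super-game meet there at both venues, unless their game is
left out. -/
theorem exists_colPair_day (z : Team k (2 * μ) r → ℝ) (hj : j < μ) (hu : OnTail s j u)
    (hv : OnHead s j v)
    (huv : μ - r ≤ j → (extIdx u + extIdx v) % (2 * k + 1) ≠ (2 * (2 * k)) % (2 * k + 1))
    (b : Prop) : ∃ q, q < 4 * k ∧ colPair z s j q u v ∧ (colRev k μ r s j q ↔ b) := by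
  suffices H : ∃ H l, H < 2 ∧ l < k ∧ ∀ c, c < 2 →
      colPair z s j (2 * k * H + k * c + l) u v by
    obtain ⟨H, l, hH, hl, h⟩ := H
    obtain ⟨c, hc, e⟩ := exists_colRev μ r s j (H := H) hl b
    exact ⟨_, day_lt hH hc hl, h c hc, e⟩
  unfold colPair
  by_cases hr : μ - r ≤ j
  · simp only [if_pos hr, rightPair, Nat.mul_div_cancel_left μ two_pos]
    obtain ⟨l, hl, e⟩ := exists_two_mul_mod (k := k) (extIdx u + extIdx v)
    have hl2 : l ≠ 2 * k := by
      rintro rfl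
      exact huv hr e
    have hH : l / k < 2 := Nat.div_lt_of_lt_mul (by omega)
    have hk : l % k < k := Nat.mod_lt _ (by
      rcases Nat.eq_zero_or_pos k with h0 | h0
      · subst h0; omega
      · exact h0)
    refine ⟨l / k, l % k, hH, hk, fun c hc => ⟨hu, hv, ?_⟩⟩
    obtain ⟨e1, -, e3⟩ := day_decode (H := l / k) hc hk
    rw [e1, e3, e, mul_comm (l / k) k, Nat.div_add_mod]
  · simp only [if_neg hr]
    obtain ⟨A, ⟨h, a⟩, rfl, hA⟩ := onSide_inl_of_not_right hj hr hu
    obtain ⟨B, ⟨h', b⟩, rfl, hB⟩ := onSide_inl_of_not_right hj hr hv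
    exact cyclePair_exists_day _ hA hB h h' a b

/-- The team plays in the super-game of column `j` in slot `s`. -/
def InCol (s j : ℕ) (u : Team k (2 * μ) r) : Prop := OnTail s j u ∨ OnHead s j u

theorem inCol_inl {A : Fin (2 * μ)} {p : Fin 2 × Fin k} :
    InCol s j (.inl (A, p) : Team k (2 * μ) r) ↔ InColumn (2 * μ) s j A := by
  unfold InCol InColumn
  exact or_congr eq_comm eq_comm

theorem inCol_inr {p : Fin r × Fin 2} :
    InCol s j (.inr p : Team k (2 * μ) r) ↔ (p.1 : ℕ) = μ - 1 - j := by
  unfold InCol OnTail OnHead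
  rw [onSide_inr, onSide_inr]
  have := p.2.2
  omega

theorem exists_inCol (hr : r ≤ μ) (hs : s + 1 < 2 * μ) (u : Team k (2 * μ) r) :
    ∃ j, j < μ ∧ InCol s j u := by
  rcases u with ⟨A, p⟩ | p
  · simp only [inCol_inl]
    exact exists_inColumn hs A.2
  · have := p.1.2
    exact ⟨μ - 1 - p.1, by omega, inCol_inr.2 (by omega)⟩

theorem InCol.unique {j' : ℕ} (hs : s + 1 < 2 * μ) (hj : j < μ) (hj' : j' < μ) (h : InCol s j u)
    (h' : InCol s j' u) : j = j' := by
  rcases u with ⟨A, p⟩ | p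
  · rw [inCol_inl] at h h'
    exact inColumn_unique hs hj hj' h h'
  · rw [inCol_inr] at h h'
    omega

/-- In a column, one of two opponents is in the upper and the other one in the lower half. -/
theorem onTail_onHead_upper (hu : OnTail s j u) (hv : OnHead s j v) :
    (onSide (upper (2 * μ) s j) (μ - 1 - j) 0 u ∧ onSide (lower (2 * μ) s j) (μ - 1 - j) 1 v) ∨
    (onSide (lower (2 * μ) s j) (μ - 1 - j) 1 u ∧ onSide (upper (2 * μ) s j) (μ - 1 - j) 0 v) := by
  unfold OnTail tailSide at hu
  unfold OnHead headSide at hv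
  by_cases h : (s + j) % 2 = 0
  · rw [if_pos (Nat.even_iff.2 h), h] at hu
    rw [if_pos (Nat.even_iff.2 h), show (s + j + 1) % 2 = 1 by omega] at hv
    exact Or.inl ⟨hu, hv⟩
  · rw [if_neg (by rwa [Nat.even_iff]), show (s + j) % 2 = 1 by omega] at hu
    rw [if_neg (by rwa [Nat.even_iff]), show (s + j + 1) % 2 = 0 by omega] at hv
    exact Or.inr ⟨hu, hv⟩

theorem onTail_of_upper (h : onSide (upper (2 * μ) s j) (μ - 1 - j) 0 u) :
    if (s + j) % 2 = 0 then OnTail s j u else OnHead s j u := by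
  unfold OnTail OnHead tailSide headSide
  simp only [Nat.even_iff]
  split_ifs with h1
  · rwa [h1]
  · rwa [show (s + j + 1) % 2 = 0 by omega]

theorem onTail_of_lower (h : onSide (lower (2 * μ) s j) (μ - 1 - j) 1 u) :
    if (s + j) % 2 = 0 then OnHead s j u else OnTail s j u := by
  unfold OnTail OnHead tailSide headSide
  simp only [Nat.even_iff]
  split_ifs with h1
  · rwa [show (s + j + 1) % 2 = 1 by omega]
  · rwa [show (s + j) % 2 = 1 by omega]

/-- A super-team and a team of a team-pair meet in one slot only: the column is determined by the
team-pair and the side by the team. -/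
theorem pair_slot_unique {s' j' : ℕ} (hr : r < μ) (hs : s + 1 < 2 * μ)
    (hs' : s' + 1 < 2 * μ) {A : Fin (2 * μ)} {q : Fin 2 × Fin k} {p : Fin r × Fin 2}
    (h1 : (onSide (upper (2 * μ) s j) (μ - 1 - j) 0 (.inl (A, q) : Team k (2 * μ) r) ∧
        onSide (lower (2 * μ) s j) (μ - 1 - j) 1 (.inr p : Team k (2 * μ) r)) ∨
      (onSide (lower (2 * μ) s j) (μ - 1 - j) 1 (.inl (A, q) : Team k (2 * μ) r) ∧
        onSide (upper (2 * μ) s j) (μ - 1 - j) 0 (.inr p : Team k (2 * μ) r)))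
    (h2 : (onSide (upper (2 * μ) s' j') (μ - 1 - j') 0 (.inl (A, q) : Team k (2 * μ) r) ∧
        onSide (lower (2 * μ) s' j') (μ - 1 - j') 1 (.inr p : Team k (2 * μ) r)) ∨
      (onSide (lower (2 * μ) s' j') (μ - 1 - j') 1 (.inl (A, q) : Team k (2 * μ) r) ∧
        onSide (upper (2 * μ) s' j') (μ - 1 - j') 0 (.inr p : Team k (2 * μ) r)))
    (hj : j < μ) (hj' : j' < μ) : s = s' := by
  simp only [onSide_inl, onSide_inr] at h1 h2
  have hp := p.1.2
  have ej : j = j' := by omega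
  subst ej
  have h0 : j ≠ 0 := by omega
  rcases h1 with ⟨h1, h1'⟩ | ⟨h1, h1'⟩ <;> rcases h2 with ⟨h2, h2'⟩ | ⟨h2, h2'⟩
  · have e := h1.symm.trans h2
    rw [upper_eq hs (by omega) h0, upper_eq hs' (by omega) h0] at e
    split_ifs at e <;> omega
  · omega
  · omega
  · have e := h1.symm.trans h2
    rw [lower_eq hs, lower_eq hs'] at e
    split_ifs at e <;> omega

/-- Two teams that meet in slot `s` do not meet in another slot. -/
theorem opponents_slot_unique {s' j' : ℕ} (hr : r < μ) (hs : s + 1 < 2 * μ) (hj : j < μ)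
    (hs' : s' + 1 < 2 * μ) (hj' : j' < μ) (hu : OnTail s j u) (hv : OnHead s j v)
    (h' : (OnTail s' j' u ∧ OnHead s' j' v) ∨ (OnTail s' j' v ∧ OnHead s' j' u))
    (hne : ¬ (∃ p p', u = .inr p ∧ v = .inr p')) : s = s' := by
  have e1 := onTail_onHead_upper hu hv
  have e2 : (onSide (upper (2 * μ) s' j') (μ - 1 - j') 0 u ∧
      onSide (lower (2 * μ) s' j') (μ - 1 - j') 1 v) ∨
    (onSide (lower (2 * μ) s' j') (μ - 1 - j') 1 u ∧
      onSide (upper (2 * μ) s' j') (μ - 1 - j') 0 v) := by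
    rcases h' with h' | h'
    · exact onTail_onHead_upper h'.1 h'.2
    · rcases onTail_onHead_upper h'.1 h'.2 with h | h
      · exact Or.inr h.symm
      · exact Or.inl h.symm
  rcases u with ⟨A, q⟩ | p <;> rcases v with ⟨B, q'⟩ | p'
  · have hA' : InCol s' j' (.inl (A, q) : Team k (2 * μ) r) :=
      h'.elim (fun h => Or.inl h.1) (fun h => Or.inr h.2)
    have hB' : InCol s' j' (.inl (B, q') : Team k (2 * μ) r) :=
      h'.elim (fun h => Or.inr h.2) (fun h => Or.inl h.1)
    refine (slot_unique hs hj hs' hj' (A := A) (B := B) ?_ (inCol_inl.1 (Or.inl hu))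
      (inCol_inl.1 (Or.inr hv)) (inCol_inl.1 hA') (inCol_inl.1 hB')).1
    intro e
    exact tailSide_ne_headSide hs hj (hu.symm.trans (e.trans hv))
  · exact pair_slot_unique hr hs hs' e1 e2 hj hj'
  · refine pair_slot_unique hr hs hs' (A := B) (q := q') (p := p) ?_ ?_ hj hj'
    · exact e1.elim (fun h => Or.inr h.symm) (fun h => Or.inl h.symm)
    · exact e2.elim (fun h => Or.inr h.symm) (fun h => Or.inl h.symm)
  · exact absurd ⟨p, p', rfl, rfl⟩ hne

/-- The two teams of a team-pair do not meet in a super-game. -/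
theorem colPair_not_inr (hq : q < 4 * k) (hj : j < μ) (h : colPair z s j q u v) :
    ¬ (∃ p p', u = .inr p ∧ v = .inr p') := by
  rintro ⟨p, p', rfl, rfl⟩
  have h1 := (colPair_sides h).1.1
  have hp := p.1.2
  refine colPair_not_leftover hq (by omega) h ?_
  rw [extIdx_inr, extIdx_inr, ← two_mul]

/-- In slot `s`, the column in which two super-teams at distance `2i + 1` on the circle meet. -/
theorem column_of_distance {A B i : ℕ} (hs : s + 1 < 2 * μ) (hj : j < μ) (hA : A + 1 < 2 * μ)
    (hi : 2 * i + 1 < 2 * μ - 1) (hB : B = (A + (2 * i + 1)) % (2 * μ - 1))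
    (h : (upper (2 * μ) s j = A ∧ lower (2 * μ) s j = B) ∨
      (upper (2 * μ) s j = B ∧ lower (2 * μ) s j = A)) : j + i = μ - 1 := by
  have hB1 : B + 1 < 2 * μ := by
    have := Nat.mod_lt (A + (2 * i + 1)) (show 0 < 2 * μ - 1 by omega)
    omega
  have hB2 : B = A + (2 * i + 1) ∨ B + (2 * μ - 1) = A + (2 * i + 1) := by
    rcases Nat.lt_or_ge (A + (2 * i + 1)) (2 * μ - 1) with h1 | h1
    · rw [Nat.mod_eq_of_lt h1] at hB
      exact Or.inl hB
    · rw [Nat.mod_eq_sub_mod h1, Nat.mod_eq_of_lt (by omega)] at hB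
      omega
  have h0 : j ≠ 0 := by
    rintro rfl
    rw [upper_zero] at h
    omega
  rw [upper_eq hs (by omega) h0, lower_eq hs] at h
  split_ifs at h <;> omega

end Columns

/-! ### The days of the super-games -/

section SuperDays

variable {k μ r : ℕ} {z : Team k (2 * μ) r → ℝ}
  {D₁ : ℕ → FixedTeam k r → FixedTeam k r → Prop}
  {D₂ : Fin (2 * μ) → ℕ → SuperTeam k → SuperTeam k → Prop}

theorem days_team (hk : 0 < k) (hμ : 0 < μ) :
    days (Team k (2 * μ) r) = 4 * k * (2 * μ - 1) + (4 * k + 4 * r - 2) := by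
  have h1 : 2 * μ * (2 * k) = 2 * k * (2 * μ - 1) + 2 * k := by
    obtain ⟨a, rfl⟩ : ∃ a, μ = a + 1 := ⟨μ - 1, by omega⟩
    rw [show 2 * (a + 1) - 1 = 2 * a + 1 by omega]
    ring
  have h2 : 4 * k * (2 * μ - 1) = 2 * (2 * k * (2 * μ - 1)) := by ring
  simp only [days, Fintype.card_sum, Fintype.card_prod, Fintype.card_fin]
  omega

theorem days_fixedTeam : days (FixedTeam k r) = 4 * k + 4 * r - 2 := by
  simp only [days, Fintype.card_sum, Fintype.card_prod, Fintype.card_fin]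
  omega

theorem days_superTeam : days (SuperTeam k) = 4 * k - 2 := by
  simp only [days, Fintype.card_prod, Fintype.card_fin]
  omega

theorem oriented_or_comm {V : Type*} (R : Prop) (P : V → V → Prop) (u v : V) :
    oriented R P u v ∨ oriented R P v u ↔ P u v ∨ P v u := by
  unfold oriented
  tauto

theorem slot_lt {s q : ℕ} (hs : s + 1 < 2 * μ) (hq : q < 4 * k) :
    4 * k * s + q < 4 * k * (2 * μ - 1) := by
  calc 4 * k * s + q < 4 * k * s + 4 * k := by omega
    _ = 4 * k * (s + 1) := by ring
    _ ≤ 4 * k * (2 * μ - 1) := Nat.mul_le_mul_left _ (by omega)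

theorem exists_slot_day {d : ℕ} (hd : d < 4 * k * (2 * μ - 1)) :
    ∃ s q, s + 1 < 2 * μ ∧ q < 4 * k ∧ d = 4 * k * s + q := by
  have hk : 0 < 4 * k := by
    rcases Nat.eq_zero_or_pos (4 * k) with h | h
    · rw [h] at hd; omega
    · exact h
  have := Nat.div_lt_of_lt_mul hd
  exact ⟨d / (4 * k), d % (4 * k), Nat.add_lt_of_lt_sub this, Nat.mod_lt _ hk,
    (Nat.div_add_mod _ _).symm⟩

theorem packGame_super {s q : ℕ} (hs : s + 1 < 2 * μ) (hq : q < 4 * k)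
    {u v : Team k (2 * μ) r} : packGame z D₁ D₂ (4 * k * s + q) u v ↔
      ∃ j, j < μ ∧ oriented (colRev k μ r s j q) (colPair z s j q) u v := by
  unfold packGame
  rw [if_pos (slot_lt hs hq), Nat.mul_add_div (by omega), Nat.div_eq_of_lt hq, add_zero,
    Nat.mul_add_mod, Nat.mod_eq_of_lt hq, Nat.mul_div_cancel_left μ two_pos]
  simp only [superGame_iff]

theorem packGame_tail {t : ℕ} {u v : Team k (2 * μ) r} :
    packGame z D₁ D₂ (4 * k * (2 * μ - 1) + t) u v ↔ tailGame D₁ D₂ t u v := by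
  unfold packGame
  rw [if_neg (by omega), Nat.add_sub_cancel_left]

theorem oriented_inCol {s j q : ℕ} {R : Prop} {u v : Team k (2 * μ) r}
    (h : oriented R (colPair z s j q) u v) : InCol s j u ∧ InCol s j v := by
  rcases h with ⟨-, h⟩ | ⟨-, h⟩
  · exact ⟨Or.inl (colPair_sides h).1, Or.inr (colPair_sides h).2⟩
  · exact ⟨Or.inr (colPair_sides h).2, Or.inl (colPair_sides h).1⟩

/-- The games of a team on a day of the super-games take place in its column. -/
theorem packGame_of_inCol {s q j : ℕ} (hs : s + 1 < 2 * μ) (hq : q < 4 * k) (hj : j < μ)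
    {u v : Team k (2 * μ) r} (hu : InCol s j u) :
    packGame z D₁ D₂ (4 * k * s + q) u v ↔
      oriented (colRev k μ r s j q) (colPair z s j q) u v := by
  rw [packGame_super hs hq]
  constructor
  · rintro ⟨i, hi, h⟩
    rwa [hu.unique hs hj hi (oriented_inCol h).1]
  · exact fun h => ⟨j, hj, h⟩

theorem plays_of_inCol {s q j : ℕ} (hs : s + 1 < 2 * μ) (hq : q < 4 * k) (hj : j < μ)
    {u v : Team k (2 * μ) r} (hu : InCol s j u) :
    Plays (packGame z D₁ D₂) (4 * k * s + q) u v ↔ colPair z s j q u v ∨ colPair z s j q v u := by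
  rw [← oriented_or_comm (colRev k μ r s j q)]
  unfold Plays
  constructor
  · rintro (h | h)
    · exact Or.inl ((packGame_of_inCol hs hq hj hu).1 h)
    · rw [packGame_super hs hq] at h
      obtain ⟨i, hi, h⟩ := h
      rw [hu.unique hs hj hi (oriented_inCol h).2]
      exact Or.inr h
  · rintro (h | h)
    · exact Or.inl ((packGame_of_inCol hs hq hj hu).2 h)
    · exact Or.inr ((packGame_super hs hq).2 ⟨j, hj, h⟩)

theorem away_onTail {s q j : ℕ} (hs : s + 1 < 2 * μ) (hq : q < 4 * k) (hj : j < μ)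
    {u : Team k (2 * μ) r} (hu : OnTail s j u) :
    (∃ v, packGame z D₁ D₂ (4 * k * s + q) u v) ↔ ¬ colRev k μ r s j q := by
  simp only [packGame_of_inCol hs hq hj (Or.inl hu)]
  constructor
  · rintro ⟨v, h | h⟩
    · exact h.1
    · exact absurd (colPair_sides h.2).2 (hu.not_onHead hs hj)
  · intro h
    obtain ⟨v, hv⟩ := exists_colPair_right z q hs hj hu
    exact ⟨v, Or.inl ⟨h, hv⟩⟩

theorem away_onHead {s q j : ℕ} (hs : s + 1 < 2 * μ) (hq : q < 4 * k) (hj : j < μ)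
    {u : Team k (2 * μ) r} (hu : OnHead s j u) :
    (∃ v, packGame z D₁ D₂ (4 * k * s + q) u v) ↔ colRev k μ r s j q := by
  simp only [packGame_of_inCol hs hq hj (Or.inr hu)]
  constructor
  · rintro ⟨v, h | h⟩
    · exact absurd hu ((colPair_sides h.2).1.not_onHead hs hj)
    · exact h.1
  · intro h
    obtain ⟨v, hv⟩ := exists_colPair_left z q hs hj hu
    exact ⟨v, Or.inr ⟨h, hv⟩⟩

theorem packGame_asymm_super {d : ℕ} (hd : d < 4 * k * (2 * μ - 1)) {u v : Team k (2 * μ) r}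
    (h : packGame z D₁ D₂ d u v) : ¬ packGame z D₁ D₂ d v u := by
  intro h'
  obtain ⟨s, q, hs, hq, rfl⟩ := exists_slot_day hd
  obtain ⟨j, hj, h1⟩ := (packGame_super hs hq).1 h
  have h2 := (packGame_of_inCol hs hq hj (oriented_inCol h1).2).1 h'
  rcases h1 with ⟨h0, h1⟩ | ⟨h0, h1⟩ <;> rcases h2 with ⟨h0', h2⟩ | ⟨h0', h2⟩
  · exact (colPair_sides h1).1.not_onHead hs hj (colPair_sides h2).2
  · exact h0 h0'
  · exact h0' h0
  · exact (colPair_sides h1).1.not_onHead hs hj (colPair_sides h2).2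

theorem packGame_one_game_super (hr : r ≤ μ) {d : ℕ} (hd : d < 4 * k * (2 * μ - 1))
    (u : Team k (2 * μ) r) : ∃! v, Plays (packGame z D₁ D₂) d u v := by
  obtain ⟨s, q, hs, hq, rfl⟩ := exists_slot_day hd
  obtain ⟨j, hj, hu⟩ := exists_inCol hr hs u
  simp only [plays_of_inCol hs hq hj hu]
  rcases hu with hu | hu
  · obtain ⟨v, hv⟩ := exists_colPair_right z q hs hj hu
    refine ⟨v, Or.inl hv, ?_⟩
    rintro w (hw | hw)
    · exact colPair_right_unique hw hv
    · exact absurd (colPair_sides hw).2 (hu.not_onHead hs hj)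
  · obtain ⟨v, hv⟩ := exists_colPair_left z q hs hj hu
    refine ⟨v, Or.inr hv, ?_⟩
    rintro w (hw | hw)
    · exact absurd hu ((colPair_sides hw).1.not_onHead hs hj)
    · exact colPair_left_unique hw hv

theorem packGame_no_repeat_super (hk : 2 ≤ k) (hr : r < μ) {d : ℕ}
    (hd : d + 1 < 4 * k * (2 * μ - 1)) {u v : Team k (2 * μ) r}
    (h : Plays (packGame z D₁ D₂) d u v) : ¬ Plays (packGame z D₁ D₂) (d + 1) u v := by
  intro h'
  obtain ⟨s, q, hs, hq, rfl⟩ := exists_slot_day (show d < 4 * k * (2 * μ - 1) by omega)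
  obtain ⟨j, hj, hu⟩ := exists_inCol hr.le hs u
  rw [plays_of_inCol hs hq hj hu] at h
  by_cases hq' : q + 1 < 4 * k
  · rw [add_assoc, plays_of_inCol hs hq' hj hu] at h'
    rcases h with h | h <;> rcases h' with h' | h'
    · exact colPair_not_succ hk hq' h h'
    · exact (colPair_sides h).1.not_onHead hs hj (colPair_sides h').2
    · exact (colPair_sides h').1.not_onHead hs hj (colPair_sides h).2
    · exact colPair_not_succ hk hq' h h'
  · have e : 4 * k * s + q + 1 = 4 * k * (s + 1) + 0 := by
      rw [mul_add]; omega
    rw [e] at h' hd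
    have hs' : s + 1 + 1 < 2 * μ := by
      have := Nat.lt_of_mul_lt_mul_left (a := 4 * k)
        (by omega : 4 * k * (s + 1) < 4 * k * (2 * μ - 1))
      omega
    obtain ⟨j', hj', hu'⟩ := exists_inCol hr.le hs' u
    rw [plays_of_inCol hs' (by omega) hj' hu'] at h'
    rcases h with h | h
    · have := opponents_slot_unique hr hs hj hs' hj' (colPair_sides h).1 (colPair_sides h).2
        (h'.imp (fun h => colPair_sides h) (fun h => colPair_sides h))
        (colPair_not_inr hq hj h)
      omega
    · have := opponents_slot_unique hr hs hj hs' hj' (colPair_sides h).1 (colPair_sides h).2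
        (h'.symm.imp (fun h => colPair_sides h) (fun h => colPair_sides h))
        (colPair_not_inr hq hj h)
      omega

/-- From the day `q` of a slot to the next one all teams of a column change between home and away
if exactly one of the two days is reversed. -/
theorem away_change {s q j : ℕ} (hs : s + 1 < 2 * μ) (hq : q + 1 < 4 * k) (hj : j < μ)
    {u : Team k (2 * μ) r} (hu : InCol s j u)
    (h : colRev k μ r s j q ↔ ¬ colRev k μ r s j (q + 1)) :
    (∃ v, packGame z D₁ D₂ (4 * k * s + q) u v) ↔
      ¬ ∃ v, packGame z D₁ D₂ (4 * k * s + q + 1) u v := by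
  rw [add_assoc]
  rcases hu with hu | hu
  · rw [away_onTail hs (by omega) hj hu, away_onTail hs hq hj hu]
    tauto
  · rw [away_onHead hs (by omega) hj hu, away_onHead hs hq hj hu]
    exact h

/-- A team of a super-team changes between home and away from every slot to the next. -/
theorem away_change_boundary (hk : 3 ≤ k) (hr : r < μ) {s : ℕ} (hs : s + 2 < 2 * μ)
    (A : Fin (2 * μ)) (p : Fin 2 × Fin k) :
    (∃ v, packGame z D₁ D₂ (4 * k * s + (4 * k - 1)) (.inl (A, p)) v) ↔
      ¬ ∃ v, packGame z D₁ D₂ (4 * k * (s + 1) + 0) (.inl (A, p)) v := by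
  have hs1 : s + 1 < 2 * μ := by omega
  obtain ⟨j, hj, hu⟩ := exists_inCol hr.le hs1 (.inl (A, p) : Team k (2 * μ) r)
  obtain ⟨j', hj', hu'⟩ := exists_inCol hr.le (show s + 1 + 1 < 2 * μ by omega)
    (.inl (A, p) : Team k (2 * μ) r)
  have hswap := tailSide_succ hs hj hj' (inCol_inl.1 hu) (inCol_inl.1 hu')
  have e1 : (4 * k - 1) % (2 * k) = 2 * k - 1 := by
    rw [show 4 * k - 1 = 2 * k * 1 + (2 * k - 1) by omega, Nat.mul_add_mod,
      Nat.mod_eq_of_lt (by omega)]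
  have e2 : (4 * k - 1) % k = k - 1 := by
    rw [show 4 * k - 1 = k * 3 + (k - 1) by omega, Nat.mul_add_mod, Nat.mod_eq_of_lt (by omega)]
  have h0 : ¬ colRev k μ r (s + 1) j' 0 := by
    unfold colRev
    simp only [Nat.zero_mod, Xor]
    split_ifs <;> omega
  have h1 : colRev k μ r s j (4 * k - 1) ↔ j ≠ 0 := by
    unfold colRev
    have f1 : k ≤ 2 * k - 1 := by omega
    have f2 : ¬ k - 1 = k - 2 := by omega
    simp only [e1, e2, Xor, f1, f2, not_true_eq_false, not_false_eq_true, and_self, and_false,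
      or_false]
    split_ifs with g1 g2
    · simp only [true_iff]; omega
    · simp only [false_iff]; omega
    · simp only [true_iff]; omega
  have htail : ∀ {s j : ℕ}, OnTail s j (.inl (A, p) : Team k (2 * μ) r) ↔
      tailSide (2 * μ) s j = A := by
    intro s j
    exact eq_comm
  rw [← htail, ← htail] at hswap
  have hq : 4 * k - 1 < 4 * k := by omega
  have hq0 : 0 < 4 * k := by omega
  have hs2 : s + 1 + 1 < 2 * μ := by omega
  rcases hu with hu | hu
  · rw [away_onTail hs1 hq hj hu]
    by_cases hu2 : OnTail (s + 1) j' (.inl (A, p) : Team k (2 * μ) r)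
    · rw [away_onTail hs2 hq0 hj' hu2]
      tauto
    · rw [away_onHead hs2 hq0 hj' (hu'.resolve_left hu2)]
      tauto
  · have hu3 : ¬ OnTail s j (.inl (A, p) : Team k (2 * μ) r) := fun h => h.not_onHead hs1 hj hu
    rw [away_onHead hs1 hq hj hu]
    by_cases hu2 : OnTail (s + 1) j' (.inl (A, p) : Team k (2 * μ) r)
    · rw [away_onTail hs2 hq0 hj' hu2]
      tauto
    · rw [away_onHead hs2 hq0 hj' (hu'.resolve_left hu2)]
      tauto

end SuperDays

/-! ### The days after the super-games -/

section TailDays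

variable {k m r : ℕ}

theorem toFixed_inl (A : Fin m) (p : Fin 2 × Fin k) :
    toFixed (.inl (A, p) : Team k m r) = if (A : ℕ) + 1 = m then some (.inl p) else none := rfl

theorem toFixed_inr (p : Fin r × Fin 2) : toFixed (.inr p : Team k m r) = some (.inr p) := rfl

theorem toFixed_inj {u v : Team k m r} {w : FixedTeam k r} (hu : toFixed u = some w)
    (hv : toFixed v = some w) : u = v := by
  rcases u with ⟨A, p⟩ | p <;> rcases v with ⟨B, p'⟩ | p'
  · rw [toFixed_inl] at hu hv
    split_ifs at hu hv with h1 h2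
    have e : A = B := Fin.ext (by omega)
    have e' := hu.trans hv.symm
    simp only [Option.some.injEq, Sum.inl.injEq] at e'
    rw [e, e']
  · rw [toFixed_inl] at hu
    rw [toFixed_inr] at hv
    split_ifs at hu
    have e' := hu.trans hv.symm
    simp at e'
  · rw [toFixed_inr] at hu
    rw [toFixed_inl] at hv
    split_ifs at hv
    have e' := hu.trans hv.symm
    simp at e'
  · rw [toFixed_inr] at hu hv
    have e' := hu.trans hv.symm
    simp only [Option.some.injEq, Sum.inr.injEq] at e'
    rw [e']

theorem exists_toFixed (hm : 0 < m) (w : FixedTeam k r) : ∃ u : Team k m r, toFixed u = some w := by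
  rcases w with p | p
  · refine ⟨.inl (⟨m - 1, by omega⟩, p), ?_⟩
    rw [toFixed_inl, if_pos (by simp only; omega)]
  · exact ⟨.inr p, rfl⟩

theorem toFixed_eq_none {u : Team k m r} :
    toFixed u = none ↔ ∃ (A : Fin m) (p : Fin 2 × Fin k), u = .inl (A, p) ∧ (A : ℕ) + 1 < m := by
  constructor
  · intro h
    rcases u with ⟨A, p⟩ | p
    · rw [toFixed_inl] at h
      split_ifs at h with h1
      exact ⟨A, p, rfl, by omega⟩
    · simp [toFixed_inr] at h
  · rintro ⟨A, p, rfl, h⟩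
    rw [toFixed_inl, if_neg (by omega)]

theorem leftoverPair_inl {i q : ℕ} {A B : Fin m} {h h' : Fin 2} {a b : Fin k} :
    leftoverPair i q (.inl (A, h, a) : Team k m r) (.inl (B, h', b)) ↔
      (A : ℕ) + 1 < m ∧ (B : ℕ) = (A + (2 * i + 1)) % (m - 1) ∧ (h : ℕ) = q % 2 ∧
        (h * k + a : ℕ) + (h' * k + b) = 2 * k - 1 := Iff.rfl

theorem leftoverPair_cases {i q : ℕ} {u v : Team k m r} (huv : leftoverPair i q u v) :
    ∃ (A : Fin m) (h : Fin 2) (a : Fin k) (B : Fin m) (h' : Fin 2) (b : Fin k),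
      u = .inl (A, h, a) ∧ v = .inl (B, h', b) ∧ (A : ℕ) + 1 < m ∧ (B : ℕ) + 1 < m ∧
      (B : ℕ) = (A + (2 * i + 1)) % (m - 1) ∧ (h : ℕ) = q % 2 ∧ (h' : ℕ) = 1 - q % 2 ∧
        (h * k + a : ℕ) + (h' * k + b) = 2 * k - 1 := by
  rcases u with ⟨A, h, a⟩ | p <;> rcases v with ⟨B, h', b⟩ | p'
  · obtain ⟨h1, h2, h3, h4⟩ := leftoverPair_inl.1 huv
    have h5 : (B : ℕ) + 1 < m := by
      have := Nat.mod_lt (A + (2 * i + 1)) (show 0 < m - 1 by omega)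
      omega
    refine ⟨A, h, a, B, h', b, rfl, rfl, h1, h5, h2, h3, ?_, h4⟩
    rw [← h3]
    fin_cases h <;> fin_cases h' <;> simp at h4 ⊢ <;> omega
  all_goals exact huv.elim

theorem exists_mod_add_right {N a c : ℕ} (ha : a < N) : ∃ b, b < N ∧ (b + c) % N = a := by
  refine ⟨(a + (c * N - c)) % N, Nat.mod_lt _ (by omega), ?_⟩
  have h : c ≤ c * N := Nat.le_mul_of_pos_right c (by omega)
  rw [Nat.mod_add_mod, show a + (c * N - c) + c = a + c * N by omega, Nat.add_mul_mod_self_right,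
    Nat.mod_eq_of_lt ha]

theorem exists_complementary_idx {h : Fin 2} (a : Fin k) :
    ∃ (h' : Fin 2) (b : Fin k), (h' : ℕ) = 1 - h ∧ (h * k + a : ℕ) + (h' * k + b) = 2 * k - 1 := by
  refine ⟨⟨1 - h, by omega⟩, ⟨k - 1 - a, by omega⟩, rfl, ?_⟩
  fin_cases h <;> simp <;> omega

theorem exists_leftoverPair_right (i : ℕ) {q : ℕ} {A : Fin m} {h : Fin 2} (a : Fin k)
    (hA : (A : ℕ) + 1 < m) (hh : (h : ℕ) = q % 2) :
    ∃ v, leftoverPair i q (.inl (A, h, a) : Team k m r) v := by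
  obtain ⟨h', b, -, e⟩ := exists_complementary_idx (h := h) a
  have := Nat.mod_lt (A + (2 * i + 1)) (show 0 < m - 1 by omega)
  exact ⟨.inl (⟨_, by omega⟩, h', b), leftoverPair_inl.2 ⟨hA, rfl, hh, e⟩⟩

theorem exists_leftoverPair_left (i : ℕ) {q : ℕ} {B : Fin m} {h' : Fin 2} (b : Fin k)
    (hB : (B : ℕ) + 1 < m) (hh : (h' : ℕ) ≠ q % 2) :
    ∃ u, leftoverPair i q u (.inl (B, h', b) : Team k m r) := by
  obtain ⟨h, a, e1, e⟩ := exists_complementary_idx (h := h') b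
  obtain ⟨A, hA, eA⟩ := exists_mod_add_right (c := 2 * i + 1) (show (B : ℕ) < m - 1 by omega)
  exact ⟨.inl (⟨A, by omega⟩, h, a),
    leftoverPair_inl.2 ⟨by simp only; omega, eA.symm, by omega, by omega⟩⟩

theorem leftoverPair_right_unique {i q : ℕ} {u v v' : Team k m r} (hv : leftoverPair i q u v)
    (hv' : leftoverPair i q u v') : v = v' := by
  obtain ⟨A, h, a, B, h', b, rfl, rfl, e1, e2, e3, e4, e5, e6⟩ := leftoverPair_cases hv
  obtain ⟨A1, h1, a1, B1, h1', b1, e0, rfl, f1, f2, f3, f4, f5, f6⟩ := leftoverPair_cases hv'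
  simp only [Sum.inl.injEq, Prod.mk.injEq] at e0
  obtain ⟨rfl, rfl, rfl⟩ := e0
  obtain rfl : B = B1 := Fin.ext (e3.trans f3.symm)
  obtain ⟨rfl, rfl⟩ := idx_inj (show (h' * k + b : ℕ) = h1' * k + b1 by omega)
  rfl

theorem leftoverPair_left_unique {i q : ℕ} {u u' v : Team k m r} (hu : leftoverPair i q u v)
    (hu' : leftoverPair i q u' v) : u = u' := by
  obtain ⟨A, h, a, B, h', b, rfl, rfl, e1, e2, e3, e4, e5, e6⟩ := leftoverPair_cases hu
  obtain ⟨A1, h1, a1, B1, h1', b1, rfl, e0, f1, f2, f3, f4, f5, f6⟩ := leftoverPair_cases hu'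
  simp only [Sum.inl.injEq, Prod.mk.injEq] at e0
  obtain ⟨rfl, rfl, rfl⟩ := e0
  have e7 : (A : ℕ) = A1 :=
    Nat.ModEq.eq_of_lt_of_lt (Nat.ModEq.add_right_cancel' (2 * i + 1) (e3.symm.trans f3))
      (by omega) (by omega)
  obtain rfl : A = A1 := Fin.ext e7
  obtain ⟨rfl, rfl⟩ := idx_inj (show (h * k + a : ℕ) = h1 * k + a1 by omega)
  rfl

theorem insideGame_inl {D₂ : Fin m → ℕ → SuperTeam k → SuperTeam k → Prop} {d : ℕ} {A B : Fin m}
    {p p' : Fin 2 × Fin k} : insideGame D₂ d (.inl (A, p) : Team k m r) (.inl (B, p')) ↔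
      (A : ℕ) + 1 < m ∧ A = B ∧ D₂ A d p p' := Iff.rfl

theorem insideGame_cases {D₂ : Fin m → ℕ → SuperTeam k → SuperTeam k → Prop} {d : ℕ}
    {u v : Team k m r} (huv : insideGame D₂ d u v) :
    ∃ (A : Fin m) (p p' : Fin 2 × Fin k), u = .inl (A, p) ∧ v = .inl (A, p') ∧
      (A : ℕ) + 1 < m ∧ D₂ A d p p' := by
  rcases u with ⟨A, p⟩ | p <;> rcases v with ⟨B, p'⟩ | p'
  · obtain ⟨h1, rfl, h2⟩ := insideGame_inl.1 huv
    exact ⟨A, p, p', rfl, rfl, h1, h2⟩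
  all_goals exact huv.elim

variable {D₁ : ℕ → FixedTeam k r → FixedTeam k r → Prop}
  {D₂ : Fin m → ℕ → SuperTeam k → SuperTeam k → Prop} {t : ℕ} {u v : Team k m r}

theorem leftover_free {i q : ℕ} {R : Prop} (h : oriented R (leftoverPair i q) u v) :
    toFixed u = none ∧ toFixed v = none := by
  rcases h with ⟨-, h⟩ | ⟨-, h⟩ <;>
    obtain ⟨A, h, a, B, h', b, rfl, rfl, e1, e2, e3, e4, e5, e6⟩ := leftoverPair_cases h
  · exact ⟨toFixed_eq_none.2 ⟨_, _, rfl, e1⟩, toFixed_eq_none.2 ⟨_, _, rfl, e2⟩⟩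
  · exact ⟨toFixed_eq_none.2 ⟨_, _, rfl, e2⟩, toFixed_eq_none.2 ⟨_, _, rfl, e1⟩⟩

theorem inside_free {d : ℕ} (h : insideGame D₂ d u v) : toFixed u = none ∧ toFixed v = none := by
  obtain ⟨A, p, p', rfl, rfl, h1, -⟩ := insideGame_cases h
  exact ⟨toFixed_eq_none.2 ⟨_, _, rfl, h1⟩, toFixed_eq_none.2 ⟨_, _, rfl, h1⟩⟩

theorem tailGame_free_iff (h : tailGame D₁ D₂ t u v) : toFixed u = none ↔ toFixed v = none := by
  rcases h with ⟨u', v', h1, h2, -⟩ | ⟨-, h⟩ | ⟨-, h⟩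
  · rw [h1, h2]; simp
  · have := leftover_free h
    tauto
  · have := inside_free h
    tauto

theorem tailGame_fixed {u' v' : FixedTeam k r} (hu : toFixed u = some u')
    (hv : toFixed v = some v') : tailGame D₁ D₂ t u v ↔ D₁ t u' v' := by
  constructor
  · rintro (⟨u1, v1, h1, h2, h⟩ | ⟨-, h⟩ | ⟨-, h⟩)
    · rw [hu, Option.some.injEq] at h1
      rw [hv, Option.some.injEq] at h2
      rwa [h1, h2]
    · simpa [hu] using (leftover_free h).1
    · simpa [hu] using (inside_free h).1
  · exact fun h => Or.inl ⟨u', v', hu, hv, h⟩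

theorem tailGame_leftover (ht : t < 4 * r) (hu : toFixed u = none) :
    tailGame D₁ D₂ t u v ↔ oriented (2 ≤ t % 4) (leftoverPair (t / 4) (t % 4)) u v := by
  constructor
  · rintro (⟨u1, v1, h1, -⟩ | ⟨-, h⟩ | ⟨h, -⟩)
    · simp [hu] at h1
    · exact h
    · omega
  · exact fun h => Or.inr (Or.inl ⟨ht, h⟩)

theorem tailGame_inside (ht : 4 * r ≤ t) (hu : toFixed u = none) :
    tailGame D₁ D₂ t u v ↔ insideGame D₂ (t - 4 * r) u v := by
  constructor
  · rintro (⟨u1, v1, h1, -⟩ | ⟨h, -⟩ | ⟨-, h⟩)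
    · simp [hu] at h1
    · omega
    · exact h
  · exact fun h => Or.inr (Or.inr ⟨ht, h⟩)

theorem plays_fixed {u' v' : FixedTeam k r} (hu : toFixed u = some u')
    (hv : toFixed v = some v') : Plays (tailGame D₁ D₂) t u v ↔ Plays D₁ t u' v' := by
  unfold Plays
  rw [tailGame_fixed hu hv, tailGame_fixed hv hu]

theorem plays_free_iff (h : Plays (tailGame D₁ D₂) t u v) :
    toFixed u = none ↔ toFixed v = none := by
  rcases h with h | h
  · exact tailGame_free_iff h
  · exact (tailGame_free_iff h).symm

theorem plays_leftover (ht : t < 4 * r) (hu : toFixed u = none) :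
    Plays (tailGame D₁ D₂) t u v ↔
      leftoverPair (t / 4) (t % 4) u v ∨ leftoverPair (t / 4) (t % 4) v u := by
  rw [← oriented_or_comm (2 ≤ t % 4)]
  constructor
  · intro h
    have hv := (plays_free_iff h).1 hu
    rcases h with h | h
    · exact Or.inl ((tailGame_leftover ht hu).1 h)
    · exact Or.inr ((tailGame_leftover ht hv).1 h)
  · rintro (h | h)
    · exact Or.inl (Or.inr (Or.inl ⟨ht, h⟩))
    · exact Or.inr (Or.inr (Or.inl ⟨ht, h⟩))

theorem plays_inside (ht : 4 * r ≤ t) {A : Fin m} (hA : (A : ℕ) + 1 < m) {p : Fin 2 × Fin k} :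
    Plays (tailGame D₁ D₂) t (.inl (A, p)) v ↔
      ∃ p', v = .inl (A, p') ∧ Plays (D₂ A) (t - 4 * r) p p' := by
  have hu : toFixed (.inl (A, p) : Team k m r) = none := toFixed_eq_none.2 ⟨A, p, rfl, hA⟩
  constructor
  · intro h
    have hv := (plays_free_iff h).1 hu
    rcases h with h | h
    · obtain ⟨B, q, q', e1, rfl, -, h⟩ := insideGame_cases ((tailGame_inside ht hu).1 h)
      simp only [Sum.inl.injEq, Prod.mk.injEq] at e1
      obtain ⟨rfl, rfl⟩ := e1
      exact ⟨q', rfl, Or.inl h⟩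
    · obtain ⟨B, q, q', rfl, e1, -, h⟩ := insideGame_cases ((tailGame_inside ht hv).1 h)
      simp only [Sum.inl.injEq, Prod.mk.injEq] at e1
      obtain ⟨rfl, rfl⟩ := e1
      exact ⟨q, rfl, Or.inr h⟩
  · rintro ⟨p', rfl, h | h⟩
    · exact Or.inl (Or.inr (Or.inr ⟨ht, insideGame_inl.2 ⟨hA, rfl, h⟩⟩))
    · exact Or.inr (Or.inr (Or.inr ⟨ht, insideGame_inl.2 ⟨hA, rfl, h⟩⟩))

theorem away_fixed (hm : 0 < m) {u' : FixedTeam k r} (hu : toFixed u = some u') :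
    (∃ v, tailGame D₁ D₂ t u v) ↔ ∃ v', D₁ t u' v' := by
  constructor
  · rintro ⟨v, h⟩
    rcases hv : toFixed v with _ | v'
    · rw [(tailGame_free_iff h).2 hv] at hu
      simp at hu
    · exact ⟨v', (tailGame_fixed hu hv).1 h⟩
  · rintro ⟨v', h⟩
    obtain ⟨v, hv⟩ := exists_toFixed hm v'
    exact ⟨v, (tailGame_fixed hu hv).2 h⟩

theorem away_inside (ht : 4 * r ≤ t) {A : Fin m} (hA : (A : ℕ) + 1 < m) {p : Fin 2 × Fin k} :
    (∃ v, tailGame D₁ D₂ t (.inl (A, p)) v) ↔ ∃ p', D₂ A (t - 4 * r) p p' := by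
  have hu : toFixed (.inl (A, p) : Team k m r) = none := toFixed_eq_none.2 ⟨A, p, rfl, hA⟩
  simp only [tailGame_inside ht hu]
  constructor
  · rintro ⟨v, h⟩
    obtain ⟨B, q, q', e1, rfl, -, h⟩ := insideGame_cases h
    simp only [Sum.inl.injEq, Prod.mk.injEq] at e1
    obtain ⟨rfl, rfl⟩ := e1
    exact ⟨q', h⟩
  · rintro ⟨p', h⟩
    exact ⟨.inl (A, p'), insideGame_inl.2 ⟨hA, rfl, h⟩⟩

/-- In the four days of a left-out round a team is away on the first and the last or on the two
middle days. -/
theorem away_leftover (ht : t < 4 * r) {A : Fin m} (hA : (A : ℕ) + 1 < m) {h : Fin 2}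
    {a : Fin k} : (∃ v, tailGame D₁ D₂ t (.inl (A, h, a)) v) ↔ ((h : ℕ) = t % 2 ↔ t % 4 < 2) := by
  have hu : toFixed (.inl (A, h, a) : Team k m r) = none := toFixed_eq_none.2 ⟨A, _, rfl, hA⟩
  simp only [tailGame_leftover ht hu]
  by_cases hh : (h : ℕ) = t % 2
  · constructor
    · rintro ⟨v, ⟨h1, -⟩ | ⟨-, h1⟩⟩
      · omega
      · obtain ⟨A1, h1, a1, B1, h1', b1, rfl, e0, f1, f2, f3, f4, f5, f6⟩ := leftoverPair_cases h1
        simp only [Sum.inl.injEq, Prod.mk.injEq] at e0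
        obtain ⟨rfl, rfl, rfl⟩ := e0
        omega
    · intro h1
      obtain ⟨v, hv⟩ := exists_leftoverPair_right (r := r) (t / 4) (q := t % 4) a hA
        (show (h : ℕ) = t % 4 % 2 by omega)
      exact ⟨v, Or.inl ⟨by omega, hv⟩⟩
  · constructor
    · rintro ⟨v, ⟨-, h1⟩ | ⟨h1, -⟩⟩
      · obtain ⟨A1, h1, a1, B1, h1', b1, e0, rfl, f1, f2, f3, f4, f5, f6⟩ := leftoverPair_cases h1
        simp only [Sum.inl.injEq, Prod.mk.injEq] at e0
        obtain ⟨rfl, rfl, rfl⟩ := e0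
        omega
      · omega
    · intro h1
      obtain ⟨v, hv⟩ := exists_leftoverPair_left (r := r) (t / 4) (q := t % 4) a hA
        (show (h : ℕ) ≠ t % 4 % 2 by omega)
      exact ⟨v, Or.inr ⟨by omega, hv⟩⟩

theorem tailGame_asymm (hD₁ : IsTTP 2 D₁) (hD₂ : ∀ A, IsTTP 2 (D₂ A))
    (ht : t < 4 * k + 4 * r - 2) (h : tailGame D₁ D₂ t u v) : ¬ tailGame D₁ D₂ t v u := by
  intro h'
  rcases hu : toFixed u with _ | u'
  · have hv := (tailGame_free_iff h).1 hu
    rcases Nat.lt_or_ge t (4 * r) with h1 | h1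
    · rw [tailGame_leftover h1 hu] at h
      rw [tailGame_leftover h1 hv] at h'
      rcases h with ⟨h2, h⟩ | ⟨h2, h⟩ <;> rcases h' with ⟨h3, h'⟩ | ⟨h3, h'⟩
      · obtain ⟨A, h, a, B, h', b, rfl, rfl, e1, e2, e3, e4, e5, e6⟩ := leftoverPair_cases h
        have := (leftoverPair_inl.1 h').2.2.1
        omega
      · exact h2 h3
      · exact h3 h2
      · obtain ⟨A, h, a, B, h', b, rfl, rfl, e1, e2, e3, e4, e5, e6⟩ := leftoverPair_cases h
        have := (leftoverPair_inl.1 h').2.2.1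
        omega
    · rw [tailGame_inside h1 hu] at h
      rw [tailGame_inside h1 hv] at h'
      obtain ⟨A, p, p', rfl, rfl, h2, h⟩ := insideGame_cases h
      exact (hD₂ A).asymm _ (by rw [days_superTeam]; omega) _ _ h (insideGame_inl.1 h').2.2
  · rcases hv : toFixed v with _ | v'
    · rw [(tailGame_free_iff h).2 hv] at hu
      simp at hu
    · rw [tailGame_fixed hu hv] at h
      rw [tailGame_fixed hv hu] at h'
      exact hD₁.asymm _ (by rw [days_fixedTeam]; omega) _ _ h h'

theorem tailGame_one_game (hm : 0 < m) (hD₁ : IsTTP 2 D₁) (hD₂ : ∀ A, IsTTP 2 (D₂ A))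
    (ht : t < 4 * k + 4 * r - 2) (u : Team k m r) : ∃! v, Plays (tailGame D₁ D₂) t u v := by
  rcases hu : toFixed u with _ | u'
  · obtain ⟨A, ⟨h, a⟩, rfl, hA⟩ := toFixed_eq_none.1 hu
    rcases Nat.lt_or_ge t (4 * r) with h1 | h1
    · simp only [plays_leftover h1 hu]
      by_cases hh : (h : ℕ) = t % 4 % 2
      · obtain ⟨v, hv⟩ := exists_leftoverPair_right (r := r) (t / 4) a hA hh
        refine ⟨v, Or.inl hv, ?_⟩
        rintro w (hw | hw)
        · exact leftoverPair_right_unique hw hv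
        · obtain ⟨A1, h1, a1, B1, h1', b1, rfl, e0, f1, f2, f3, f4, f5, f6⟩ := leftoverPair_cases hw
          simp only [Sum.inl.injEq, Prod.mk.injEq] at e0
          obtain ⟨rfl, rfl, rfl⟩ := e0
          omega
      · obtain ⟨v, hv⟩ := exists_leftoverPair_left (r := r) (t / 4) a hA hh
        refine ⟨v, Or.inr hv, ?_⟩
        rintro w (hw | hw)
        · exact absurd (leftoverPair_cases hw) (by
            rintro ⟨A1, h1, a1, B1, h1', b1, e0, rfl, f1, f2, f3, f4, f5, f6⟩
            simp only [Sum.inl.injEq, Prod.mk.injEq] at e0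
            obtain ⟨rfl, rfl, rfl⟩ := e0
            exact hh f4)
        · exact leftoverPair_left_unique hw hv
    · simp only [plays_inside h1 hA]
      obtain ⟨p', hp', hu'⟩ := (hD₂ A).one_game (t - 4 * r) (by rw [days_superTeam]; omega) (h, a)
      refine ⟨_, ⟨p', rfl, hp'⟩, ?_⟩
      rintro w ⟨p'', rfl, h2⟩
      rw [hu' p'' h2]
  · obtain ⟨v', hv', hun⟩ := hD₁.one_game t (by rw [days_fixedTeam]; omega) u'
    obtain ⟨v, hv⟩ := exists_toFixed hm v'
    refine ⟨v, (plays_fixed hu hv).2 hv', ?_⟩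
    intro w hw
    rcases hw' : toFixed w with _ | w'
    · rw [(plays_free_iff hw).2 hw'] at hu
      simp at hu
    · rw [hun w' ((plays_fixed hu hw').1 hw)] at hw'
      exact toFixed_inj hw' hv

/-- The distances `2i + 1` of the super-teams that meet in the left-out rounds are distinct, also
as distances in the other direction of the circle. -/
theorem add_mod_ne {M a b i i' : ℕ} (hM : M % 2 = 1) (ha : a < M)
    (hi : i + i' + 1 < M) (h : b = (a + (2 * i + 1)) % M) : a ≠ (b + (2 * i' + 1)) % M := by
  intro h'
  rw [h, Nat.mod_add_mod] at h'
  have h1 : a + 0 ≡ a + (2 * (i + i' + 1)) [MOD M] := by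
    rw [add_zero, Nat.ModEq, Nat.mod_eq_of_lt ha]
    rw [show a + 2 * (i + i' + 1) = a + (2 * i + 1) + (2 * i' + 1) by ring]
    exact h'
  have h2 := Nat.ModEq.add_left_cancel' a h1
  have h3 : M ∣ 2 * (i + i' + 1) := (Nat.modEq_zero_iff_dvd).1 h2.symm
  have h4 : Nat.Coprime M 2 := Nat.coprime_two_right.2 (Nat.odd_iff.2 hM)
  have := Nat.le_of_dvd (by omega) (h4.dvd_of_dvd_mul_left h3)
  omega

/-- Two super-teams meet in at most one of the left-out rounds, and their games on successive days of
this round are between different teams. -/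
theorem tailGame_no_repeat (hm : m % 2 = 0) (hr : 2 * r < m) (hD₁ : IsTTP 2 D₁)
    (hD₂ : ∀ A, IsTTP 2 (D₂ A)) (ht : t + 1 < 4 * k + 4 * r - 2)
    (h : Plays (tailGame D₁ D₂) t u v) : ¬ Plays (tailGame D₁ D₂) (t + 1) u v := by
  intro h'
  rcases hu : toFixed u with _ | u'
  · have hv := (plays_free_iff h).1 hu
    rcases Nat.lt_or_ge t (4 * r) with h1 | h1
    · rw [plays_leftover h1 hu] at h
      rename' h' => hrep
      wlog huv : leftoverPair (t / 4) (t % 4) u v generalizing u v with H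
      · exact H h.symm hrep.symm hv hu (h.resolve_left huv)
      obtain ⟨A, h, a, B, h', b, rfl, rfl, e1, e2, e3, e4, e5, e6⟩ := leftoverPair_cases huv
      rcases Nat.lt_or_ge (t + 1) (4 * r) with h2 | h2
      · have hp := hrep
        rw [plays_leftover h2 hu] at hp
        rcases hp with hp | hp
        · have := (leftoverPair_inl.1 hp).2.2.1
          omega
        · have := (leftoverPair_inl.1 hp).2.1
          exact add_mod_ne (M := m - 1) (by omega) (by omega) (by omega) e3 this
      · have hp := hrep
        rw [plays_inside h2 e1] at hp
        obtain ⟨p', ep, -⟩ := hp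
        simp only [Sum.inl.injEq, Prod.mk.injEq] at ep
        obtain ⟨rfl, -⟩ := ep
        have h3 : (B : ℕ) + 0 ≡ B + (2 * (t / 4) + 1) [MOD (m - 1)] := by
          rw [add_zero, Nat.ModEq, ← e3, Nat.mod_eq_of_lt (by omega)]
        have h4 := Nat.ModEq.add_left_cancel' _ h3
        have h5 := Nat.le_of_dvd (by omega) ((Nat.modEq_zero_iff_dvd).1 h4.symm)
        omega
    · obtain ⟨A, p, rfl, hA⟩ := toFixed_eq_none.1 hu
      rw [plays_inside h1 hA] at h
      rw [plays_inside (by omega) hA] at h'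
      obtain ⟨p1, rfl, h⟩ := h
      obtain ⟨p2, e, h'⟩ := h'
      simp only [Sum.inl.injEq, Prod.mk.injEq, true_and] at e
      subst e
      rw [show t + 1 - 4 * r = t - 4 * r + 1 by omega] at h'
      exact (hD₂ A).no_repeat _ (by rw [days_superTeam]; omega) _ _ h h'
  · rcases hv : toFixed v with _ | v'
    · rw [(plays_free_iff h).2 hv] at hu
      simp at hu
    · rw [plays_fixed hu hv] at h h'
      exact hD₁.no_repeat _ (by rw [days_fixedTeam]; omega) _ _ h h'

/-- Any two successive transitions after the super-games contain a change between home and away,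
or else the one before them is a transition after the super-games with a change. -/
theorem tailGame_change (hm : 0 < m) (hD₁ : IsTTP 2 D₁) (hD₂ : ∀ A, IsTTP 2 (D₂ A))
    (ht : t + 2 < 4 * k + 4 * r - 2) (u : Team k m r) :
    ((∃ v, tailGame D₁ D₂ t u v) ↔ ¬ ∃ v, tailGame D₁ D₂ (t + 1) u v) ∨
    ((∃ v, tailGame D₁ D₂ (t + 1) u v) ↔ ¬ ∃ v, tailGame D₁ D₂ (t + 2) u v) ∨
    (0 < t ∧ ((∃ v, tailGame D₁ D₂ (t - 1) u v) ↔ ¬ ∃ v, tailGame D₁ D₂ t u v)) := by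
  rcases hu : toFixed u with _ | u'
  · obtain ⟨A, ⟨h, a⟩, rfl, hA⟩ := toFixed_eq_none.1 hu
    have hleft : ∀ t, t % 2 = 0 → t + 1 < 4 * r →
        ((∃ v, tailGame D₁ D₂ t (.inl (A, h, a)) v) ↔
          ¬ ∃ v, tailGame D₁ D₂ (t + 1) (.inl (A, h, a)) v) := by
      intro t h1 h2
      rw [away_leftover (by omega) hA, away_leftover h2 hA]
      omega
    by_cases h1 : t + 1 < 4 * r
    · rcases Nat.mod_two_eq_zero_or_one t with h2 | h2
      · exact Or.inl (hleft t h2 h1)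
      · exact Or.inr (Or.inl (hleft (t + 1) (by omega) (by omega)))
    by_cases h2 : t + 1 = 4 * r
    · refine Or.inr (Or.inr ⟨by omega, ?_⟩)
      have := hleft (t - 1) (by omega) (by omega)
      rwa [Nat.sub_add_cancel (by omega)] at this
    · rw [away_inside (by omega) hA, away_inside (by omega) hA, away_inside (by omega) hA]
      rw [show t + 1 - 4 * r = t - 4 * r + 1 by omega, show t + 2 - 4 * r = t - 4 * r + 2 by omega]
      obtain ⟨j, hj, hc⟩ := (hD₂ A).exists_change (d := t - 4 * r)
        (by rw [days_superTeam]; omega) (h, a)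
      interval_cases j
      · exact Or.inl hc
      · exact Or.inr (Or.inl hc)
  · simp only [away_fixed hm hu]
    obtain ⟨j, hj, hc⟩ := hD₁.exists_change (d := t) (by rw [days_fixedTeam]; omega) u'
    interval_cases j
    · exact Or.inl hc
    · exact Or.inr (Or.inl hc)

end TailDays

/-! ### Feasibility of the construction -/

section Feasible

variable {k μ r : ℕ} {z : Team k (2 * μ) r → ℝ}
  {D₁ : ℕ → FixedTeam k r → FixedTeam k r → Prop}
  {D₂ : Fin (2 * μ) → ℕ → SuperTeam k → SuperTeam k → Prop}

theorem plays_packGame_tail {t : ℕ} {u v : Team k (2 * μ) r} :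
    Plays (packGame z D₁ D₂) (4 * k * (2 * μ - 1) + t) u v ↔ Plays (tailGame D₁ D₂) t u v := by
  unfold Plays
  rw [packGame_tail, packGame_tail]

theorem packGame_no_repeat_boundary (hk : 3 ≤ k) (hr : r < μ) {d : ℕ}
    (hd : d + 1 = 4 * k * (2 * μ - 1)) {u v : Team k (2 * μ) r}
    (h : Plays (packGame z D₁ D₂) d u v) : ¬ Plays (packGame z D₁ D₂) (d + 1) u v := by
  intro h'
  rw [hd, ← add_zero (4 * k * (2 * μ - 1)), plays_packGame_tail] at h'
  obtain ⟨s, q, hs, hq, rfl⟩ := exists_slot_day (show d < 4 * k * (2 * μ - 1) by omega)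
  obtain ⟨j, hj, hu⟩ := exists_inCol hr.le hs u
  rw [plays_of_inCol hs hq hj hu] at h
  clear hu hd
  rename' h' => hrep
  wlog huv : colPair z s j q u v generalizing u v with H
  · exact H hrep.symm h.symm (h.resolve_left huv)
  obtain ⟨hu, hv⟩ := colPair_sides huv
  have hne := tailSide_ne_headSide hs hj
  rcases hu0 : toFixed u with _ | u'
  · have hv0 := (plays_free_iff hrep).1 hu0
    obtain ⟨A, ⟨i, a⟩, rfl, hA⟩ := toFixed_eq_none.1 hu0
    obtain ⟨B, ⟨i', b⟩, rfl, hB⟩ := toFixed_eq_none.1 hv0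
    rw [OnTail, onSide_inl] at hu
    rw [OnHead, onSide_inl] at hv
    rcases Nat.eq_zero_or_pos r with hr0 | hr0
    · subst hr0
      rw [plays_inside (by omega) hA] at hrep
      obtain ⟨p', e, -⟩ := hrep
      simp only [Sum.inl.injEq, Prod.mk.injEq] at e
      obtain ⟨rfl, -⟩ := e
      exact hne (hu.symm.trans hv)
    · rw [plays_leftover (by omega) hu0] at hrep
      have hul : (upper (2 * μ) s j = A ∧ lower (2 * μ) s j = B) ∨
          (upper (2 * μ) s j = B ∧ lower (2 * μ) s j = A) := by
        rw [hu, hv]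
        unfold tailSide headSide
        split_ifs
        · exact Or.inl ⟨rfl, rfl⟩
        · exact Or.inr ⟨rfl, rfl⟩
      have hmod : ∀ x : ℕ, x = 2 * k - 1 → x % (2 * k + 1) = (2 * (2 * k)) % (2 * k + 1) := by
        rintro x rfl
        rw [show 2 * (2 * k) = (2 * k - 1) + (2 * k + 1) by omega, Nat.add_mod_right]
      rcases hrep with hrep | hrep
      · obtain ⟨-, e2, -, e4⟩ := leftoverPair_inl.1 hrep
        have := column_of_distance hs hj hA (i := 0) (by omega) e2 hul
        exact colPair_not_leftover hq (by omega) huv (hmod _ e4)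
      · obtain ⟨-, e2, -, e4⟩ := leftoverPair_inl.1 hrep
        have := column_of_distance hs hj hB (i := 0) (by omega) e2 hul.symm
        rw [add_comm] at e4
        exact colPair_not_leftover hq (by omega) huv (hmod _ e4)
  · rcases hv0 : toFixed v with _ | v'
    · rw [(plays_free_iff hrep).2 hv0] at hu0
      simp at hu0
    have col0 : ∀ (A : Fin (2 * μ)) (p : Fin 2 × Fin k),
        toFixed (.inl (A, p) : Team k (2 * μ) r) ≠ none →
        InCol s j (.inl (A, p) : Team k (2 * μ) r) → (A : ℕ) + 1 = 2 * μ ∧ j = 0 := by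
      intro A p h1 h2
      have hA : (A : ℕ) + 1 = 2 * μ := by
        by_contra h3
        exact h1 (toFixed_eq_none.2 ⟨A, p, rfl, by omega⟩)
      refine ⟨hA, ?_⟩
      refine inColumn_unique hs hj (by omega) (inCol_inl.1 h2) (inColumn_iff.2 (Or.inl ?_))
      rw [upper_zero]; omega
    rcases u with ⟨A, p⟩ | p <;> rcases v with ⟨B, p'⟩ | p'
    · have h1 := (col0 A p (by simp [hu0]) (Or.inl hu)).1
      have h2 := (col0 B p' (by simp [hv0]) (Or.inr hv)).1
      have h3 : tailSide (2 * μ) s j = A := hu.symm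
      have h4 : headSide (2 * μ) s j = B := hv.symm
      omega
    · have h1 := (col0 A p (by simp [hu0]) (Or.inl hu)).2
      have h2 := hv.1
      have := p'.1.2
      omega
    · have h1 := (col0 B p' (by simp [hv0]) (Or.inr hv)).2
      have h2 := hu.1
      have := p.1.2
      omega
    · exact colPair_not_inr hq hj huv ⟨p, p', rfl, rfl⟩

theorem colRev_decode (μ r s j : ℕ) {H c l : ℕ} (hc : c < 2) (hl : l < k) :
    colRev k μ r s j (2 * k * H + k * c + l) ↔
      if μ - r ≤ j then Xor (c = 1) (l = k - 2)
      else if j = 0 ∨ s = 2 * μ - 2 then Xor (c = 1) (l = k - 1) else c = 1 := by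
  obtain ⟨-, e2, e3⟩ := day_decode (H := H) hc hl
  unfold colRev
  rw [e2, e3]

/-- The schedule changes venues before the round with index `k - 2` of a right super-game. -/
theorem colRev_right_change (s : ℕ) {j H c : ℕ} (hk : 3 ≤ k) (hc : c < 2) (hj : μ - r ≤ j) :
    colRev k μ r s j (2 * k * H + k * c + (k - 3)) ↔
      ¬ colRev k μ r s j (2 * k * H + k * c + (k - 3) + 1) := by
  rw [add_assoc _ (k - 3) 1, show k - 3 + 1 = k - 2 by omega, colRev_decode μ r s j hc (by omega),
    colRev_decode μ r s j hc (by omega), if_pos hj, if_pos hj]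
  have h1 : ¬ k - 3 = k - 2 := by omega
  simp only [Xor, h1, not_false_eq_true, and_true, not_true_eq_false, and_false, true_and,
    or_false, false_or, not_not, false_and]

/-- The schedule changes venues before the last round of a left or right cycle-game. -/
theorem colRev_last_change {s j H c : ℕ} (hk : 3 ≤ k) (hc : c < 2)
    (hj : μ - r ≤ j ∨ j = 0 ∨ s = 2 * μ - 2) :
    colRev k μ r s j (2 * k * H + k * c + (k - 2)) ↔
      ¬ colRev k μ r s j (2 * k * H + k * c + (k - 2) + 1) := by
  rw [add_assoc _ (k - 2) 1, show k - 2 + 1 = k - 1 by omega, colRev_decode μ r s j hc (by omega),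
    colRev_decode μ r s j hc (by omega)]
  have h1 : ¬ k - 2 = k - 1 := by omega
  have h2 : ¬ k - 1 = k - 2 := by omega
  by_cases hr : μ - r ≤ j
  · rw [if_pos hr, if_pos hr]
    simp only [Xor, h2, not_false_eq_true, and_true, not_true_eq_false, and_false, true_and,
      or_false, false_or, false_and]
  · rw [if_neg hr, if_neg hr, if_pos (hj.resolve_left hr), if_pos (hj.resolve_left hr)]
    simp only [Xor, h1, not_false_eq_true, and_true, not_true_eq_false, and_false, true_and,
      or_false, false_or, not_not, false_and]

/-- The schedule changes venues between any two parts of a normal or right super-game. -/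
theorem colRev_part_change {s j q : ℕ} (hk : 3 ≤ k) (hq : q % k = k - 1) (hq' : q + 1 < 4 * k)
    (hj : μ - r ≤ j ∨ ¬ (j = 0 ∨ s = 2 * μ - 2)) :
    colRev k μ r s j q ↔ ¬ colRev k μ r s j (q + 1) := by
  obtain ⟨H, c, l, hH, hc, hl, rfl⟩ := exists_day_decode (show q < 4 * k by omega)
  rw [(day_decode hc hl).2.2] at hq
  subst hq
  have key : ∀ H' c', c' < 2 → c' ≠ c →
      2 * k * H + k * c + (k - 1) + 1 = 2 * k * H' + k * c' + 0 →
      (colRev k μ r s j (2 * k * H + k * c + (k - 1)) ↔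
      ¬ colRev k μ r s j (2 * k * H + k * c + (k - 1) + 1)) := by
    intro H' c' hc' hne e
    rw [e, colRev_decode μ r s j hc hl, colRev_decode μ r s j hc' (by omega)]
    have h1 : ¬ k - 1 = k - 2 := by omega
    have h2 : ¬ 0 = k - 2 := by omega
    by_cases hr : μ - r ≤ j
    · rw [if_pos hr, if_pos hr]
      simp only [Xor, h1, h2, not_false_eq_true, and_true, or_false, false_and]
      omega
    · rw [if_neg hr, if_neg hr, if_neg (hj.resolve_left hr), if_neg (hj.resolve_left hr)]
      omega
  interval_cases c
  · exact key H 1 (by omega) (by omega) (by omega)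
  · exact key (H + 1) 0 (by omega) (by omega) (by rw [mul_add]; omega)

theorem packGame_change_pair (hk : 3 ≤ k) {d : ℕ} (hd : d + k < 4 * k * (2 * μ - 1))
    (hr : r < μ) (p : Fin r × Fin 2) : ∃ j, j < k ∧
      ((∃ v, packGame z D₁ D₂ (d + j) (.inr p) v) ↔
        ¬ ∃ v, packGame z D₁ D₂ (d + j + 1) (.inr p) v) := by
  -- the day before the next one of the form `ck + k - 2`
  obtain ⟨i, hi, hmod⟩ : ∃ i, i < k ∧ (d + i) % k = k - 3 := by
    have h1 := Nat.div_add_mod (d + 2) k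
    have h2 := Nat.mod_lt (d + 2) (show 0 < k by omega)
    refine ⟨k * ((d + 2) / k) + (k - 3) - d, by omega, ?_⟩
    rw [show d + (k * ((d + 2) / k) + (k - 3) - d) = k * ((d + 2) / k) + (k - 3) by omega,
      Nat.mul_add_mod, Nat.mod_eq_of_lt (by omega)]
  refine ⟨i, hi, ?_⟩
  obtain ⟨s, q, hs, hq, e⟩ := exists_slot_day (show d + i < 4 * k * (2 * μ - 1) by omega)
  obtain ⟨j, hj, hu⟩ := exists_inCol hr.le hs (.inr p : Team k (2 * μ) r)
  rw [e] at hmod ⊢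
  rw [show 4 * k * s + q = k * (4 * s) + q by ring, Nat.mul_add_mod] at hmod
  obtain ⟨H, c, l, hH, hc, hl, rfl⟩ := exists_day_decode hq
  rw [(day_decode hc hl).2.2] at hmod
  subst hmod
  have hp := p.1.2
  have := inCol_inr.1 hu
  refine away_change hs ?_ hj hu (colRev_right_change s hk hc (by omega))
  have := day_lt hH hc (show k - 2 < k by omega)
  omega

theorem packGame_change_super (hk : 3 ≤ k) {d : ℕ} (hd : d + k < 4 * k * (2 * μ - 1))
    (hr : r < μ) (A : Fin (2 * μ)) (p : Fin 2 × Fin k) : ∃ j, j < k ∧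
      ((∃ v, packGame z D₁ D₂ (d + j) (.inl (A, p)) v) ↔
        ¬ ∃ v, packGame z D₁ D₂ (d + j + 1) (.inl (A, p)) v) := by
  -- the day before the next multiple of `k`
  obtain ⟨i, hi, hmod⟩ : ∃ i, i < k ∧ (d + i) % k = k - 1 := by
    have h1 := Nat.div_add_mod d k
    have h2 := Nat.mod_lt d (show 0 < k by omega)
    refine ⟨k * (d / k) + (k - 1) - d, by omega, ?_⟩
    rw [show d + (k * (d / k) + (k - 1) - d) = k * (d / k) + (k - 1) by omega,
      Nat.mul_add_mod, Nat.mod_eq_of_lt (by omega)]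
  obtain ⟨s, q, hs, hq, e⟩ := exists_slot_day (show d + i < 4 * k * (2 * μ - 1) by omega)
  have hqm : q % k = k - 1 := by
    rw [← hmod, e, show 4 * k * s + q = k * (4 * s) + q by ring, Nat.mul_add_mod]
  by_cases hq4 : q + 1 < 4 * k
  · obtain ⟨j, hj, hu⟩ := exists_inCol hr.le hs (.inl (A, p) : Team k (2 * μ) r)
    by_cases hnr : μ - r ≤ j ∨ ¬ (j = 0 ∨ s = 2 * μ - 2)
    · refine ⟨i, hi, ?_⟩
      rw [e]
      exact away_change hs hq4 hj hu (colRev_part_change hk hqm hq4 hnr)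
    · have hL : μ - r ≤ j ∨ j = 0 ∨ s = 2 * μ - 2 := by tauto
      obtain ⟨H, c, l, hH, hc, hl, rfl⟩ := exists_day_decode hq
      rw [(day_decode hc hl).2.2] at hqm
      subst hqm
      -- the last round before the multiple of `k`, or the last round of the next part
      rcases Nat.eq_zero_or_pos i with hi0 | hi0
      · have main : ∀ H' c', H' < 2 → c' < 2 →
            2 * k * H + k * c + (k - 1) + (k - 1) = 2 * k * H' + k * c' + (k - 2) →
            ((∃ v, packGame z D₁ D₂ (d + (k - 1)) (.inl (A, p)) v) ↔
              ¬ ∃ v, packGame z D₁ D₂ (d + (k - 1) + 1) (.inl (A, p)) v) := by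
          intro H' c' hH' hc' e'
          have := day_lt hH' hc' (show k - 1 < k by omega)
          rw [show d + (k - 1) = 4 * k * s + (2 * k * H' + k * c' + (k - 2)) by omega]
          exact away_change hs (by omega) hj hu (colRev_last_change hk hc' hL)
        refine ⟨k - 1, by omega, ?_⟩
        interval_cases c
        · exact main H 1 hH (by omega) (by omega)
        · have hH1 : H = 0 := by
            interval_cases H
            · rfl
            · omega
          exact main 1 0 (by omega) (by omega) (by subst hH1; omega)
      · refine ⟨i - 1, by omega, ?_⟩
        have := day_lt hH hc (show k - 1 < k by omega)
        rw [show d + (i - 1) = 4 * k * s + (2 * k * H + k * c + (k - 2)) by omega]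
        exact away_change hs (by omega) hj hu (colRev_last_change hk hc hL)
  · refine ⟨i, hi, ?_⟩
    obtain rfl : q = 4 * k - 1 := by omega
    have hs2 : s + 2 < 2 * μ := by
      have h1 : 4 * k * (s + 1) < 4 * k * (2 * μ - 1) := by
        rw [mul_add]; omega
      have := Nat.lt_of_mul_lt_mul_left h1
      omega
    rw [e, show 4 * k * s + (4 * k - 1) + 1 = 4 * k * (s + 1) + 0 by rw [mul_add]; omega]
    exact away_change_boundary hk hr hs2 A p

theorem packGame_change_last (hk : 3 ≤ k) (hr : r < μ) {d : ℕ}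
    (hd : d + 2 = 4 * k * (2 * μ - 1)) (u : Team k (2 * μ) r) :
      ((∃ v, packGame z D₁ D₂ d u v) ↔ ¬ ∃ v, packGame z D₁ D₂ (d + 1) u v) := by
  have hs : 2 * μ - 2 + 1 < 2 * μ := by omega
  obtain ⟨j, hj, hu⟩ := exists_inCol hr.le hs u
  have e : d = 4 * k * (2 * μ - 2) + (2 * k * 1 + k * 1 + (k - 2)) := by
    rw [show 2 * μ - 1 = 2 * μ - 2 + 1 by omega, mul_add] at hd
    omega
  rw [e]
  exact away_change hs (by omega) hj hu
    (colRev_last_change hk (by omega) (Or.inr (Or.inr rfl)))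

/-- Every team changes between home and away during any `k` successive transitions, so that its
home stands and road trips have at most `k` games. -/
theorem packGame_change (hk : 3 ≤ k) (hr : r < μ) (hD₁ : IsTTP 2 D₁) (hD₂ : ∀ A, IsTTP 2 (D₂ A))
    {d : ℕ} (hd : d + k < 4 * k * (2 * μ - 1) + (4 * k + 4 * r - 2)) (u : Team k (2 * μ) r) :
    ∃ j, j < k ∧ ((∃ v, packGame z D₁ D₂ (d + j) u v) ↔
        ¬ ∃ v, packGame z D₁ D₂ (d + j + 1) u v) := by
  rcases Nat.lt_or_ge (d + k) (4 * k * (2 * μ - 1)) with h1 | h1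
  · rcases u with ⟨A, p⟩ | p
    · exact packGame_change_super hk h1 hr A p
    · exact packGame_change_pair hk h1 hr p
  rcases Nat.lt_or_ge (d + 1) (4 * k * (2 * μ - 1)) with h2 | h2
  · refine ⟨4 * k * (2 * μ - 1) - 2 - d, by omega, packGame_change_last hk hr (by omega) u⟩
  · obtain ⟨t, ht⟩ : ∃ t, d + 1 = 4 * k * (2 * μ - 1) + t := ⟨d + 1 - 4 * k * (2 * μ - 1), by omega⟩
    rcases tailGame_change (t := t) (show 0 < 2 * μ by omega) hD₁ hD₂ (by omega) u with h | h | h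
    · refine ⟨1, by omega, ?_⟩
      rw [ht, add_assoc _ t 1]
      simp only [packGame_tail]
      exact h
    · refine ⟨2, by omega, ?_⟩
      rw [show d + 2 = 4 * k * (2 * μ - 1) + (t + 1) by omega, add_assoc _ (t + 1) 1]
      simp only [packGame_tail]
      exact h
    · refine ⟨0, by omega, ?_⟩
      rw [add_zero, ht, show d = 4 * k * (2 * μ - 1) + (t - 1) by omega]
      simp only [packGame_tail]
      exact h.2

/-- Two teams on opposite sides of a column meet there at both venues, unless their game is left
out. -/
theorem exists_packGame_of_sides {s j : ℕ} (hs : s + 1 < 2 * μ) (hj : j < μ)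
    {u v : Team k (2 * μ) r} (huv : (OnTail s j u ∧ OnHead s j v) ∨ (OnHead s j u ∧ OnTail s j v))
    (hl : μ - r ≤ j → (extIdx u + extIdx v) % (2 * k + 1) ≠ (2 * (2 * k)) % (2 * k + 1)) :
    ∃ d, d < 4 * k * (2 * μ - 1) ∧ packGame z D₁ D₂ d u v := by
  rcases huv with ⟨hu, hv⟩ | ⟨hu, hv⟩
  · obtain ⟨q, hq, h, hr⟩ := exists_colPair_day z hj hu hv hl False
    exact ⟨_, slot_lt hs hq, (packGame_super hs hq).2 ⟨j, hj, Or.inl ⟨by tauto, h⟩⟩⟩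
  · obtain ⟨q, hq, h, hr⟩ := exists_colPair_day z hj hv hu (by rwa [add_comm]) True
    exact ⟨_, slot_lt hs hq, (packGame_super hs hq).2 ⟨j, hj, Or.inr ⟨by tauto, h⟩⟩⟩

theorem exists_tailGame_leftover {A B : Fin (2 * μ)} {h h' : Fin 2} {a b : Fin k} {i : ℕ}
    (hi : i < r) (hA : (A : ℕ) + 1 < 2 * μ) (hB : (B : ℕ) = (A + (2 * i + 1)) % (2 * μ - 1))
    (hs : (h * k + a : ℕ) + (h' * k + b) = 2 * k - 1) :
    (∃ t, t < 4 * r ∧ tailGame D₁ D₂ t (.inl (A, h, a) : Team k (2 * μ) r) (.inl (B, h', b))) ∧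
    (∃ t, t < 4 * r ∧ tailGame D₁ D₂ t (.inl (B, h', b) : Team k (2 * μ) r) (.inl (A, h, a))) := by
  constructor
  · refine ⟨4 * i + h, by omega, Or.inr (Or.inl ⟨by omega, Or.inl ⟨by omega, ?_⟩⟩)⟩
    rw [show (4 * i + (h : ℕ)) / 4 = i by omega]
    exact leftoverPair_inl.2 ⟨hA, hB, by omega, hs⟩
  · refine ⟨4 * i + h + 2, by omega, Or.inr (Or.inl ⟨by omega, Or.inr ⟨by omega, ?_⟩⟩)⟩
    rw [show (4 * i + (h : ℕ) + 2) / 4 = i by omega]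
    exact leftoverPair_inl.2 ⟨hA, hB, by omega, hs⟩

theorem mod_eq_leftover {x : ℕ} (hk : 0 < k) (hx : x < 4 * k)
    (h : x % (2 * k + 1) = (2 * (2 * k)) % (2 * k + 1)) : x = 2 * k - 1 := by
  rw [show 2 * (2 * k) = (2 * k - 1) + (2 * k + 1) by omega, Nat.add_mod_right,
    Nat.mod_eq_of_lt (show 2 * k - 1 < 2 * k + 1 by omega)] at h
  rcases Nat.lt_or_ge x (2 * k + 1) with h1 | h1
  · rwa [Nat.mod_eq_of_lt h1] at h
  · rw [Nat.mod_eq_sub_mod h1, Nat.mod_eq_of_lt (by omega)] at h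
    omega

theorem exists_packGame_inl_inl (hk : 3 ≤ k) (hr : r < μ) {A B : Fin (2 * μ)} (hAB : A ≠ B)
    (h h' : Fin 2) (a b : Fin k) : ∃ d, d < 4 * k * (2 * μ - 1) + (4 * k + 4 * r - 2) ∧
      packGame z D₁ D₂ d (.inl (A, h, a)) (.inl (B, h', b)) := by
  obtain ⟨s, j, hs, hj, hsj⟩ := exists_slot A.2 B.2 (fun e => hAB (Fin.ext e))
  by_cases hl : μ - r ≤ j ∧ ((h * k + a : ℕ) + (h' * k + b)) % (2 * k + 1)
      = (2 * (2 * k)) % (2 * k + 1)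
  · obtain ⟨hj1, hl⟩ := hl
    have i1 := inl_idx_lt h a
    have i2 := inl_idx_lt h' b
    have hsum := mod_eq_leftover (by omega) (by omega) hl
    have h0 : j ≠ 0 := by omega
    have hlow := lower_eq_of_upper hs hj h0
    rw [show 2 * μ - 1 - 2 * j = 2 * (μ - 1 - j) + 1 by omega] at hlow
    have hup : upper (2 * μ) s j + 1 < 2 * μ :=
      InColumn.lt_pred hs hj h0 (inColumn_iff.2 (Or.inl rfl))
    have hcase : (upper (2 * μ) s j = A ∧ lower (2 * μ) s j = B) ∨
        (upper (2 * μ) s j = B ∧ lower (2 * μ) s j = A) := by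
      unfold tailSide headSide at hsj
      split_ifs at hsj <;> tauto
    suffices H : ∃ t, t < 4 * r ∧
        tailGame D₁ D₂ t (.inl (A, h, a) : Team k (2 * μ) r) (.inl (B, h', b)) by
      obtain ⟨t, ht, hg⟩ := H
      exact ⟨_, by omega, packGame_tail.2 hg⟩
    rcases hcase with ⟨e1, e2⟩ | ⟨e1, e2⟩
    · rw [e1, e2] at hlow
      exact (exists_tailGame_leftover (by omega) (by omega) hlow hsum).1
    · rw [e1, e2] at hlow
      rw [add_comm] at hsum
      exact (exists_tailGame_leftover (by omega) (by omega) hlow hsum).2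
  · obtain ⟨d, hd, hg⟩ := exists_packGame_of_sides (z := z) (D₁ := D₁) (D₂ := D₂) hs hj
      (u := .inl (A, h, a)) (v := .inl (B, h', b))
      (hsj.imp (fun e => ⟨e.1.symm, e.2.symm⟩) (fun e => ⟨e.2.symm, e.1.symm⟩))
      (fun h1 h2 => hl ⟨h1, h2⟩)
    exact ⟨d, by omega, hg⟩

theorem exists_packGame_inl_inr (hr : r < μ) {A : Fin (2 * μ)} (hA : (A : ℕ) + 1 < 2 * μ)
    (h : Fin 2) (a : Fin k) (p : Fin r × Fin 2) :
    (∃ d, d < 4 * k * (2 * μ - 1) ∧ packGame z D₁ D₂ d (.inl (A, h, a)) (.inr p)) ∧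
    (∃ d, d < 4 * k * (2 * μ - 1) ∧ packGame z D₁ D₂ d (.inr p) (.inl (A, h, a))) := by
  have hp := p.1.2
  obtain ⟨j, hj, h0, hpj⟩ : ∃ j, j < μ ∧ j ≠ 0 ∧ (p.1 : ℕ) = μ - 1 - j :=
    ⟨μ - 1 - p.1, by omega, by omega, by omega⟩
  have hl : μ - r ≤ j →
      (extIdx (.inl (A, h, a) : Team k (2 * μ) r) + extIdx (.inr p : Team k (2 * μ) r))
      % (2 * k + 1) ≠ (2 * (2 * k)) % (2 * k + 1) := by
    intro _ e
    rw [extIdx_inl, extIdx_inr, two_mul (2 * k)] at e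
    have h1 := inl_idx_lt h a
    have h2 := Nat.ModEq.add_right_cancel' (2 * k) e
    have := Nat.ModEq.eq_of_lt_of_lt h2 (by omega) (by omega)
    omega
  have hsides : ∃ s, s + 1 < 2 * μ ∧
      ((OnTail s j (.inl (A, h, a) : Team k (2 * μ) r) ∧ OnHead s j (.inr p : Team k (2 * μ) r)) ∨
      (OnHead s j (.inl (A, h, a) : Team k (2 * μ) r) ∧
        OnTail s j (.inr p : Team k (2 * μ) r))) := by
    -- the first team of the pair always plays against the lower super-team
    by_cases hc : p.2 = 0
    · obtain ⟨s, hs, e⟩ := exists_lower_eq hj hA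
      refine ⟨s, hs, ?_⟩
      have h1 := onTail_of_lower (k := k) (r := r) (s := s) (j := j) (u := .inl (A, h, a)) e.symm
      have h2 := onTail_of_upper (k := k) (μ := μ) (r := r) (s := s) (j := j) (u := .inr p)
        ⟨hpj, by rw [hc]; rfl⟩
      split_ifs at h1 h2
      · exact Or.inr ⟨h1, h2⟩
      · exact Or.inl ⟨h1, h2⟩
    · obtain ⟨s, hs, e⟩ := exists_upper_eq hj h0 hA
      refine ⟨s, hs, ?_⟩
      have h1 := onTail_of_upper (k := k) (r := r) (s := s) (j := j) (u := .inl (A, h, a)) e.symm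
      have h2 := onTail_of_lower (k := k) (μ := μ) (r := r) (s := s) (j := j) (u := .inr p)
        ⟨hpj, by omega⟩
      split_ifs at h1 h2
      · exact Or.inl ⟨h1, h2⟩
      · exact Or.inr ⟨h1, h2⟩
  obtain ⟨s, hs, hsd⟩ := hsides
  refine ⟨exists_packGame_of_sides hs hj hsd hl, exists_packGame_of_sides hs hj ?_ ?_⟩
  · exact hsd.symm.imp And.symm And.symm
  · rwa [add_comm]

theorem exists_packGame (hk : 3 ≤ k) (hr : r < μ) (hD₁ : IsTTP 2 D₁) (hD₂ : ∀ A, IsTTP 2 (D₂ A))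
    {u v : Team k (2 * μ) r} (huv : u ≠ v) :
    ∃ d, d < 4 * k * (2 * μ - 1) + (4 * k + 4 * r - 2) ∧ packGame z D₁ D₂ d u v := by
  have fixed : ∀ u' v', toFixed u = some u' → toFixed v = some v' →
      ∃ d, d < 4 * k * (2 * μ - 1) + (4 * k + 4 * r - 2) ∧ packGame z D₁ D₂ d u v := by
    intro u' v' hu hv
    have hne : u' ≠ v' := by
      rintro rfl
      exact huv (toFixed_inj hu hv)
    obtain ⟨t, ⟨ht, hg⟩, -⟩ := hD₁.double_round u' v' hne
    rw [days_fixedTeam] at ht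
    exact ⟨_, by omega, packGame_tail.2 ((tailGame_fixed hu hv).2 hg)⟩
  rcases u with ⟨A, h, a⟩ | p <;> rcases v with ⟨B, h', b⟩ | p'
  · by_cases hAB : A = B
    · subst hAB
      by_cases hA : (A : ℕ) + 1 < 2 * μ
      · have hne : ((h, a) : Fin 2 × Fin k) ≠ (h', b) := by
          intro e
          exact huv (by rw [e])
        obtain ⟨t, ⟨ht, hg⟩, -⟩ := (hD₂ A).double_round _ _ hne
        rw [days_superTeam] at ht
        refine ⟨4 * k * (2 * μ - 1) + (4 * r + t), by omega, packGame_tail.2 ?_⟩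
        refine Or.inr (Or.inr ⟨by omega, ?_⟩)
        rw [Nat.add_sub_cancel_left]
        exact insideGame_inl.2 ⟨hA, rfl, hg⟩
      · exact fixed _ _ ((toFixed_inl A _).trans (if_pos (by omega)))
          ((toFixed_inl A _).trans (if_pos (by omega)))
    · exact exists_packGame_inl_inl hk hr hAB h h' a b
  · by_cases hA : (A : ℕ) + 1 < 2 * μ
    · obtain ⟨d, hd, hg⟩ := (exists_packGame_inl_inr (z := z) (D₁ := D₁) (D₂ := D₂) hr hA h a p').1
      exact ⟨d, by omega, hg⟩
    · exact fixed _ _ ((toFixed_inl A _).trans (if_pos (by omega))) (toFixed_inr p')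
  · by_cases hB : (B : ℕ) + 1 < 2 * μ
    · obtain ⟨d, hd, hg⟩ := (exists_packGame_inl_inr (z := z) (D₁ := D₁) (D₂ := D₂) hr hB h' b p).2
      exact ⟨d, by omega, hg⟩
    · exact fixed _ _ (toFixed_inr p) ((toFixed_inl B _).trans (if_pos (by omega)))
  · exact fixed _ _ (toFixed_inr p) (toFixed_inr p')

/-- The cycle packing construction yields feasible schedules. -/
theorem isTTP_packGame (hk : 3 ≤ k) (hr : r < μ) (z : Team k (2 * μ) r → ℝ) (hD₁ : IsTTP 2 D₁)
    (hD₂ : ∀ A, IsTTP 2 (D₂ A)) : IsTTP k (packGame z D₁ D₂) := by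
  have hm : 0 < 2 * μ := by omega
  have hsplit : ∀ d, d < 4 * k * (2 * μ - 1) ∨ ∃ t, d = 4 * k * (2 * μ - 1) + t := by
    intro d
    rcases Nat.lt_or_ge d (4 * k * (2 * μ - 1)) with h | h
    · exact Or.inl h
    · exact Or.inr ⟨d - 4 * k * (2 * μ - 1), by omega⟩
  refine IsTTP.of_changes ?_ ?_ ?_ ?_ ?_ <;> rw [days_team (by omega) (by omega)]
  · intro d hd u v h
    rcases hsplit d with h1 | ⟨t, rfl⟩
    · exact packGame_asymm_super h1 h
    · rw [packGame_tail] at h ⊢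
      exact tailGame_asymm hD₁ hD₂ (by omega) h
  · intro d hd u
    rcases hsplit d with h1 | ⟨t, rfl⟩
    · exact packGame_one_game_super hr.le h1 u
    · simp only [plays_packGame_tail]
      exact tailGame_one_game hm hD₁ hD₂ (by omega) u
  · exact fun u v huv => exists_packGame hk hr hD₁ hD₂ huv
  · intro d hd u v h
    rcases hsplit d with h1 | ⟨t, rfl⟩
    · by_cases h2 : d + 1 < 4 * k * (2 * μ - 1)
      · exact packGame_no_repeat_super (by omega) hr h2 h
      · exact packGame_no_repeat_boundary hk hr (by omega) h
    · rw [add_assoc, plays_packGame_tail]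
      rw [plays_packGame_tail] at h
      exact tailGame_no_repeat (by omega) (by omega) hD₁ hD₂ (by omega) h
  · exact fun d hd u => packGame_change hk hr hD₁ hD₂ hd u

end Feasible

/-! ### Cuts of the line -/

section Cuts

/-- The cut of the line at `t`: the indicator function of the points to the right of `t`. -/
noncomputable def cut {V : Type*} (x : V → ℝ) (t : ℝ) (v : V) : ℝ := if t < x v then 1 else 0

theorem cut_eq_zero_or_one {V : Type*} (x : V → ℝ) (t : ℝ) (v : V) :
    cut x t v = 0 ∨ cut x t v = 1 := by
  unfold cut
  split_ifs <;> simp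

theorem cut_mono {V : Type*} {x : V → ℝ} {t : ℝ} {u v : V} (h : x u ≤ x v) :
    cut x t u ≤ cut x t v := by
  unfold cut
  split_ifs with h1 h2
  · exact le_rfl
  · exact absurd (h1.trans_le h) h2
  · exact zero_le_one
  · exact le_rfl

theorem exists_cuts_finset (s : Finset ℝ) : ∃ (N : ℕ) (t l : ℕ → ℝ), (∀ g, 0 ≤ l g) ∧
    (∀ g, g < N → ∃ a ∈ s, t g < a) ∧ ∀ a ∈ s, ∀ b ∈ s,
      |a - b| = ∑ g ∈ range N, l g * |cut id (t g) a - cut id (t g) b| := by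
  induction s using Finset.induction_on_max with
  | empty => exact ⟨0, 0, 0, by simp, by simp, by simp⟩
  | insert M s hM ih =>
    obtain ⟨N, t, l, hl, ht, h⟩ := ih
    rcases s.eq_empty_or_nonempty with rfl | hne
    · refine ⟨0, 0, 0, by simp, by simp, ?_⟩
      intro a ha b hb
      simp only [insert_empty_eq, mem_singleton] at ha hb
      simp [ha, hb]
    · set p := s.max' hne with hp
      have hps : p ∈ s := s.max'_mem hne
      have hpM : p < M := hM p hps
      have hle : ∀ a ∈ s, a ≤ p := fun a ha => s.le_max' a ha
      refine ⟨N + 1, fun g => if g < N then t g else p, fun g => if g < N then l g else M - p,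
        ?_, ?_, ?_⟩
      · intro g
        simp only
        split_ifs
        · exact hl g
        · linarith
      · intro g _
        simp only
        split_ifs with hg
        · obtain ⟨a, ha, h⟩ := ht g hg
          exact ⟨a, mem_insert_of_mem ha, h⟩
        · exact ⟨M, mem_insert_self _ _, hpM⟩
      · have hsum : ∀ a b : ℝ, (∑ g ∈ range (N + 1), (if g < N then l g else M - p) *
            |cut id (if g < N then t g else p) a - cut id (if g < N then t g else p) b|) =
            ∑ g ∈ range N, l g * |cut id (t g) a - cut id (t g) b| +
              (M - p) * |cut id p a - cut id p b| := by
          intro a b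
          rw [sum_range_succ]
          congr 1
          · refine sum_congr rfl fun g hg => ?_
            rw [if_pos (mem_range.1 hg), if_pos (mem_range.1 hg)]
          · rw [if_neg (lt_irrefl N), if_neg (lt_irrefl N)]
        have c0 : ∀ a ∈ s, cut id p a = 0 := fun a ha => if_neg (not_lt.2 (hle a ha))
        have c1 : cut id p M = 1 := if_pos hpM
        have cM : ∀ g, g < N → cut id (t g) M = cut id (t g) p := by
          intro g hg
          obtain ⟨a, ha, h⟩ := ht g hg
          have h1 : t g < p := h.trans_le (hle a ha)
          unfold cut
          rw [if_pos (show t g < id p from h1), if_pos (show t g < id M from h1.trans hpM)]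
        have key : ∀ a ∈ s, |a - M| = ∑ g ∈ range N, l g * |cut id (t g) a - cut id (t g) M| +
              (M - p) * |cut id p a - cut id p M| := by
          intro a ha
          rw [c0 a ha, c1, sum_congr rfl (fun g hg => by rw [cM g (mem_range.1 hg)]),
            ← h a ha p hps, abs_of_nonpos (by linarith [hle a ha]),
            abs_of_nonpos (by linarith [hle a ha])]
          norm_num
        intro a ha b hb
        rw [hsum]
        rw [mem_insert] at ha hb
        rcases ha with rfl | ha <;> rcases hb with rfl | hb
        · simp
        · rw [abs_sub_comm, key b hb]
          simp only [abs_sub_comm]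
        · exact key a ha
        · rw [c0 a ha, c0 b hb, h a ha b hb]
          simp

/-- The line metric on a finite set of points is a nonnegative combination of cuts. -/
theorem exists_cuts {V : Type*} [Fintype V] (x : V → ℝ) : ∃ (N : ℕ) (t l : ℕ → ℝ),
    (∀ g, 0 ≤ l g) ∧
      ∀ u v, |x u - x v| = ∑ g ∈ range N, l g * |cut x (t g) u - cut x (t g) v| := by
  classical
  obtain ⟨N, t, l, hl, -, h⟩ := exists_cuts_finset (univ.image x)
  exact ⟨N, t, l, hl, fun u v => h _ (mem_image_of_mem x (mem_univ u)) _
    (mem_image_of_mem x (mem_univ v))⟩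

/-- Sum of the distances over all ordered pairs of teams. -/
noncomputable def pairSum {V : Type*} [Fintype V] (x : V → ℝ) : ℝ := ∑ u, ∑ v, |x u - x v|

theorem pairSum_nonneg {V : Type*} [Fintype V] (x : V → ℝ) : 0 ≤ pairSum x :=
  sum_nonneg fun _ _ => sum_nonneg fun _ _ => abs_nonneg _

theorem packingWeight_nonneg {n k l : ℕ} (x : Fin n → ℝ) (f : Fin l × Fin k → Fin n) :
    0 ≤ packingWeight x f :=
  sum_nonneg fun _ _ => sum_nonneg fun _ _ => abs_nonneg _

theorem travel_nonneg {V : Type*} [Fintype V] (x : V → ℝ) (G : ℕ → V → V → Prop) :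
    0 ≤ travel x G :=
  sum_nonneg fun _ _ => sum_nonneg fun _ _ => abs_nonneg _

theorem sum_sum_cuts {V I J : Type*} {N : ℕ} {x : V → ℝ} {t l : ℕ → ℝ}
    (h : ∀ u v, |x u - x v| = ∑ g ∈ range N, l g * |cut x (t g) u - cut x (t g) v|)
    (s : Finset I) (s' : Finset J) (p q : I → J → V) :
    ∑ i ∈ s, ∑ j ∈ s', |x (p i j) - x (q i j)| =
      ∑ g ∈ range N, l g * ∑ i ∈ s, ∑ j ∈ s', |cut x (t g) (p i j) - cut x (t g) (q i j)| := by
  simp only [h, mul_sum]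
  rw [sum_congr rfl (fun i _ => sum_comm), sum_comm]

/-- A linear inequality between the sum of all distances, the weight of a packing and the weight
of a schedule holds if it holds for all cuts. -/
theorem inequality_of_cuts {n k l : ℕ} (x : Fin n → ℝ) (f : Fin l × Fin k → Fin n)
    (G : ℕ → Fin n → Fin n → Prop) (α β γ : ℝ)
    (h : ∀ t, α * pairSum (cut x t) + β * packingWeight (cut x t) f ≤ γ * travel (cut x t) G) :
    α * pairSum x + β * packingWeight x f ≤ γ * travel x G := by
  obtain ⟨N, t, w, hw, hx⟩ := exists_cuts x
  have e1 : pairSum x = ∑ g ∈ range N, w g * pairSum (cut x (t g)) :=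
    sum_sum_cuts hx univ univ (fun u _ => u) (fun _ v => v)
  have e2 : packingWeight x f = ∑ g ∈ range N, w g * packingWeight (cut x (t g)) f :=
    sum_sum_cuts hx univ univ (fun c i => f (c, i)) (fun c i => f (c, rot i 1))
  have e3 : travel x G = ∑ g ∈ range N, w g * travel (cut x (t g)) G :=
    sum_sum_cuts hx univ _ (fun a d => venue G a d) (fun a d => venue G a (d + 1))
  rw [e1, e2, e3, mul_sum, mul_sum, mul_sum, ← sum_add_distrib]
  refine sum_le_sum fun g _ => ?_
  have := mul_le_mul_of_nonneg_left (h (t g)) (hw g)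
  linarith

theorem packingWeight_le_of_cuts {n k l : ℕ} (x : Fin n → ℝ) (f f' : Fin l × Fin k → Fin n)
    (h : ∀ t, packingWeight (cut x t) f ≤ packingWeight (cut x t) f') :
    packingWeight x f ≤ packingWeight x f' := by
  obtain ⟨N, t, w, hw, hx⟩ := exists_cuts x
  have e : ∀ f : Fin l × Fin k → Fin n,
      packingWeight x f = ∑ g ∈ range N, w g * packingWeight (cut x (t g)) f := fun f =>
    sum_sum_cuts hx univ univ (fun c i => f (c, i)) (fun c i => f (c, rot i 1))
  rw [e, e]
  exact sum_le_sum fun g _ => mul_le_mul_of_nonneg_left (h (t g)) (hw g)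

end Cuts

/-! ### The lower bound for a cut -/

section LowerBound

/-- A sequence that starts and ends outside `q` crosses the boundary of `q` twice as often as it
enters `q`. -/
theorem sum_crossings (q : ℕ → Prop) [DecidablePred q] (N : ℕ) (h0 : ¬ q 0) (hN : ¬ q N) :
    ∑ d ∈ range N, |(if q d then (1 : ℝ) else 0) - (if q (d + 1) then 1 else 0)| =
      2 * #{d ∈ range N | ¬ q d ∧ q (d + 1)} := by
  have tele := Finset.sum_range_sub (fun d => if q d then (1 : ℝ) else 0) N
  simp only [if_neg h0, if_neg hN, sub_zero] at tele
  have e : ∀ d ∈ range N, |(if q d then (1 : ℝ) else 0) - (if q (d + 1) then 1 else 0)| =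
      2 * (if ¬ q d ∧ q (d + 1) then 1 else 0) -
        ((if q (d + 1) then (1 : ℝ) else 0) - (if q d then 1 else 0)) := by
    intro d _
    by_cases h1 : q d <;> by_cases h2 : q (d + 1) <;> simp [h1, h2]
    norm_num
  rw [sum_congr rfl e, sum_sub_distrib, tele, sub_zero, ← mul_sum, sum_boole]

/-- If the sequence stays in `q` for at most `k` steps, it is there at most `k` times as often as
it enters `q`. -/
theorem card_le_mul_entries (q : ℕ → Prop) [DecidablePred q] (N k : ℕ) (h0 : ¬ q 0)
    (hk : ∀ d, d + k < N → ∃ j, j ≤ k ∧ ¬ q (d + j + 1)) :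
    #{t ∈ range N | q t} ≤ k * #{d ∈ range N | ¬ q d ∧ q (d + 1)} := by
  classical
  set g : ℕ → ℕ := fun t => Nat.findGreatest (fun d => ¬ q d) t with hg
  have g1 : ∀ t, ¬ q (g t) := fun t =>
    Nat.findGreatest_spec (P := fun d => ¬ q d) (Nat.zero_le t) h0
  have g2 : ∀ t, g t ≤ t := fun t => Nat.findGreatest_le t
  have g3 : ∀ t d, g t < d → d ≤ t → q d := by
    intro t d h1 h2
    by_contra h3
    exact Nat.findGreatest_is_greatest h1 h2 h3
  have g4 : ∀ t, q t → g t < t := by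
    intro t ht
    refine lt_of_le_of_ne (g2 t) fun e => ?_
    exact g1 t (by rwa [e])
  rw [← card_range k, mul_comm, ← card_product]
  refine card_le_card_of_injOn (fun t => (g t, t - g t - 1)) ?_ ?_
  · intro t ht
    simp only [coe_filter, Set.mem_ofPred_eq, mem_range] at ht
    have h4 := g4 t ht.2
    simp only [coe_product, Set.mem_prod, mem_coe, mem_filter, mem_range]
    refine ⟨⟨by omega, g1 t, g3 t _ (by omega) (by omega)⟩, ?_⟩
    by_contra h5
    obtain ⟨j, hj, hq⟩ := hk (g t) (by omega)
    exact hq (g3 t _ (by omega) (by omega))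
  · intro t ht t' ht' e
    simp only [coe_filter, Set.mem_ofPred_eq, mem_range] at ht ht'
    simp only [Prod.mk.injEq] at e
    have h4 := g4 t ht.2
    have h4' := g4 t' ht'.2
    omega

variable {V : Type*} [Fintype V] {k : ℕ} {G : ℕ → V → V → Prop}

/-- A team crosses a cut at least `2⌈q/k⌉` times if there are `q` teams on the other side. -/
theorem IsTTP.team_crossings (hG : IsTTP k G) (x : V → ℝ) (t : ℝ) (a : V) :
    ∃ U : ℕ, #{v | ¬ (t < x v ↔ t < x a)} ≤ k * U ∧
      ∑ d ∈ range (days V + 1), |cut x t (venue G a d) - cut x t (venue G a (d + 1))| = 2 * U := by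
  classical
  set q : ℕ → Prop := fun d => ¬ (t < x (venue G a d) ↔ t < x a) with hq
  have h0 : ¬ q 0 := by
    simp only [hq, not_not]
    rfl
  have hN : ¬ q (days V + 1) := by
    have : venue G a (days V + 1) = a :=
      venue_succ_of_not (fun h => absurd h.1 (lt_irrefl _))
    simp only [hq, this, not_not]
  refine ⟨#{d ∈ range (days V + 1) | ¬ q d ∧ q (d + 1)}, ?_, ?_⟩
  · refine le_trans ?_ (card_le_mul_entries q (days V + 1) k h0 ?_)
    · refine card_le_card_of_surjOn (venue G a) ?_
      intro b hb
      simp only [coe_filter, mem_univ, true_and, Set.mem_ofPred_eq] at hb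
      have hne : a ≠ b := by
        rintro rfl
        exact hb Iff.rfl
      obtain ⟨d, ⟨hd, h⟩, -⟩ := hG.double_round a b hne
      have e := hG.venue_succ hd h
      refine ⟨d + 1, ?_, e⟩
      simp only [coe_filter, mem_range, Set.mem_ofPred_eq, hq, e]
      exact ⟨by omega, hb⟩
    · intro d hd
      by_contra! hcon
      have haway : ∀ j, j ≤ k → d + j < days V ∧ ∃ b, G (d + j) a b := by
        intro j hj
        by_contra h
        refine hcon j hj ?_
        rw [venue_succ_of_not h]
      exact hG.bounded_away d (haway k le_rfl).1 a (fun j hj => (haway j hj).2)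
  · rw [← sum_crossings q _ h0 hN]
    refine sum_congr rfl fun d _ => ?_
    unfold cut
    by_cases h1 : t < x a <;> by_cases h2 : t < x (venue G a d) <;>
      by_cases h3 : t < x (venue G a (d + 1)) <;>
      simp only [hq, h1, h2, h3, iff_true, iff_false, not_true_eq_false, not_false_eq_true,
        if_true, if_false] <;> norm_num

/-- A team on the left of a cut with `i` teams on the left side crosses it at least
`2⌈(n - i)/k⌉` times, a team on the right at least `2⌈i/k⌉` times. -/
theorem IsTTP.travel_cut_ge (hG : IsTTP k G) (x : V → ℝ) (t : ℝ) {c c' : ℕ}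
    (hc : ∀ U, #{v | t < x v} ≤ k * U → c ≤ U) (hc' : ∀ U, #{v | ¬ t < x v} ≤ k * U → c' ≤ U) :
    2 * ((#{v | ¬ t < x v} : ℝ) * c + #{v | t < x v} * c') ≤ travel (cut x t) G := by
  classical
  choose U hU hsum using hG.team_crossings x t
  unfold travel
  rw [sum_congr rfl (fun a _ => hsum a), ← mul_sum]
  refine mul_le_mul_of_nonneg_left ?_ two_pos.le
  rw [← sum_filter_add_sum_filter_not univ (fun a => ¬ t < x a)]
  refine add_le_add ?_ ?_
  · rw [← nsmul_eq_mul]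
    refine card_nsmul_le_sum _ _ _ fun a ha => ?_
    simp only [mem_filter, mem_univ, true_and] at ha
    have := hU a
    simp only [ha, iff_false, not_not] at this
    exact_mod_cast hc _ this
  · simp only [not_not]
    rw [← nsmul_eq_mul]
    refine card_nsmul_le_sum _ _ _ fun a ha => ?_
    simp only [mem_filter, mem_univ, true_and] at ha
    have := hU a
    simp only [ha, iff_true] at this
    exact_mod_cast hc' _ this

theorem pairSum_cut (x : V → ℝ) (t : ℝ) :
    pairSum (cut x t) = 2 * ((#{v | ¬ t < x v} : ℝ) * #{v | t < x v}) := by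
  classical
  unfold pairSum
  have h : ∀ u v, |cut x t u - cut x t v| = (if ¬ t < x u then (1 : ℝ) else 0) *
      (if t < x v then 1 else 0) + (if t < x u then 1 else 0) * (if ¬ t < x v then 1 else 0) := by
    intro u v
    unfold cut
    by_cases h1 : t < x u <;> by_cases h2 : t < x v <;> simp [h1, h2]
  simp only [h, sum_add_distrib, ← mul_sum, ← sum_mul, sum_boole]
  ring

end LowerBound

/-! ### Consecutive packings -/

section Packings

variable {n k l : ℕ}

/-- A closed walk through all points of a cycle connects any two of them twice. -/
theorem two_mul_le_cycle (g : Fin k → ℝ) (a b : Fin k) :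
    2 * |g a - g b| ≤ ∑ i, |g i - g (rot i 1)| := by
  wlog hab : a ≤ b generalizing a b with H
  · rw [abs_sub_comm]
    exact H b a (le_of_not_ge hab)
  have hk : 0 < k := a.pos
  set h : ℕ → ℝ := fun t => g ⟨t % k, Nat.mod_lt _ hk⟩ with hh
  have hval : ∀ c : Fin k, h c = g c := by
    intro c
    simp only [hh, Nat.mod_eq_of_lt c.2]
  have hk0 : h k = h 0 := by simp [hh]
  have hsum : ∑ i, |g i - g (rot i 1)| = ∑ t ∈ range k, dist (h t) (h (t + 1)) := by
    rw [← Fin.sum_univ_eq_sum_range (fun t => dist (h t) (h (t + 1)))]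
    refine sum_congr rfl fun i _ => ?_
    rw [Real.dist_eq, hval]
    rfl
  rw [hsum, ← sum_range_add_sum_Ico _ b.2.le, ← sum_range_add_sum_Ico _ (show (a : ℕ) ≤ b from hab)]
  have h1 := dist_le_range_sum_dist h a
  have h2 := dist_le_Ico_sum_dist h (show (a : ℕ) ≤ b from hab)
  have h3 := dist_le_Ico_sum_dist h b.2.le
  have h4 := dist_triangle (h a) (h 0) (h b)
  rw [hk0, dist_comm] at h3
  rw [dist_comm] at h1
  rw [hval] at h1 h3
  rw [hval, hval, Real.dist_eq] at h2 h4
  linarith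

/-- The weight of a cycle through points in increasing order. -/
theorem cycle_of_monotone {κ : ℕ} (g : Fin (κ + 1) → ℝ) (hg : Monotone g) :
    ∑ i, |g i - g (rot i 1)| = 2 * (g (Fin.last κ) - g 0) := by
  have r1 : ∀ i : Fin κ, rot i.castSucc 1 = i.succ := by
    intro i
    apply Fin.ext
    simp only [rot, Fin.val_castSucc, Fin.val_succ]
    exact Nat.mod_eq_of_lt (by omega)
  have r2 : rot (Fin.last κ) 1 = 0 := by
    apply Fin.ext
    simp [rot]
  have e1 := Fin.sum_univ_castSucc g
  have e2 := Fin.sum_univ_succ g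
  rw [Fin.sum_univ_castSucc, r2, sum_congr rfl (fun i _ => by
    rw [r1, abs_sub_comm, abs_of_nonneg (sub_nonneg.2 (hg (Fin.castSucc_le_succ i)))]),
    sum_sub_distrib, abs_of_nonneg (sub_nonneg.2 (hg (Fin.zero_le _)))]
  linarith

theorem card_index_lt {M : ℕ} (hM : M ≤ l * k) :
    #{p : Fin l × Fin k | (p.1 * k + p.2 : ℕ) < M} = M := by
  have h : #{p : Fin l × Fin k | (p.1 * k + p.2 : ℕ) < M} = #{j : Fin (l * k) | (j : ℕ) < M} := by
    refine card_bij (fun p _ => finProdFinEquiv p) ?_ ?_ ?_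
    · intro p hp
      simp only [mem_filter, mem_univ, true_and, finProdFinEquiv_apply_val] at hp ⊢
      rw [mul_comm] at hp
      omega
    · intro p _ q _ h
      exact finProdFinEquiv.injective h
    · intro j hj
      refine ⟨finProdFinEquiv.symm j, ?_, Equiv.apply_symm_apply _ _⟩
      simp only [mem_filter, mem_univ, true_and] at hj ⊢
      have h1 := finProdFinEquiv_apply_val (finProdFinEquiv.symm j)
      rw [Equiv.apply_symm_apply] at h1
      rw [mul_comm]
      omega
  rw [h, Fin.card_filter_val_lt]
  omega

/-- A sorted zero-one function on the consecutive cycles is constant on each cycle if the number of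
its zeros is a multiple of `k`: the zeros fill the first cycles completely. -/
theorem cycle_constant_of_dvd {g : Fin l × Fin k → ℝ} (h01 : ∀ p, g p = 0 ∨ g p = 1)
    (hg : ∀ p q : Fin l × Fin k, (p.1 * k + p.2 : ℕ) ≤ q.1 * k + q.2 → g p ≤ g q)
    (hdvd : k ∣ #{p | g p = 0}) (c : Fin l) (a b : Fin k) : g (c, a) = g (c, b) := by
  wlog hab : a ≤ b generalizing a b with H
  · exact (H b a (le_of_not_ge hab)).symm
  by_contra hne
  have hle : g (c, a) ≤ g (c, b) := hg _ _ (by simp only; omega)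
  have ha : g (c, a) = 0 := by
    rcases h01 (c, a) with h | h
    · exact h
    · rcases h01 (c, b) with h' | h'
      · linarith
      · exact absurd (h.trans h'.symm) hne
  have hb : g (c, b) = 1 := by
    rcases h01 (c, b) with h | h
    · exact absurd (ha.trans h.symm) hne
    · exact h
  have hck : (c + 1 : ℕ) * k ≤ l * k := Nat.mul_le_mul_right _ c.2
  rw [add_mul, one_mul] at hck
  have h1 : c * k + a + 1 ≤ #{p | g p = 0} := by
    rw [← card_index_lt (l := l) (k := k) (M := c * k + a + 1) (by omega)]
    refine card_le_card fun p hp => ?_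
    simp only [mem_filter, mem_univ, true_and] at hp ⊢
    have := hg p (c, a) (by simp only; omega)
    rcases h01 p with h | h
    · exact h
    · linarith
  have h2 : #{p | g p = 0} ≤ c * k + b := by
    rw [← card_index_lt (l := l) (k := k) (M := c * k + b) (by omega)]
    refine card_le_card fun p hp => ?_
    simp only [mem_filter, mem_univ, true_and] at hp ⊢
    by_contra h3
    have := hg (c, b) p (by simp only; omega)
    linarith
  obtain ⟨e, he⟩ := hdvd
  rw [he, mul_comm k e] at h1 h2
  have h3 : (c : ℕ) < e := Nat.lt_of_mul_lt_mul_right (a := k) (by omega)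
  have h4 : (c + 1 : ℕ) * k ≤ e * k := Nat.mul_le_mul_right _ h3
  rw [add_mul, one_mul] at h4
  omega

theorem packingWeight_cut_eq_zero {x : Fin n → ℝ} {f : Fin l × Fin k → Fin n} {t : ℝ}
    (hf : ∀ p q : Fin l × Fin k, (p.1 * k + p.2 : ℕ) ≤ q.1 * k + q.2 → x (f p) ≤ x (f q))
    (hdvd : k ∣ #{p | cut x t (f p) = 0}) : packingWeight (cut x t) f = 0 := by
  have h := cycle_constant_of_dvd (g := fun p => cut x t (f p))
    (fun p => cut_eq_zero_or_one _ _ _) (fun p q hpq => cut_mono (hf p q hpq)) hdvd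
  refine sum_eq_zero fun c _ => sum_eq_zero fun i _ => ?_
  have := h c i (rot i 1)
  rw [this, sub_self, abs_zero]

/-- A cut separates at most one of the consecutive cycles and crosses it twice. -/
theorem packingWeight_cut_le_two {x : Fin n → ℝ} {f : Fin l × Fin k → Fin n} (t : ℝ)
    (hf : ∀ p q : Fin l × Fin k, (p.1 * k + p.2 : ℕ) ≤ q.1 * k + q.2 → x (f p) ≤ x (f q)) :
    packingWeight (cut x t) f ≤ 2 := by
  rcases k with _ | κ
  · simp [packingWeight]
  set g : Fin l × Fin (κ + 1) → ℝ := fun p => cut x t (f p) with hg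
  have h01 : ∀ p, g p = 0 ∨ g p = 1 := fun p => cut_eq_zero_or_one _ _ _
  have hmono : ∀ p q : Fin l × Fin (κ + 1),
      (p.1 * (κ + 1) + p.2 : ℕ) ≤ q.1 * (κ + 1) + q.2 → g p ≤ g q :=
    fun p q hpq => cut_mono (hf p q hpq)
  have hcyc : ∀ c, ∑ i, |g (c, i) - g (c, rot i 1)| = 2 * (g (c, Fin.last κ) - g (c, 0)) := by
    intro c
    refine cycle_of_monotone (fun i => g (c, i)) fun i j hij => hmono _ _ ?_
    have : (i : ℕ) ≤ j := hij
    simp only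
    omega
  have hval : ∀ c, g (c, Fin.last κ) - g (c, 0) ≤ 1 := by
    intro c
    rcases h01 (c, Fin.last κ) with h | h <;> rcases h01 (c, 0) with h' | h' <;> rw [h, h'] <;>
      norm_num
  have e : packingWeight (cut x t) f = ∑ c, 2 * (g (c, Fin.last κ) - g (c, 0)) :=
    sum_congr rfl fun c _ => hcyc c
  rw [e]
  by_cases hex : ∃ c, g (c, Fin.last κ) - g (c, 0) ≠ 0
  · obtain ⟨c, hc⟩ := hex
    have hc0 : g (c, 0) = 0 ∧ g (c, Fin.last κ) = 1 := by
      have := hmono (c, 0) (c, Fin.last κ) (by simp)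
      rcases h01 (c, Fin.last κ) with h | h <;> rcases h01 (c, 0) with h' | h' <;>
        first
        | exact ⟨h', h⟩
        | exact absurd (by rw [h, h', sub_self]) hc
        | (rw [h, h'] at this; norm_num at this)
    rw [sum_eq_single c]
    · linarith [hval c]
    · intro c' _ hne
      have hle : ∀ d d' : Fin l, d < d' → g (d, Fin.last κ) ≤ g (d', 0) := by
        intro d d' hd
        refine hmono _ _ ?_
        have : (d + 1 : ℕ) * (κ + 1) ≤ d' * (κ + 1) := Nat.mul_le_mul_right _ hd
        rw [add_mul, one_mul] at this
        simp only [Fin.val_last, Fin.val_zero]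
        omega
      have h1 := hmono (c', 0) (c', Fin.last κ) (by simp)
      rcases lt_or_gt_of_ne hne with h | h
      · have h2 := hle _ _ h
        rcases h01 (c', 0) with h' | h' <;> rcases h01 (c', Fin.last κ) with h'' | h'' <;>
          rw [h', h''] <;> linarith
      · have h2 := hle _ _ h
        rcases h01 (c', 0) with h' | h' <;> rcases h01 (c', Fin.last κ) with h'' | h'' <;>
          rw [h', h''] <;> linarith
    · simp
  · push Not at hex
    rw [sum_eq_zero (fun c _ => by rw [hex c, mul_zero])]
    norm_num

/-- A cut crosses every packing at least twice if the number of packed teams on its left is not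
a multiple of `k`. -/
theorem two_le_packingWeight_cut {x : Fin n → ℝ} {f : Fin l × Fin k → Fin n} {t : ℝ}
    (hdvd : ¬ k ∣ #{p | cut x t (f p) = 0}) : 2 ≤ packingWeight (cut x t) f := by
  by_contra hlt
  refine hdvd ?_
  have hconst : ∀ c a b, cut x t (f (c, a)) = cut x t (f (c, b)) := by
    intro c a b
    by_contra hne
    have h1 := two_mul_le_cycle (fun i => cut x t (f (c, i))) a b
    have h2 : ∑ i, |cut x t (f (c, i)) - cut x t (f (c, rot i 1))| ≤ packingWeight (cut x t) f :=
      single_le_sum (f := fun c => ∑ i, |cut x t (f (c, i)) - cut x t (f (c, rot i 1))|)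
        (fun c _ => sum_nonneg fun i _ => abs_nonneg _) (mem_univ c)
    have h3 : |cut x t (f (c, a)) - cut x t (f (c, b))| = 1 := by
      rcases cut_eq_zero_or_one x t (f (c, a)) with h | h <;>
        rcases cut_eq_zero_or_one x t (f (c, b)) with h' | h' <;>
        first
        | exact absurd (h.trans h'.symm) hne
        | (rw [h, h']; norm_num)
    linarith
  rw [card_filter, Fintype.sum_prod_type]
  refine dvd_sum fun c _ => ?_
  rw [← card_filter]
  by_cases h : ∃ a, cut x t (f (c, a)) = 0
  · obtain ⟨a, ha⟩ := h
    rw [filter_true_of_mem (fun b _ => (hconst c b a).trans ha), card_univ, Fintype.card_fin]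
  · push Not at h
    rw [filter_false_of_mem (fun b _ => h b), card_empty]
    exact dvd_zero k

/-- Packing consecutive teams into cycles is optimal. -/
theorem packingWeight_le_of_sorted {x : Fin n → ℝ} {f f' : Fin l × Fin k → Fin n}
    (hf : ∀ p q : Fin l × Fin k, (p.1 * k + p.2 : ℕ) ≤ q.1 * k + q.2 → x (f p) ≤ x (f q))
    (hinj : Function.Injective f) (hinj' : Function.Injective f')
    (hrange : Set.range f' = Set.range f) : packingWeight x f ≤ packingWeight x f' := by
  classical
  refine packingWeight_le_of_cuts x f f' fun t => ?_
  by_cases hdvd : k ∣ #{p | cut x t (f p) = 0}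
  · rw [packingWeight_cut_eq_zero hf hdvd]
    exact packingWeight_nonneg _ _
  · refine (packingWeight_cut_le_two t hf).trans (two_le_packingWeight_cut ?_)
    have himg : ∀ f : Fin l × Fin k → Fin n, Function.Injective f →
        #{p | cut x t (f p) = 0} = #{v ∈ univ.image f | cut x t v = 0} := by
      intro f hf
      rw [filter_image, card_image_of_injective _ hf]
    have hr : univ.image f' = univ.image f := by
      ext v
      simpa using Set.ext_iff.1 hrange v
    rwa [himg f' hinj', hr, ← himg f hinj]

end Packings

/-! ### Teams of large weighted degree -/

section Degree

variable {n : ℕ}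

/-- The weighted degree strictly decreases from the left end of the line to the median. -/
theorem wdeg_lt_of_lt {x : Fin n → ℝ} {u v : Fin n} (huv : x u < x v)
    (hv : 2 * #{z | x z < x v} < n) : wdeg x v < wdeg x u := by
  have h1 : ∀ z, (x v - x u) * (1 - 2 * (if x z < x v then (1 : ℝ) else 0)) ≤
      |x u - x z| - |x v - x z| := by
    intro z
    split_ifs with h
    · have := abs_sub_abs_le_abs_sub (x v - x z) (x u - x z)
      rw [show x v - x z - (x u - x z) = x v - x u by ring, abs_of_pos (sub_pos.2 huv)] at this
      linarith
    · rw [abs_of_nonpos (by linarith), abs_of_nonpos (by linarith)]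
      linarith
  have h2 := sum_le_sum (s := univ) fun z _ => h1 z
  rw [← mul_sum, sum_sub_distrib, ← mul_sum, sum_boole, sum_sub_distrib, sum_const, card_univ,
    Fintype.card_fin, nsmul_eq_mul, mul_one] at h2
  have h3 : (0 : ℝ) < n - 2 * #{z | x z < x v} := by
    have : ((2 * #{z | x z < x v} : ℕ) : ℝ) < n := by exact_mod_cast hv
    push_cast at this
    linarith
  have := mul_pos (sub_pos.2 huv) h3
  unfold wdeg
  linarith

/-- At least half of the teams have fewer than half of the teams to their left. -/
theorem half_le_card_left (x : Fin n → ℝ) : n ≤ 2 * #{v | 2 * #{z | x z < x v} < n} := by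
  by_cases h : ∃ v, ¬ 2 * #{z | x z < x v} < n
  · obtain ⟨v, hv, hmin⟩ := exists_min_image {v | ¬ 2 * #{z | x z < x v} < n} x
      (by obtain ⟨v, hv⟩ := h; exact ⟨v, by simpa using hv⟩)
    simp only [mem_filter, mem_univ, true_and] at hv hmin
    refine (not_lt.1 hv).trans (Nat.mul_le_mul_left 2 (card_le_card fun z hz => ?_))
    simp only [mem_filter, mem_univ, true_and] at hz ⊢
    by_contra hz'
    exact absurd (hmin z hz') (not_le.2 hz)
  · push Not at h
    rw [filter_true_of_mem (fun v _ => h v), card_univ, Fintype.card_fin]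
    omega

/-- In a set of maximum total degree, exchanging one team for another one does not increase the
degree. -/
theorem wdeg_le_of_max_degree {x : Fin n → ℝ} {S : Finset (Fin n)}
    (hS : ∀ T : Finset (Fin n), #T = #S → ∑ v ∈ T, wdeg x v ≤ ∑ v ∈ S, wdeg x v) {u v : Fin n}
    (hu : u ∈ S) (hv : v ∉ S) : wdeg x v ≤ wdeg x u := by
  have hv' : v ∉ S.erase u := fun h => hv (mem_of_mem_erase h)
  have h1 := hS (insert v (S.erase u)) (by
    rw [card_insert_of_notMem hv', card_erase_of_mem hu,
      Nat.sub_add_cancel (card_pos.2 ⟨u, hu⟩)])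
  rw [sum_insert hv', ← add_sum_erase _ _ hu] at h1
  linarith

/-- If the set of the leftmost teams given by `P` is small, then it is contained in every set of
maximum weighted degree: the degree strictly decreases towards the median. -/
theorem mem_of_max_degree {x : Fin n → ℝ} {S : Finset (Fin n)} {P : Fin n → Prop}
    [DecidablePred P]
    (hS : ∀ T : Finset (Fin n), #T = #S → ∑ v ∈ T, wdeg x v ≤ ∑ v ∈ S, wdeg x v)
    (hP : ∀ u v, P u → ¬ P v → x u < x v) (hcard : 2 * #{v | P v} + 2 * #Sᶜ ≤ n) {u : Fin n}
    (hu : P u) : u ∈ S := by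
  by_contra huS
  have h1 := half_le_card_left x
  have h2 : insert u (({v | 2 * #{z | x z < x v} < n} : Finset (Fin n)) \
      ({v | P v} : Finset (Fin n))) ⊆ Sᶜ := by
    intro v hv
    rw [mem_insert, mem_sdiff] at hv
    rw [mem_compl]
    rcases hv with rfl | ⟨hv, hv'⟩
    · exact huS
    · simp only [mem_filter, mem_univ, true_and] at hv hv'
      intro hvS
      exact absurd (wdeg_le_of_max_degree hS hvS huS) (not_le.2 (wdeg_lt_of_lt (hP u v hu hv') hv))
  have h3 := card_le_card h2
  rw [card_insert_of_notMem (by simp [hu])] at h3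
  have h4 := le_card_sdiff ({v | P v} : Finset (Fin n)) {v | 2 * #{z | x z < x v} < n}
  omega

theorem wdeg_neg (x : Fin n → ℝ) (v : Fin n) : wdeg (fun u => -x u) v = wdeg x v := by
  unfold wdeg
  refine sum_congr rfl fun u _ => ?_
  rw [← abs_neg]
  congr 1
  ring

end Degree

/-! ### The ratio for a cut -/

section Ratio

/-- The inequality behind the approximation ratio for a cut with `I ≤ J` teams on its two sides:
`c` and `c'` are the numbers of trips across the cut, `C` is the number of crossings of the
packing. -/
theorem cut_arith {k I J c c' r m : ℕ} {C ε : ℝ} (hk : 3 ≤ k) (hIJ : I ≤ J) (hc : J ≤ k * c)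
    (hc' : I ≤ k * c') (hm : 2 * m * k ≤ I + J) (hC2 : C ≤ 2)
    (hC : 2 * I + 4 * r ≤ I + J → k ∣ I → C = 0) (hε : 0 ≤ ε)
    (hn : (k : ℝ) - 1 ≤ ε * (((I : ℝ) + J) / 2 - 2 * r)) :
    2 / k * (2 * ((I : ℝ) * J)) + 2 * m * (k - 1) * C ≤
      ((3 * k - 3) / (2 * k - 1) + ε) * (2 * (I * c + J * c')) := by
  have hK : (3 : ℝ) ≤ k := by exact_mod_cast hk
  have hcr : (J : ℝ) ≤ k * c := by exact_mod_cast hc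
  have hcr' : (I : ℝ) ≤ k * c' := by exact_mod_cast hc'
  have hmr : 2 * m * k ≤ (I : ℝ) + J := by exact_mod_cast hm
  have hround : ¬ k ∣ I → (I : ℝ) + 1 ≤ k * c' ∧ (k : ℝ) ≤ k * c' := by
    intro hdvd
    have h1 : I + 1 ≤ k * c' := lt_of_le_of_ne hc' fun h => hdvd ⟨c', h⟩
    have h2 : k ≤ k * c' := by
      rcases Nat.eq_zero_or_pos c' with h0 | h0
      · rw [h0] at h1; omega
      · exact Nat.le_mul_of_pos_right k h0
    exact ⟨by exact_mod_cast h1, by exact_mod_cast h2⟩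
  clear hc hc' hm hk
  generalize (k : ℝ) = K at *
  set ρ : ℝ := (3 * K - 3) / (2 * K - 1) with hρ
  have hρ1 : ρ * (2 * K - 1) = 3 * K - 3 := div_mul_cancel₀ _ (by linarith)
  have hρ2 : 1 ≤ ρ := by
    rw [hρ, le_div_iff₀ (by linarith)]; linarith
  have hρ3 : ρ ≤ 2 := by
    rw [hρ, div_le_iff₀ (by linarith)]; linarith
  have hI : (0 : ℝ) ≤ I := Nat.cast_nonneg _
  have hJ : (0 : ℝ) ≤ J := Nat.cast_nonneg _
  have hIJ' : (I : ℝ) ≤ J := by exact_mod_cast hIJ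
  set X : ℝ := I * (K * c) + J * (K * c') with hX
  have hX1 : (I : ℝ) * J + J * (K * c') ≤ X := by
    have := mul_le_mul_of_nonneg_left hcr hI
    linarith
  have hX2 : 2 * ((I : ℝ) * J) ≤ X := by
    have := mul_le_mul_of_nonneg_left hcr' hJ
    linarith
  have hIJ0 : (0 : ℝ) ≤ I * J := mul_nonneg hI hJ
  suffices H : 2 * ((I : ℝ) * J) + m * K * (K - 1) * C ≤ (ρ + ε) * X by
    have e1 : 2 / K * (2 * ((I : ℝ) * J)) + 2 * m * (K - 1) * C =
        2 / K * (2 * ((I : ℝ) * J) + m * K * (K - 1) * C) := by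
      field_simp
    have e2 : (ρ + ε) * (2 * ((I : ℝ) * c + J * c')) = 2 / K * ((ρ + ε) * X) := by
      rw [hX]
      field_simp
    rw [e1, e2]
    exact mul_le_mul_of_nonneg_left H (by positivity)
  have hbase : 2 * ((I : ℝ) * J) ≤ ρ * X := by
    have := mul_le_mul hρ2 hX2 (by linarith) (by linarith)
    linarith
  have hX0 : 0 ≤ X := le_trans (by linarith) hX2
  have hεX : 0 ≤ ε * X := mul_nonneg hε hX0
  by_cases hC0 : C = 0
  · rw [hC0, mul_zero, add_zero, add_mul]
    linarith
  have hCle : m * K * (K - 1) * C ≤ (I + J) * (K - 1) := by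
    have h1 : m * K * (K - 1) * C ≤ m * K * (K - 1) * 2 :=
      mul_le_mul_of_nonneg_left hC2 (mul_nonneg (by positivity) (by linarith))
    have h2 := mul_le_mul_of_nonneg_right hmr (show 0 ≤ K - 1 by linarith)
    linarith
  have hr : (0 : ℝ) ≤ r := Nat.cast_nonneg _
  by_cases hdvd : k ∣ I
  · -- the smaller side is large, so that the packing is negligible
    have h1 : ¬ 2 * I + 4 * r ≤ I + J := fun h => hC0 (hC h hdvd)
    have h2 : (I : ℝ) + J < 2 * I + 4 * r := by exact_mod_cast not_le.1 h1
    have h3 : K - 1 ≤ ε * I :=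
      hn.trans (mul_le_mul_of_nonneg_left (by linarith) hε)
    have h4 := mul_le_mul_of_nonneg_right h3 (show (0 : ℝ) ≤ 2 * J by linarith)
    have h5 := mul_le_mul_of_nonneg_left hX2 hε
    have h6 := mul_le_mul_of_nonneg_left hIJ' (show 0 ≤ K - 1 by linarith)
    rw [add_mul]
    linarith
  · -- the number of trips from the larger to the smaller side is rounded up
    obtain ⟨h1r, h2r⟩ := hround hdvd
    have h3 := mul_nonneg (show 0 ≤ 2 - ρ by linarith) (show 0 ≤ K * c' - 1 - I by linarith)
    have h4 := mul_nonneg (show 0 ≤ 2 * ρ - 2 by linarith) (show 0 ≤ K * c' - K by linarith)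
    have h5 : 2 * (I : ℝ) + (K - 1) ≤ ρ * (I + K * c') := by linarith
    have h6 := mul_le_mul_of_nonneg_left h5 hJ
    have h7 := mul_le_mul_of_nonneg_left hX1 (show 0 ≤ ρ by linarith)
    have h8 : K - 1 ≤ ε * J :=
      hn.trans (mul_le_mul_of_nonneg_left (by linarith) hε)
    have h9 := mul_le_mul_of_nonneg_left h8 hI
    have h10 := mul_le_mul_of_nonneg_left (show (I : ℝ) * J ≤ X by linarith) hε
    rw [add_mul]
    linarith

theorem exists_ceil {k : ℕ} (hk : 0 < k) (I : ℕ) :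
    ∃ c, I ≤ k * c ∧ ∀ U, I ≤ k * U → c ≤ U := by
  refine ⟨(I + k - 1) / k, ?_, ?_⟩
  · have h1 := Nat.div_add_mod (I + k - 1) k
    have h2 := Nat.mod_lt (I + k - 1) hk
    omega
  · intro U hU
    refine Nat.le_of_lt_succ (Nat.div_lt_of_lt_mul ?_)
    rw [Nat.mul_succ]
    omega

variable {n k : ℕ}

theorem card_left_add_card_right (x : Fin n → ℝ) (t : ℝ) :
    #{v | ¬ t < x v} + #{v | t < x v} = n := by
  have := card_filter_add_card_filter_not (s := (univ : Finset (Fin n))) (fun v => t < x v)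
  rw [card_univ, Fintype.card_fin] at this
  omega

/-- The classical lower bound on the weight of a schedule by trips of length `k`. -/
theorem IsTTP.pairSum_le_travel (hk : 0 < k) {x : Fin n → ℝ} {G : ℕ → Fin n → Fin n → Prop}
    (hG : IsTTP k G) : 2 / k * pairSum x ≤ travel x G := by
  have key := inequality_of_cuts (k := 0) (l := 0) x (fun p => p.1.elim0) G (2 / k) 0 1 ?_
  · simpa using key
  · intro t
    obtain ⟨c, hc, hcU⟩ := exists_ceil hk #{v | t < x v}
    obtain ⟨c', hc', hcU'⟩ := exists_ceil hk #{v | ¬ t < x v}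
    refine le_trans ?_ ((hG.travel_cut_ge x t hcU hcU').trans (one_mul _).ge)
    rw [pairSum_cut, zero_mul, add_zero]
    have hkr : (0 : ℝ) < k := by exact_mod_cast hk
    have h1 : (#{v | t < x v} : ℝ) ≤ k * c := by exact_mod_cast hc
    have h2 : (#{v | ¬ t < x v} : ℝ) ≤ k * c' := by exact_mod_cast hc'
    have h3 := mul_le_mul_of_nonneg_left h1 (Nat.cast_nonneg (α := ℝ) #{v | ¬ t < x v})
    have h4 := mul_le_mul_of_nonneg_left h2 (Nat.cast_nonneg (α := ℝ) #{v | t < x v})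
    rw [div_mul_eq_mul_div, div_le_iff₀ hkr]
    linarith

variable {x : Fin n → ℝ} {en : Arrangement n k}

theorem Arrangement.cycles_injective (en : Arrangement n k) : Function.Injective en.cycles :=
  en.injective.comp Sum.inl_injective

theorem Arrangement.card_image_cycles (en : Arrangement n k) :
    #(univ.image en.cycles) = 2 * numSuper n k * k := by
  rw [card_image_of_injective _ en.cycles_injective, card_univ, Fintype.card_prod,
    Fintype.card_fin, Fintype.card_fin]

theorem Arrangement.card_add (en : Arrangement n k) :
    2 * numSuper n k * k + 2 * numPairs n k = n := by
  have := Fintype.card_congr en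
  simp only [Fintype.card_sum, Fintype.card_prod, Fintype.card_fin] at this
  omega

theorem Arrangement.card_compl_cycles (en : Arrangement n k) :
    #(univ.image en.cycles)ᶜ = 2 * numPairs n k := by
  have := en.card_add
  rw [card_compl, en.card_image_cycles, Fintype.card_fin]
  omega

theorem card_cut_zeros (en : Arrangement n k) (t : ℝ) :
    #{p | cut x t (en.cycles p) = 0} = #{v ∈ univ.image en.cycles | ¬ t < x v} := by
  rw [filter_image, card_image_of_injective _ en.cycles_injective]
  congr 1
  refine filter_congr fun p _ => ?_
  unfold cut
  split_ifs with h <;> simp [h]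

/-- If one side of a cut is small and its number of teams is a multiple of `k`, then no cycle
crosses the cut. -/
theorem IsConsecutive.packingWeight_cut_eq_zero (h : IsConsecutive x en) (t : ℝ)
    (hI : (2 * #{v | ¬ t < x v} + 4 * numPairs n k ≤ n ∧ k ∣ #{v | ¬ t < x v}) ∨
      (2 * #{v | t < x v} + 4 * numPairs n k ≤ n ∧ k ∣ #{v | t < x v})) :
    packingWeight (cut x t) en.cycles = 0 := by
  have hcompl := en.card_compl_cycles
  refine LDTTP.packingWeight_cut_eq_zero h.sorted ?_
  rw [card_cut_zeros]
  rcases hI with ⟨h1, h2⟩ | ⟨h1, h2⟩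
  · have hsub : ∀ v, ¬ t < x v → v ∈ univ.image en.cycles := fun v hv =>
      mem_of_max_degree (P := fun v => ¬ t < x v) h.max_degree
        (fun u v hu hv => (not_lt.1 hu).trans_lt (not_not.1 hv)) (by omega) hv
    have e : filter (fun v => ¬ t < x v) (univ.image en.cycles) =
        filter (fun v => ¬ t < x v) univ := by
      ext v
      simp only [mem_filter, mem_univ, true_and, and_iff_right_iff_imp]
      exact hsub v
    rwa [e]
  · have hsub : ∀ v, t < x v → v ∈ univ.image en.cycles := by
      intro v hv
      refine mem_of_max_degree (x := fun v => -x v) (P := fun v => t < x v) ?_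
        (fun u v hu hv => neg_lt_neg ((not_lt.1 hv).trans_lt hu)) (by omega) hv
      intro T hT
      simp only [wdeg_neg]
      exact h.max_degree T hT
    have e : filter (fun v => t < x v) (univ.image en.cycles) = filter (fun v => t < x v) univ := by
      ext v
      simp only [mem_filter, mem_univ, true_and, and_iff_right_iff_imp]
      exact hsub v
    have h3 := card_filter_add_card_filter_not (s := univ.image en.cycles) (fun v => t < x v)
    rw [e, en.card_image_cycles] at h3
    exact (Nat.dvd_add_right h2).1 (h3 ▸ Dvd.intro_left _ rfl)

/-- The weights of a consecutive packing and of the complete graph are bounded by the weight of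
any feasible schedule. -/
theorem IsConsecutive.ratio (hk : 3 ≤ k) (h : IsConsecutive x en) {ε : ℝ} (hε : 0 ≤ ε)
    (hn : (k : ℝ) - 1 ≤ ε * ((n : ℝ) / 2 - 2 * numPairs n k)) {G : ℕ → Fin n → Fin n → Prop}
    (hG : IsTTP k G) :
    2 / k * pairSum x + 2 * numSuper n k * (k - 1) * packingWeight x en.cycles ≤
      ((3 * k - 3) / (2 * k - 1) + ε) * travel x G := by
  refine inequality_of_cuts x en.cycles G _ _ _ fun t => ?_
  obtain ⟨c, hc, hcU⟩ := exists_ceil (by omega : 0 < k) #{v | t < x v}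
  obtain ⟨c', hc', hcU'⟩ := exists_ceil (by omega : 0 < k) #{v | ¬ t < x v}
  have htr := hG.travel_cut_ge x t hcU hcU'
  have hkr : (3 : ℝ) ≤ k := by exact_mod_cast hk
  have hρ : (0 : ℝ) ≤ (3 * k - 3) / (2 * k - 1) + ε :=
    add_nonneg (div_nonneg (by linarith) (by linarith)) hε
  refine le_trans ?_ (mul_le_mul_of_nonneg_left htr hρ)
  rw [pairSum_cut]
  have hC2 := packingWeight_cut_le_two (f := en.cycles) t h.sorted
  have hcard := card_left_add_card_right x t
  have hcr : (#{v | ¬ t < x v} : ℝ) + #{v | t < x v} = n := by exact_mod_cast hcard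
  have hcr2 : (#{v | t < x v} : ℝ) + #{v | ¬ t < x v} = n := by rw [add_comm]; exact hcr
  have hm := en.card_add
  rcases le_total #{v | ¬ t < x v} #{v | t < x v} with hIJ | hIJ
  · exact cut_arith (r := numPairs n k) hk hIJ hc hc' (by omega) hC2
      (fun h1 h2 => h.packingWeight_cut_eq_zero t (Or.inl ⟨by omega, h2⟩)) hε (by rwa [hcr])
  · have := cut_arith (r := numPairs n k) (m := numSuper n k) hk hIJ hc' hc (by omega) hC2
      (fun h1 h2 => h.packingWeight_cut_eq_zero t (Or.inr ⟨by omega, h2⟩)) hε (by rwa [hcr2])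
    rw [mul_comm (#{v | ¬ t < x v} : ℝ), add_comm ((#{v | ¬ t < x v} : ℝ) * c)]
    exact this

/-- Consecutive packings of teams of maximum weighted degree exist. -/
theorem exists_isConsecutive (x : Fin n → ℝ)
    (hcard : 2 * numSuper n k * k + 2 * numPairs n k = n) :
    ∃ en : Arrangement n k, IsConsecutive x en := by
  classical
  set M := 2 * numSuper n k * k with hM
  obtain ⟨S, hS, hmax⟩ := exists_max_image (powersetCard M (univ : Finset (Fin n)))
    (fun T => ∑ v ∈ T, wdeg x v) (powersetCard_nonempty.2 (by
      rw [card_univ, Fintype.card_fin]; omega))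
  have hSc : #S = M := (mem_powersetCard.1 hS).2
  set σ := Tuple.sort x with hσ
  set S' := S.map σ.symm.toEmbedding with hS'
  have hSc' : #S' = M := by rw [hS', card_map, hSc]
  set f : Fin (2 * numSuper n k) × Fin k → Fin n :=
    fun p => σ (S'.orderEmbOfFin hSc' (finProdFinEquiv p)) with hf
  have hinj : Function.Injective f :=
    σ.injective.comp ((S'.orderEmbOfFin hSc').injective.comp finProdFinEquiv.injective)
  have himg : univ.image f = S := by
    refine eq_of_subset_of_card_le ?_ ?_
    · intro v hv
      obtain ⟨p, -, rfl⟩ := mem_image.1 hv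
      have := S'.orderEmbOfFin_mem hSc' (finProdFinEquiv p)
      obtain ⟨w, hw, e⟩ := mem_map.1 this
      simp only [hf, ← e]
      simpa using hw
    · rw [card_image_of_injective _ hinj, card_univ, Fintype.card_prod, Fintype.card_fin,
        Fintype.card_fin, hSc]
  have hc : Fintype.card (Fin (numPairs n k) × Fin 2) = Fintype.card ((Set.range f)ᶜ : Set _) := by
    rw [Fintype.card_compl_set, Set.card_range_of_injective hinj]
    simp only [Fintype.card_prod, Fintype.card_fin]
    omega
  let en : Arrangement n k := (Equiv.sumCongr (Equiv.ofInjective f hinj)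
    (Fintype.equivOfCardEq hc)).trans (Equiv.Set.sumCompl (Set.range f))
  have hcyc : en.cycles = f := rfl
  refine ⟨en, ?_, ?_⟩
  · intro T hT
    rw [hcyc, himg] at hT ⊢
    exact hmax T (mem_powersetCard.2 ⟨subset_univ _, hT.trans hSc⟩)
  · intro p q hpq
    rw [hcyc]
    refine Tuple.monotone_sort x ((S'.orderEmbOfFin hSc').monotone ?_)
    rw [Fin.le_def, finProdFinEquiv_apply_val, finProdFinEquiv_apply_val, mul_comm k, mul_comm k]
    omega

end Ratio

/-! ### Travel along runs of away games -/

section Legs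

variable {V : Type*} [Fintype V] {k : ℕ} {G : ℕ → V → V → Prop}

/-- A closed tour `p` from `p 0` is bounded by replacing all legs, except those on the days in `I`,
by a detour over `p 0`. -/
theorem sum_legs_le (p : ℕ → ℝ) (D : ℕ) (I : ℕ → Prop) [DecidablePred I] (hI : ¬ I D)
    (hp : p (D + 1) = p 0) :
    ∑ t ∈ range (D + 1), |p t - p (t + 1)| ≤
      ∑ t ∈ range D, ((if I t then |p t - p (t + 1)| else |p 0 - p (t + 1)|) +
        (if I (t + 1) then 0 else |p 0 - p (t + 1)|)) := by
  have h1 : ∀ t ∈ range (D + 1), |p t - p (t + 1)| ≤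
      (if I t then |p t - p (t + 1)| else |p 0 - p (t + 1)|) +
        (if I t then 0 else |p 0 - p t|) := by
    intro t _
    split_ifs
    · rw [add_zero]
    · have := abs_sub_le (p t) (p 0) (p (t + 1))
      rw [abs_sub_comm (p t) (p 0)] at this
      linarith
  refine (sum_le_sum h1).trans ?_
  rw [sum_add_distrib, sum_add_distrib]
  refine add_le_add ?_ ?_
  · rw [sum_range_succ, if_neg hI, hp, sub_self, abs_zero, add_zero]
  · rw [sum_range_succ']
    simp

/-- The games of a team away from home on the days in `P` are at different venues. -/
theorem IsTTP.sum_trips_le (hG : IsTTP k G) (x : V → ℝ) (u : V) (P : ℕ → Prop) (Q : V → Prop)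
    [DecidablePred P] [DecidablePred Q]
    (h : ∀ d, d < days V → P d → ∀ v, G d u v → Q v) :
    ∑ d ∈ range (days V), (if P d then |x u - x (venue G u (d + 1))| else 0) ≤
      ∑ v, if Q v then |x u - x v| else 0 := by
  classical
  have e : ∑ d ∈ range (days V), (if P d then |x u - x (venue G u (d + 1))| else 0) =
      ∑ d ∈ range (days V) with P d ∧ ∃ v, G d u v, |x u - x (venue G u (d + 1))| := by
    rw [sum_filter]
    refine sum_congr rfl fun d _ => ?_
    by_cases hP : P d
    · by_cases hv : ∃ v, G d u v
      · rw [if_pos hP, if_pos ⟨hP, hv⟩]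
      · rw [if_pos hP, if_neg (fun h => hv h.2), venue_succ_of_not (fun h => hv h.2), sub_self,
          abs_zero]
    · rw [if_neg hP, if_neg (fun h => hP h.1)]
  have hmem : ∀ d ∈ (range (days V)).filter (fun d => P d ∧ ∃ v, G d u v),
      d < days V ∧ P d ∧ G d u (venue G u (d + 1)) := by
    intro d hd
    simp only [mem_filter, mem_range] at hd
    obtain ⟨h1, h2, v, hv⟩ := hd
    exact ⟨h1, h2, by rwa [hG.venue_succ h1 hv]⟩
  rw [e, ← sum_filter, ← sum_image (f := fun v => |x u - x v|) (g := fun d => venue G u (d + 1))]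
  · refine sum_le_sum_of_subset_of_nonneg ?_ fun _ _ _ => abs_nonneg _
    intro v hv
    obtain ⟨d, hd, rfl⟩ := mem_image.1 hv
    obtain ⟨h1, h2, h3⟩ := hmem d hd
    exact mem_filter.2 ⟨mem_univ _, h d h1 h2 _ h3⟩
  · intro d hd d' hd' hdd
    obtain ⟨h1, h2, h3⟩ := hmem d hd
    obtain ⟨h1', h2', h3'⟩ := hmem d' hd'
    simp only at hdd
    rw [← hdd] at h3'
    have hne : u ≠ venue G u (d + 1) := by
      intro e
      rw [← e] at h3
      exact hG.irrefl h1 u h3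
    exact (hG.double_round u _ hne).unique ⟨h1, h3⟩ ⟨h1', h3'⟩

theorem sum_range_blocks (K n T : ℕ) (f : ℕ → ℝ) :
    ∑ d ∈ range (K * n + T), f d =
      ∑ s ∈ range n, ∑ q ∈ range K, f (K * s + q) + ∑ t ∈ range T, f (K * n + t) := by
  rw [sum_range_add]
  congr 1
  induction n with
  | zero => simp
  | succ n ih => rw [mul_add_one, sum_range_add, ih, sum_range_succ]

/-- The cost of a trip from `b` over `f 0, …, f (k - 1)` back to `b`. -/
def tripCost (k : ℕ) (b : ℝ) (f : ℕ → ℝ) : ℝ :=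
  |b - f 0| + ∑ l ∈ range (k - 1), |f l - f (l + 1)| + |b - f (k - 1)|

theorem tripCost_eq_zero {b : ℝ} {f : ℕ → ℝ} (hk : 0 < k) (h : ∀ l, l < k → f l = b) :
    tripCost k b f = 0 := by
  unfold tripCost
  rw [h 0 hk, h (k - 1) (by omega), sub_self, abs_zero, zero_add, add_zero]
  refine sum_eq_zero fun l hl => ?_
  rw [mem_range] at hl
  rw [h l (by omega), h (l + 1) (by omega), sub_self, abs_zero]

theorem tripCost_congr {b : ℝ} {f g : ℕ → ℝ} (hk : 0 < k) (h : ∀ l, l < k → f l = g l) :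
    tripCost k b f = tripCost k b g := by
  unfold tripCost
  rw [h 0 hk, h (k - 1) (by omega)]
  congr 2
  refine sum_congr rfl fun l hl => ?_
  rw [mem_range] at hl
  rw [h l (by omega), h (l + 1) (by omega)]

/-- The contribution of `k` successive days on which only the first leg and the return are detours
over `p 0`. -/
theorem sum_block_le_tripCost (hk : 0 < k) (p : ℕ → ℝ) (I : ℕ → Prop) [DecidablePred I] (d : ℕ)
    (hd : ¬ I d) (hI : ∀ l, 0 < l → l < k → I (d + l)) :
    ∑ l ∈ range k, ((if I (d + l) then |p (d + l) - p (d + l + 1)| else |p 0 - p (d + l + 1)|) +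
      (if I (d + l + 1) then 0 else |p 0 - p (d + l + 1)|)) ≤
      tripCost k (p 0) (fun l => p (d + l + 1)) := by
  obtain ⟨k, rfl⟩ : ∃ k', k = k' + 1 := ⟨k - 1, by omega⟩
  unfold tripCost
  rw [sum_add_distrib, Nat.add_sub_cancel]
  refine add_le_add ?_ ?_
  · rw [sum_range_succ', add_comm]
    refine add_le_add ?_ (sum_le_sum fun l hl => ?_)
    · rw [add_zero, if_neg hd]
    · rw [mem_range] at hl
      rw [if_pos (hI (l + 1) (by omega) (by omega))]
      rfl
  · rw [sum_range_succ, sum_eq_zero, zero_add]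
    · split_ifs
      · exact abs_nonneg _
      · exact le_rfl
    · intro l hl
      rw [mem_range] at hl
      exact if_pos (hI (l + 1) (by omega) (by omega))

/-- If the days of the slots (of `4 * k` days) in `N` are divided into trips of `k` days, then the
distance travelled by a team is at most the cost of these trips and of return trips to its
opponents on the other days. -/
theorem IsTTP.sum_legs_le (hG : IsTTP k G) (hk : 0 < k) (x : V → ℝ) (u : V) {S T : ℕ}
    (hD : days V = 4 * k * S + T) (N : ℕ → Prop) [DecidablePred N] (hN : ∀ s, N s → s < S)
    (Q : V → Prop) [DecidablePred Q]
    (hQ : ∀ d, d < days V → ¬ N (d / (4 * k)) → ∀ v, G d u v → Q v) :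
    ∑ t ∈ range (days V + 1), |x (venue G u t) - x (venue G u (t + 1))| ≤
      2 * (∑ v, if Q v then |x u - x v| else 0) +
      ∑ s ∈ range S, if N s then ∑ H ∈ range 4,
        tripCost k (x u) (fun l => x (venue G u (4 * k * s + k * H + l + 1))) else 0 := by
  set I : ℕ → Prop := fun d => N (d / (4 * k)) ∧ d % k ≠ 0 with hI
  have : DecidablePred I := fun d => inferInstanceAs (Decidable (_ ∧ _))
  set p : ℕ → ℝ := fun t => x (venue G u t) with hp
  have hk4 : 0 < 4 * k := by omega
  have hp0 : p 0 = x u := rfl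
  have hID : ¬ I (days V) := by
    rintro ⟨h, -⟩
    have := hN _ h
    rw [Nat.div_lt_iff_lt_mul hk4, hD, mul_comm S] at this
    omega
  have hpD : p (days V + 1) = p 0 := by
    simp only [hp]
    rw [venue_succ_of_not (fun h => absurd h.1 (lt_irrefl _))]
    rfl
  refine (LDTTP.sum_legs_le p (days V) I hID hpD).trans ?_
  set c : ℕ → ℝ := fun t => (if I t then |p t - p (t + 1)| else |p 0 - p (t + 1)|) +
        (if I (t + 1) then 0 else |p 0 - p (t + 1)|) with hc
  have hc2 : ∀ t, ¬ N (t / (4 * k)) → c t ≤ 2 * |x u - x (venue G u (t + 1))| := by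
    intro t ht
    simp only [hc]
    rw [if_neg (fun h => ht h.1)]
    have : 0 ≤ |p 0 - p (t + 1)| := abs_nonneg _
    have e : |p 0 - p (t + 1)| = |x u - x (venue G u (t + 1))| := rfl
    rw [← e]
    split_ifs <;> linarith
  have hsplit : ∑ t ∈ range (days V), c t ≤
      ∑ t ∈ range (days V), 2 * (if ¬ N (t / (4 * k)) then |x u - x (venue G u (t + 1))| else 0) +
      ∑ t ∈ range (days V), if N (t / (4 * k)) then c t else 0 := by
    rw [← sum_add_distrib]
    refine sum_le_sum fun t _ => ?_
    by_cases h : N (t / (4 * k))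
    · simp [h]
    · simpa [h] using hc2 t h
  refine hsplit.trans (add_le_add ?_ ?_)
  · rw [← mul_sum]
    exact mul_le_mul_of_nonneg_left (hG.sum_trips_le x u _ Q hQ) two_pos.le
  · rw [hD, sum_range_blocks]
    have h0 : ∑ t ∈ range T,
        (if N ((4 * k * S + t) / (4 * k)) then c (4 * k * S + t) else 0) = 0 := by
      refine sum_eq_zero fun t _ => if_neg fun h => ?_
      have := hN _ h
      rw [Nat.div_lt_iff_lt_mul hk4, mul_comm S] at this
      omega
    rw [h0, add_zero]
    refine sum_le_sum fun s _ => ?_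
    have hdiv : ∀ q, q < 4 * k → (4 * k * s + q) / (4 * k) = s := fun q hq => by
      rw [Nat.mul_add_div hk4, Nat.div_eq_of_lt hq, add_zero]
    split_ifs with hs
    · have e : ∑ q ∈ range (4 * k),
          (if N ((4 * k * s + q) / (4 * k)) then c (4 * k * s + q) else 0) =
          ∑ H ∈ range 4, ∑ l ∈ range k, c (4 * k * s + k * H + l) := by
        have := sum_range_blocks k 4 0 (fun q => c (4 * k * s + q))
        rw [sum_range_zero, add_zero, add_zero, mul_comm k 4] at this
        simp only [add_assoc] at this ⊢
        rw [← this]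
        refine sum_congr rfl fun q hq => ?_
        rw [hdiv q (mem_range.1 hq), if_pos hs]
      rw [e]
      refine sum_le_sum fun H hH => ?_
      rw [mem_range] at hH
      have hlt : ∀ l, l < k → k * H + l < 4 * k := by
        intro l hl
        have : k * H ≤ k * 3 := Nat.mul_le_mul_left k (by omega)
        omega
      have hmod : ∀ l, (4 * k * s + k * H + l) % k = l % k := by
        intro l
        rw [show 4 * k * s + k * H + l = k * (4 * s + H) + l by ring, Nat.mul_add_mod]
      refine sum_block_le_tripCost hk p I _ ?_ ?_
      · rintro ⟨-, h⟩
        exact h (by rw [← add_zero (4 * k * s + k * H), hmod, Nat.zero_mod])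
      · intro l h1 h2
        refine ⟨?_, ?_⟩
        · rw [add_assoc, hdiv _ (hlt l h2)]
          exact hs
        · rw [hmod, Nat.mod_eq_of_lt h2]
          omega
    · refine le_of_eq (sum_eq_zero fun q hq => ?_)
      rw [hdiv q (mem_range.1 hq), if_neg hs]

end Legs

/-! ### Trips through a cycle -/

section Rotations

variable {k : ℕ}

theorem sum_rot (c : ℕ) (f : Fin k → ℝ) : ∑ i, f (rot i c) = ∑ i, f i :=
  (Finite.injective_iff_bijective.1 (rot_left_injective c)).sum_comp f

theorem sum_rot_right (i : Fin k) (c : ℕ) (f : Fin k → ℝ) :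
    ∑ d ∈ range k, f (rot i (d + c)) = ∑ i', f i' := by
  rw [← Fin.sum_univ_eq_sum_range (fun d => f (rot i (d + c)))]
  have hinj : Function.Injective (fun d : Fin k => rot i (d + c)) := by
    intro d d' h
    have h2 := (rot_eq_iff i _ _).1 h
    have := Nat.ModEq.add_right_cancel' c h2
    unfold Nat.ModEq at this
    rw [Nat.mod_eq_of_lt d.2, Nat.mod_eq_of_lt d'.2] at this
    exact Fin.ext this
  exact (Finite.injective_iff_bijective.1 hinj).sum_comp f

/-- The weight of the cycle with the vertices `g 0, …, g (k - 1)`. -/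
noncomputable def cycleWeight (g : Fin k → ℝ) : ℝ := ∑ i, |g i - g (rot i 1)|

/-- The weight of the first and last legs of the trips of the teams `g` through the cycle `g'` with
shift `c`. -/
noncomputable def endCost (g g' : Fin k → ℝ) (c : ℕ) : ℝ :=
  ∑ i, (|g i - g' (rot i c)| + |g i - g' (rot i (c + k - 1))|)

theorem cycleWeight_nonneg (g : Fin k → ℝ) : 0 ≤ cycleWeight g :=
  sum_nonneg fun _ _ => abs_nonneg _

/-- Over all shifts, every team of the first cycle meets every team of the second one once on a
first leg and once on a last leg. -/
theorem sum_endCost (hk : 0 < k) (g g' : Fin k → ℝ) :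
    ∑ c ∈ range k, endCost g g' c = 2 * ∑ i, ∑ i', |g i - g' i'| := by
  unfold endCost
  rw [sum_comm, mul_sum]
  refine sum_congr rfl fun i _ => ?_
  rw [sum_add_distrib, two_mul]
  congr 1
  · exact sum_rot_right i 0 (fun i' => |g i - g' i'|)
  · rw [← sum_rot_right i (k - 1) (fun i' => |g i - g' i'|)]
    refine sum_congr rfl fun c _ => ?_
    rw [Nat.add_sub_assoc hk]

/-- The best shift is at most as expensive as the average shift. -/
theorem endCost_le_of_best (hk : 0 < k) {g g' : Fin k → ℝ} {c : ℕ}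
    (h : ∀ c', c' < k → endCost g g' c ≤ endCost g g' c') :
    endCost g g' c ≤ 2 / k * ∑ i, ∑ i', |g i - g' i'| := by
  have h1 : #(range k) • endCost g g' c ≤ ∑ c' ∈ range k, endCost g g' c' :=
    card_nsmul_le_sum _ _ _ fun c' hc' => h c' (mem_range.1 hc')
  rw [sum_endCost hk, card_range, nsmul_eq_mul] at h1
  have hkr : (0 : ℝ) < k := by exact_mod_cast hk
  rw [div_mul_eq_mul_div, le_div_iff₀ hkr]
  linarith

/-- Trips of the teams of the first cycle through the second one. -/
theorem sum_tripCost_tail (hk : 0 < k) (g g' : Fin k → ℝ) (c : ℕ) :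
    ∑ a, tripCost k (g a) (fun l => g' (rot a (l + c))) =
      endCost g g' c + (k - 1) * cycleWeight g' := by
  have hmid : ∑ a, ∑ l ∈ range (k - 1), |g' (rot a (l + c)) - g' (rot a (l + 1 + c))| =
      (k - 1) * cycleWeight g' := by
    rw [sum_comm]
    have : ∀ l ∈ range (k - 1), ∑ a, |g' (rot a (l + c)) - g' (rot a (l + 1 + c))| =
        cycleWeight g' := by
      intro l _
      rw [cycleWeight, ← sum_rot (l + c) (fun i => |g' i - g' (rot i 1)|)]
      refine sum_congr rfl fun a _ => ?_
      rw [rot_rot, add_right_comm]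
    rw [sum_congr rfl this, sum_const, card_range, nsmul_eq_mul, Nat.cast_sub hk, Nat.cast_one]
  unfold tripCost endCost
  rw [← hmid, sum_add_distrib, sum_add_distrib, sum_add_distrib]
  simp only [zero_add, show k - 1 + c = c + k - 1 by omega]
  ring

/-- Trips of the teams of the second cycle through the first one. -/
theorem sum_tripCost_head (hk : 0 < k) (g g' : Fin k → ℝ) (c : ℕ) (f : Fin k → ℕ → ℝ)
    (hf : ∀ a l, l < k → f (rot a (l + c)) l = g a) :
    ∑ b, tripCost k (g' b) (f b) = endCost g g' c + (k - 1) * cycleWeight g := by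
  have hf' : ∀ w l, l < k → f (rot w (k - 1 + c)) l = g (rot w (k - 1 - l)) := by
    intro w l hl
    rw [← hf (rot w (k - 1 - l)) l hl, rot_rot, show k - 1 - l + (l + c) = k - 1 + c by omega]
  have hmid : ∑ w, ∑ l ∈ range (k - 1), |g (rot w (k - 1 - l)) - g (rot w (k - 1 - (l + 1)))| =
      (k - 1) * cycleWeight g := by
    rw [sum_comm]
    have : ∀ l ∈ range (k - 1), ∑ w, |g (rot w (k - 1 - l)) - g (rot w (k - 1 - (l + 1)))| =
        cycleWeight g := by
      intro l hl
      rw [mem_range] at hl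
      rw [cycleWeight, ← sum_rot (k - 1 - (l + 1)) (fun i => |g i - g (rot i 1)|)]
      refine sum_congr rfl fun a _ => ?_
      rw [rot_rot, show k - 1 - (l + 1) + 1 = k - 1 - l by omega, abs_sub_comm]
    rw [sum_congr rfl this, sum_const, card_range, nsmul_eq_mul, Nat.cast_sub hk, Nat.cast_one]
  have hfirst : ∑ w, |g' (rot w (k - 1 + c)) - g (rot w (k - 1))| =
      ∑ a, |g a - g' (rot a c)| := by
    rw [← sum_rot (k - 1) (fun a => |g a - g' (rot a c)|)]
    refine sum_congr rfl fun w _ => ?_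
    rw [rot_rot, abs_sub_comm]
  have hrot0 : ∀ w : Fin k, rot w 0 = w := fun w => Fin.ext (Nat.mod_eq_of_lt w.2)
  rw [← sum_rot (k - 1 + c)]
  have key : ∀ w, tripCost k (g' (rot w (k - 1 + c))) (f (rot w (k - 1 + c))) =
      |g' (rot w (k - 1 + c)) - g (rot w (k - 1))| +
        ∑ l ∈ range (k - 1), |g (rot w (k - 1 - l)) - g (rot w (k - 1 - (l + 1)))| +
        |g w - g' (rot w (c + k - 1))| := by
    intro w
    rw [tripCost_congr hk (fun l hl => hf' w l hl), tripCost]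
    rw [Nat.sub_self, hrot0, Nat.sub_zero, abs_sub_comm _ (g w),
      show k - 1 + c = c + k - 1 by omega]
  rw [sum_congr rfl (fun w _ => key w), sum_add_distrib, sum_add_distrib, hmid, hfirst, endCost,
    sum_add_distrib]
  ring

theorem sum_two_shift (h : Fin 2) (f : ℕ → ℝ) :
    ∑ H ∈ range 2, f H = ∑ h' : Fin 2, f ((h + h') % 2) := by
  fin_cases h <;> simp [sum_range_succ, Fin.sum_univ_two, add_comm]

end Rotations

/-! ### Travel in the cycle packing schedule -/

section Irregular

variable {k μ r : ℕ} {z : Team k (2 * μ) r → ℝ}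
  {D₁ : ℕ → FixedTeam k r → FixedTeam k r → Prop}
  {D₂ : Fin (2 * μ) → ℕ → SuperTeam k → SuperTeam k → Prop}

/-- In slot `s`, column `j` has a normal super-game from the super-team `A` to the super-team
`B`. -/
structure NormalGame (μ r s j A B : ℕ) : Prop where
  slot_lt : s + 2 < 2 * μ
  column_lt : j < μ
  not_right : ¬ μ - r ≤ j
  not_left : j ≠ 0
  tail : A = tailSide (2 * μ) s j
  head : B = headSide (2 * μ) s j

/-- The super-teams `A` and `B` play a normal super-game in slot `s`. -/
def MeetNormally (μ r s A B : ℕ) : Prop :=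
  ∃ j, NormalGame μ r s j A B ∨ NormalGame μ r s j B A

/-- Two super-teams some of whose games may lie outside the normal super-games. -/
def IrregularPair (μ r A B : ℕ) : Prop :=
  A = B ∨
  (∃ s j, s + 1 < 2 * μ ∧ j < μ ∧ (μ - r ≤ j ∨ j = 0 ∨ s + 2 = 2 * μ) ∧
    InColumn (2 * μ) s j A ∧ InColumn (2 * μ) s j B) ∨
  ∃ i, i < r ∧ (B = (A + (2 * i + 1)) % (2 * μ - 1) ∨ A = (B + (2 * i + 1)) % (2 * μ - 1))

/-- Two teams whose games may lie outside the normal super-games; this does not depend on the homes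
of the teams. -/
def Irregular : Team k (2 * μ) r → Team k (2 * μ) r → Prop
  | .inl (A, _), .inl (B, _) => IrregularPair μ r A B
  | _, _ => True

/-- Outside the normal super-games only irregular pairs of teams meet. -/
theorem irregular_of_game {d : ℕ}
    (hd : d < 4 * k * (2 * μ - 1) + (4 * k + 4 * r - 2)) {A : Fin (2 * μ)} {p : Fin 2 × Fin k}
    {v : Team k (2 * μ) r} (hN : ∀ B : Fin (2 * μ), ¬ MeetNormally μ r (d / (4 * k)) A B)
    (h : packGame z D₁ D₂ d (.inl (A, p)) v) : Irregular (.inl (A, p)) v := by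
  rcases v with ⟨B, p'⟩ | p'
  swap
  · trivial
  change IrregularPair μ r A B
  by_cases hAB : (A : ℕ) = B
  · exact Or.inl hAB
  by_cases hd' : d < 4 * k * (2 * μ - 1)
  · obtain ⟨s, q, hs, hq, rfl⟩ := exists_slot_day hd'
    obtain ⟨j, hj, h1⟩ := (packGame_super hs hq).1 h
    have hA := inCol_inl.1 (oriented_inCol h1).1
    have hB := inCol_inl.1 (oriented_inCol h1).2
    refine Or.inr (Or.inl ⟨s, j, hs, hj, ?_, hA, hB⟩)
    by_contra hcon
    rw [Nat.mul_add_div (by omega), Nat.div_eq_of_lt hq, add_zero] at hN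
    unfold InColumn at hA hB
    refine hN B ⟨j, ?_⟩
    rcases hA with hA | hA
    · exact Or.inl ⟨by omega, hj, by omega, by omega, by omega, by omega⟩
    · exact Or.inr ⟨by omega, hj, by omega, by omega, by omega, by omega⟩
  · obtain ⟨t, rfl⟩ : ∃ t, d = 4 * k * (2 * μ - 1) + t := ⟨d - 4 * k * (2 * μ - 1), by omega⟩
    rw [packGame_tail] at h
    rcases h with ⟨u', v', hu, hv, -⟩ | ⟨ht, h⟩ | ⟨-, h⟩
    · exfalso
      simp only [toFixed] at hu hv
      split_ifs at hu hv
      omega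
    · refine Or.inr (Or.inr ⟨t / 4, by omega, ?_⟩)
      rcases h with ⟨-, h⟩ | ⟨-, h⟩
      · exact Or.inl (leftoverPair_inl.1 h).2.1
      · exact Or.inr (leftoverPair_inl.1 h).2.1
    · exact absurd (congrArg Fin.val (insideGame_inl.1 h).2.1) hAB

end Irregular

section NormalSlot

variable {k μ r : ℕ} {z : Team k (2 * μ) r → ℝ}
  {D₁ : ℕ → FixedTeam k r → FixedTeam k r → Prop}
  {D₂ : Fin (2 * μ) → ℕ → SuperTeam k → SuperTeam k → Prop} {s j : ℕ} {A B : Fin (2 * μ)}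

/-- The homes of the teams of a cycle-team. -/
def cycleHomes (z : Team k (2 * μ) r → ℝ) (A : Fin (2 * μ)) (h : Fin 2) (i : Fin k) : ℝ :=
  z (.inl (A, h, i))

/-- Total distance between two cycle-teams. -/
noncomputable def cycleDist (z : Team k (2 * μ) r → ℝ) (A : Fin (2 * μ)) (h : Fin 2)
    (B : Fin (2 * μ)) (h' : Fin 2) : ℝ :=
  ∑ i, ∑ i', |cycleHomes z A h i - cycleHomes z B h' i'|

theorem cycleDist_comm (z : Team k (2 * μ) r → ℝ) (A : Fin (2 * μ)) (h : Fin 2)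
    (B : Fin (2 * μ)) (h' : Fin 2) : cycleDist z A h B h' = cycleDist z B h' A h := by
  unfold cycleDist
  rw [sum_comm]
  simp only [abs_sub_comm]

theorem endCost_bestShift_le (hk : 0 < k) (z : Team k (2 * μ) r → ℝ) (A : Fin (2 * μ)) (h : Fin 2)
    (B : Fin (2 * μ)) (h' : Fin 2) :
    endCost (cycleHomes z A h) (cycleHomes z B h') (bestShift z A h B h') ≤
      2 / k * cycleDist z A h B h' := by
  refine endCost_le_of_best hk ?_
  obtain ⟨c, hc, hmin⟩ := exists_min_image (range k) (shiftCost z A h B h') ⟨0, mem_range.2 hk⟩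
  exact (Nat.sInf_mem (s := {c | c < k ∧ ∀ c', c' < k → shiftCost z A h B h' c ≤
    shiftCost z A h B h' c'}) ⟨c, mem_range.1 hc, fun c' hc' => hmin c' (mem_range.2 hc')⟩).2

theorem normal_day_lt (hk : 0 < k) (hs : s + 2 < 2 * μ) {H c l : ℕ} (hH : H < 2) (hc : c < 2)
    (hl : l < k) : 4 * k * s + (2 * k * H + k * c + l) < days (Team k (2 * μ) r) := by
  rw [days_team hk (by omega)]
  have := slot_lt (show s + 1 < 2 * μ by omega) (day_lt hH hc hl)
  omega

theorem NormalGame.colRev_iff (hN : NormalGame μ r s j A B) {H c l : ℕ} (hc : c < 2)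
    (hl : l < k) : colRev k μ r s j (2 * k * H + k * c + l) ↔ c = 1 := by
  have := hN.slot_lt
  have := hN.not_left
  rw [colRev_decode μ r s j hc hl, if_neg hN.not_right, if_neg (by omega)]

theorem NormalGame.colPair (hN : NormalGame μ r s j A B) {H c l : ℕ} (hc : c < 2) (hl : l < k)
    {h h' : Fin 2} (hh : (h' : ℕ) = (h + H) % 2) (a : Fin k) :
    colPair z s j (2 * k * H + k * c + l) (.inl (A, h, a))
      (.inl (B, h', rot a (l + bestShift z A h B h'))) := by
  have := hN.slot_lt
  have := hN.not_left
  obtain ⟨e1, -, e3⟩ := day_decode (H := H) hc hl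
  unfold LDTTP.colPair
  rw [if_neg hN.not_right, if_neg (by omega), cyclePair_inl, e1, e3]
  exact ⟨hN.tail, hN.head, hh, rfl⟩

theorem NormalGame.onTail (hN : NormalGame μ r s j A B) (p : Fin 2 × Fin k) :
    OnTail s j (.inl (A, p) : Team k (2 * μ) r) := hN.tail

theorem NormalGame.onHead (hN : NormalGame μ r s j A B) (p : Fin 2 × Fin k) :
    OnHead s j (.inl (B, p) : Team k (2 * μ) r) := hN.head

theorem venue_tail_away (hk : 0 < k) (hG : IsTTP k (packGame z D₁ D₂))
    (hN : NormalGame μ r s j A B) {H l : ℕ} (hH : H < 2) (hl : l < k) {h h' : Fin 2}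
    (hh : (h' : ℕ) = (h + H) % 2) (a : Fin k) :
    venue (packGame z D₁ D₂) (.inl (A, h, a)) (4 * k * s + (2 * k * H + k * 0 + l) + 1) =
      .inl (B, h', rot a (l + bestShift z A h B h')) := by
  have hs := hN.slot_lt
  refine hG.venue_succ (normal_day_lt hk hs hH two_pos hl) ?_
  refine (packGame_of_inCol (by omega) (day_lt hH two_pos hl) hN.column_lt
    (Or.inl (hN.onTail _))).2 (Or.inl ⟨?_, hN.colPair two_pos hl hh a⟩)
  rw [hN.colRev_iff two_pos hl]
  omega

theorem venue_head_away (hk : 0 < k) (hG : IsTTP k (packGame z D₁ D₂))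
    (hN : NormalGame μ r s j A B) {H l : ℕ} (hH : H < 2) (hl : l < k) {h h' : Fin 2}
    (hh : (h' : ℕ) = (h + H) % 2) (a : Fin k) :
    venue (packGame z D₁ D₂) (.inl (B, h', rot a (l + bestShift z A h B h')))
      (4 * k * s + (2 * k * H + k * 1 + l) + 1) = .inl (A, h, a) := by
  have hs := hN.slot_lt
  refine hG.venue_succ (normal_day_lt hk hs hH one_lt_two hl) ?_
  refine (packGame_of_inCol (by omega) (day_lt hH one_lt_two hl) hN.column_lt
    (Or.inr (hN.onHead _))).2 (Or.inr ⟨?_, hN.colPair one_lt_two hl hh a⟩)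
  rw [hN.colRev_iff one_lt_two hl]

theorem venue_tail_home (hN : NormalGame μ r s j A B) {H l : ℕ} (hH : H < 2) (hl : l < k)
    (p : Fin 2 × Fin k) :
    venue (packGame z D₁ D₂) (.inl (A, p)) (4 * k * s + (2 * k * H + k * 1 + l) + 1) =
      .inl (A, p) := by
  have hs := hN.slot_lt
  refine venue_succ_of_not fun hv => ?_
  refine (away_onTail (by omega) (day_lt hH one_lt_two hl) hN.column_lt (hN.onTail p)).1 hv.2 ?_
  rw [hN.colRev_iff one_lt_two hl]

theorem venue_head_home (hN : NormalGame μ r s j A B) {H l : ℕ} (hH : H < 2) (hl : l < k)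
    (p : Fin 2 × Fin k) :
    venue (packGame z D₁ D₂) (.inl (B, p)) (4 * k * s + (2 * k * H + k * 0 + l) + 1) =
      .inl (B, p) := by
  have hs := hN.slot_lt
  refine venue_succ_of_not fun hv => ?_
  have := (away_onHead (by omega) (day_lt hH two_pos hl) hN.column_lt (hN.onHead p)).1 hv.2
  rw [hN.colRev_iff two_pos hl] at this
  omega

theorem sum_four_blocks (k : ℕ) (f : ℕ → ℝ) : ∑ H ∈ range 4, f (k * H) =
    ∑ H ∈ range 2, (f (2 * k * H + k * 0) + f (2 * k * H + k * 1)) := by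
  simp only [sum_range_succ, sum_range_zero]
  rw [show 2 * k * 0 + k * 0 = k * 0 by ring, show 2 * k * 0 + k * 1 = k * 1 by ring,
    show 2 * k * 1 + k * 0 = k * 2 by ring, show 2 * k * 1 + k * 1 = k * 3 by ring]
  ring

/-- The cost of the trips of a team in slot `s`. -/
noncomputable def slotCost (z : Team k (2 * μ) r → ℝ)
    (G : ℕ → Team k (2 * μ) r → Team k (2 * μ) r → Prop) (s : ℕ) (u : Team k (2 * μ) r) : ℝ :=
  ∑ H ∈ range 4, tripCost k (z u) (fun l => z (venue G u (4 * k * s + k * H + l + 1)))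

/-- In a normal super-game, the best relabelling costs at most the average one. -/
theorem sum_slotCost_le (hk : 0 < k) (hG : IsTTP k (packGame z D₁ D₂))
    (hAB : MeetNormally μ r s A B) :
    ∑ h, ∑ a, slotCost z (packGame z D₁ D₂) s (.inl (A, h, a)) ≤
      ∑ h, ∑ h', (2 / k * cycleDist z A h B h' + (k - 1) * cycleWeight (cycleHomes z B h')) := by
  obtain ⟨j, hN | hN⟩ := hAB
  · refine sum_le_sum fun h _ => ?_
    have e : ∀ a, slotCost z (packGame z D₁ D₂) s (.inl (A, h, a)) = ∑ h' : Fin 2,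
        tripCost k (cycleHomes z A h a)
          (fun l => cycleHomes z B h' (rot a (l + bestShift z A h B h'))) := by
      intro a
      unfold slotCost
      have e1 := sum_four_blocks k (fun q => tripCost k (z (.inl (A, h, a)))
        (fun l => z (venue (packGame z D₁ D₂) (.inl (A, h, a)) (4 * k * s + q + l + 1))))
      rw [e1, sum_two_shift h]
      refine sum_congr rfl fun h' _ => ?_
      have hH : ((h : ℕ) + h') % 2 < 2 := Nat.mod_lt _ two_pos
      have hh : (h' : ℕ) = (h + ((h : ℕ) + h') % 2) % 2 := by omega
      rw [tripCost_eq_zero (f := fun l => z (venue (packGame z D₁ D₂) (.inl (A, h, a))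
        (4 * k * s + (2 * k * (((h : ℕ) + h') % 2) + k * 1) + l + 1))) hk, add_zero]
      · refine tripCost_congr hk fun l hl => ?_
        rw [add_assoc (4 * k * s), venue_tail_away hk hG hN hH hl hh]
        rfl
      · intro l hl
        rw [add_assoc (4 * k * s), venue_tail_home hN hH hl]
    rw [sum_congr rfl (fun a _ => e a), sum_comm]
    refine sum_le_sum fun h' _ => ?_
    rw [sum_tripCost_tail hk]
    exact add_le_add (endCost_bestShift_le hk z A h B h') le_rfl
  · refine sum_le_sum fun h _ => ?_
    have e : ∀ a, slotCost z (packGame z D₁ D₂) s (.inl (A, h, a)) = ∑ h' : Fin 2,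
        tripCost k (cycleHomes z A h a)
          (fun l => z (venue (packGame z D₁ D₂) (.inl (A, h, a))
            (4 * k * s + (2 * k * (((h : ℕ) + h') % 2) + k * 1) + l + 1))) := by
      intro a
      unfold slotCost
      have e1 := sum_four_blocks k (fun q => tripCost k (z (.inl (A, h, a)))
        (fun l => z (venue (packGame z D₁ D₂) (.inl (A, h, a)) (4 * k * s + q + l + 1))))
      rw [e1, sum_two_shift h]
      refine sum_congr rfl fun h' _ => ?_
      have hH : ((h : ℕ) + h') % 2 < 2 := Nat.mod_lt _ two_pos
      rw [tripCost_eq_zero hk, zero_add]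
      · rfl
      · intro l hl
        rw [add_assoc (4 * k * s), venue_head_home hN hH hl]
    rw [sum_congr rfl (fun a _ => e a), sum_comm]
    refine sum_le_sum fun h' _ => ?_
    rw [sum_tripCost_head hk (cycleHomes z B h') (cycleHomes z A h) (bestShift z B h' A h)]
    · rw [cycleDist_comm]
      exact add_le_add (endCost_bestShift_le hk z B h' A h) le_rfl
    · intro a l hl
      have hH : ((h : ℕ) + h') % 2 < 2 := Nat.mod_lt _ two_pos
      have hh : (h : ℕ) = (h' + ((h : ℕ) + h') % 2) % 2 := by omega
      rw [add_assoc (4 * k * s), venue_head_away hk hG hN hH hl hh]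
      rfl

end NormalSlot

section Total

variable {k μ r : ℕ} {z : Team k (2 * μ) r → ℝ}
  {D₁ : ℕ → FixedTeam k r → FixedTeam k r → Prop}
  {D₂ : Fin (2 * μ) → ℕ → SuperTeam k → SuperTeam k → Prop}

theorem MeetNormally.slot_unique {s s' : ℕ} {A B : ℕ} (hAB : A ≠ B)
    (h : MeetNormally μ r s A B) (h' : MeetNormally μ r s' A B) : s = s' := by
  have sides : ∀ {s}, MeetNormally μ r s A B → ∃ j, s + 1 < 2 * μ ∧ j < μ ∧
      InColumn (2 * μ) s j A ∧ InColumn (2 * μ) s j B := by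
    rintro s ⟨j, h | h⟩
    · have := h.slot_lt
      exact ⟨j, by omega, h.column_lt, Or.inl h.tail.symm, Or.inr h.head.symm⟩
    · have := h.slot_lt
      exact ⟨j, by omega, h.column_lt, Or.inr h.head.symm, Or.inl h.tail.symm⟩
  obtain ⟨j, hs, hj, hA, hB⟩ := sides h
  obtain ⟨j', hs', hj', hA', hB'⟩ := sides h'
  exact (LDTTP.slot_unique hs hj hs' hj' hAB hA hB hA' hB').1

theorem MeetNormally.ne {s : ℕ} {A B : ℕ} (h : MeetNormally μ r s A B) : A ≠ B := by
  obtain ⟨j, h | h⟩ := h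
  all_goals
    have := h.slot_lt
    have := tailSide_ne_headSide (show s + 1 < 2 * μ by omega) h.column_lt
    have := h.tail
    have := h.head
    omega

/-- The trips of a super-team in its normal super-games. -/
theorem sum_normal_slots_le (hk : 0 < k) (hG : IsTTP k (packGame z D₁ D₂)) (A : Fin (2 * μ))
    (N : ℕ → Prop) [DecidablePred N] (hN : ∀ s, N s ↔ ∃ B : Fin (2 * μ), MeetNormally μ r s A B)
    (S : ℕ) :
    ∑ h, ∑ a, ∑ s ∈ range S,
        (if N s then slotCost z (packGame z D₁ D₂) s (.inl (A, h, a)) else 0) ≤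
      ∑ B, ∑ h, ∑ h', (2 / k * cycleDist z A h B h' +
        (k - 1) * cycleWeight (cycleHomes z B h')) := by
  classical
  have hk1 : (1 : ℝ) ≤ k := by exact_mod_cast hk
  have e : ∑ h, ∑ a, ∑ s ∈ range S,
        (if N s then slotCost z (packGame z D₁ D₂) s (.inl (A, h, a)) else 0) =
      ∑ s ∈ range S with N s, ∑ h, ∑ a, slotCost z (packGame z D₁ D₂) s (.inl (A, h, a)) := by
    simp only [← sum_filter]
    rw [sum_congr rfl (fun h _ => sum_comm), sum_comm]
  set f : Fin (2 * μ) → ℝ := fun B => ∑ h, ∑ h', (2 / k * cycleDist z A h B h' +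
        (k - 1) * cycleWeight (cycleHomes z B h')) with hf
  have hf0 : ∀ B, 0 ≤ f B := by
    intro B
    refine sum_nonneg fun h _ => sum_nonneg fun h' _ => add_nonneg (mul_nonneg (by positivity) ?_)
      (mul_nonneg (by linarith) (cycleWeight_nonneg _))
    exact sum_nonneg fun _ _ => sum_nonneg fun _ _ => abs_nonneg _
  set o : ℕ → Fin (2 * μ) := fun s =>
    if h : ∃ B : Fin (2 * μ), MeetNormally μ r s A B then h.choose else A with ho
  have ho' : ∀ s, N s → MeetNormally μ r s A (o s) := by
    intro s hs
    have h := (hN s).1 hs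
    simp only [ho, dif_pos h]
    exact h.choose_spec
  rw [e]
  calc _ ≤ ∑ s ∈ range S with N s, f (o s) :=
        sum_le_sum fun s hs => sum_slotCost_le hk hG (ho' s (mem_filter.1 hs).2)
    _ = ∑ B ∈ ((range S).filter N).image o, f B := by
        refine (sum_image fun s hs s' hs' h => ?_).symm
        have h1 := ho' s (mem_filter.1 hs).2
        have h2 := ho' s' (mem_filter.1 hs').2
        rw [← h] at h2
        exact h1.slot_unique h1.ne h2
    _ ≤ ∑ B, f B := sum_le_sum_of_subset_of_nonneg (subset_univ _) fun B _ _ => hf0 B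

theorem sum_cycleDist_le (z : Team k (2 * μ) r → ℝ) :
    ∑ A, ∑ B, ∑ h, ∑ h', cycleDist z A h B h' ≤ pairSum z := by
  have e : ∑ A, ∑ B, ∑ h, ∑ h', cycleDist z A h B h' =
      ∑ p : Fin (2 * μ) × Fin 2 × Fin k, ∑ p' : Fin (2 * μ) × Fin 2 × Fin k,
        |z (.inl p) - z (.inl p')| := by
    simp only [Fintype.sum_prod_type, cycleDist]
    refine sum_congr rfl fun A _ => ?_
    rw [sum_comm]
    refine sum_congr rfl fun h _ => ?_
    rw [sum_comm (s := (univ : Finset (Fin k)))]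
    exact sum_congr rfl fun B _ => sum_comm.symm
  rw [e, pairSum, Fintype.sum_sum_type]
  refine le_trans ?_ (le_add_of_nonneg_right (sum_nonneg fun _ _ => sum_nonneg fun _ _ =>
    abs_nonneg _))
  refine sum_le_sum fun p _ => ?_
  rw [Fintype.sum_sum_type]
  exact le_add_of_nonneg_right (sum_nonneg fun _ _ => abs_nonneg _)

open Classical in
/-- The travel distance of the cycle packing schedule, up to the games outside the normal
super-games. -/
theorem travel_packGame_le (hk : 0 < k) (hμ : 0 < μ) (hG : IsTTP k (packGame z D₁ D₂)) :
    travel z (packGame z D₁ D₂) ≤ 2 * (∑ u, ∑ v, if Irregular u v then |z u - z v| else 0) +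
      2 / k * pairSum z + 2 * (2 * μ) * (k - 1) * ∑ A, ∑ h, cycleWeight (cycleHomes z A h) := by
  set G := packGame z D₁ D₂ with hGdef
  have hD := days_team (r := r) hk hμ
  set N : Fin (2 * μ) → ℕ → Prop := fun A s => ∃ B : Fin (2 * μ), MeetNormally μ r s A B with hN
  have hinl : ∀ A h a, ∑ t ∈ range (days (Team k (2 * μ) r) + 1),
      |z (venue G (.inl (A, h, a)) t) - z (venue G (.inl (A, h, a)) (t + 1))| ≤
      2 * (∑ v, if Irregular (.inl (A, h, a)) v then |z (.inl (A, h, a)) - z v| else 0) +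
        ∑ s ∈ range (2 * μ - 1), if N A s then slotCost z G s (.inl (A, h, a)) else 0 := by
    intro A h a
    refine hG.sum_legs_le hk z _ hD (N A) ?_ _ ?_
    · rintro s ⟨B, j, h | h⟩
      all_goals
        have := h.slot_lt
        omega
    · intro d hd hNd v hv
      rw [hD] at hd
      exact irregular_of_game hd (fun B hB => hNd ⟨B, hB⟩) hv
  have hinr : ∀ p, ∑ t ∈ range (days (Team k (2 * μ) r) + 1),
      |z (venue G (.inr p) t) - z (venue G (.inr p) (t + 1))| ≤
      2 * (∑ v, if Irregular (.inr p) v then |z (.inr p) - z v| else 0) := by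
    intro p
    have := hG.sum_legs_le hk z (.inr p) hD (fun _ => False) (fun _ h => h.elim)
      (fun v => Irregular (.inr p) v) (fun _ _ _ _ _ => trivial)
    simpa using this
  have hnorm : ∀ A, ∑ h, ∑ a, ∑ s ∈ range (2 * μ - 1),
      (if N A s then slotCost z G s (.inl (A, h, a)) else 0) ≤ _ := fun A =>
    sum_normal_slots_le hk hG A (N A) (fun s => Iff.rfl) (2 * μ - 1)
  have hlast : ∑ A, ∑ B, ∑ h, ∑ h', (2 / k * cycleDist z A h B h' +
        (k - 1) * cycleWeight (cycleHomes z B h')) ≤ 2 / k * pairSum z +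
          2 * (2 * μ) * (k - 1) * ∑ A, ∑ h, cycleWeight (cycleHomes z A h) := by
    simp only [sum_add_distrib, ← mul_sum]
    refine add_le_add (mul_le_mul_of_nonneg_left (sum_cycleDist_le z) (by positivity)) ?_
    simp only [sum_const, card_univ, Fintype.card_fin, nsmul_eq_mul, ← mul_sum]
    push_cast
    exact le_of_eq (by ring)
  unfold travel
  rw [Fintype.sum_sum_type]
  have h1 : ∑ p : Fin (2 * μ) × Fin 2 × Fin k, ∑ t ∈ range (days (Team k (2 * μ) r) + 1),
      |z (venue G (.inl p) t) - z (venue G (.inl p) (t + 1))| ≤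
      2 * (∑ p : Fin (2 * μ) × Fin 2 × Fin k, ∑ v,
        if Irregular (.inl p) v then |z (.inl p) - z v| else 0) +
      ∑ A, ∑ h, ∑ a, ∑ s ∈ range (2 * μ - 1),
        (if N A s then slotCost z G s (.inl (A, h, a)) else 0) := by
    rw [mul_sum]
    simp only [Fintype.sum_prod_type]
    simp only [← sum_add_distrib]
    exact sum_le_sum fun A _ => sum_le_sum fun h _ => sum_le_sum fun a _ => hinl A h a
  have h2 := sum_le_sum fun p (_ : p ∈ (univ : Finset (Fin r × Fin 2))) => hinr p
  have h3 := sum_le_sum fun A (_ : A ∈ (univ : Finset (Fin (2 * μ)))) => hnorm A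
  rw [← mul_sum] at h2
  rw [Fintype.sum_sum_type]
  linarith

end Total

/-! ### Random labellings -/

section Labellings

variable {ι κ : Type*} [Fintype ι] [DecidableEq ι] [Fintype κ] [DecidableEq κ]

theorem exists_perm_apply_pair {ι : Type*} [DecidableEq ι] {p q p' q' : ι} (h : p ≠ q)
    (h' : p' ≠ q') :
    ∃ σ : Equiv.Perm ι, σ p = p' ∧ σ q = q' := by
  refine ⟨(Equiv.swap p p').trans (Equiv.swap (Equiv.swap p p' q) q'), ?_, ?_⟩
  · rw [Equiv.trans_apply, Equiv.swap_apply_left, Equiv.swap_apply_of_ne_of_ne _ h']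
    exact fun e => h ((Equiv.swap p p').injective ((Equiv.swap_apply_left p p').trans e))
  · rw [Equiv.trans_apply, Equiv.swap_apply_left]

/-- Under a random labelling, two different places get a uniformly random pair of different
labels. -/
theorem sum_equiv_apply_pair (F : κ → κ → ℝ) {p q : ι} (hpq : p ≠ q) :
    (Fintype.card ι * (Fintype.card ι - 1) : ℝ) * ∑ e : ι ≃ κ, F (e p) (e q) =
      Fintype.card (ι ≃ κ) * ∑ c, ∑ c', if c ≠ c' then F c c' else 0 := by
  have hT : ∀ p' q', p' ≠ q' → ∑ e : ι ≃ κ, F (e p') (e q') = ∑ e : ι ≃ κ, F (e p) (e q) := by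
    intro p' q' h'
    obtain ⟨σ, rfl, rfl⟩ := exists_perm_apply_pair hpq h'
    exact ((Equiv.equivCongr σ.symm (Equiv.refl κ)).sum_comp
      (fun e : ι ≃ κ => F (e p) (e q))).symm ▸ rfl
  have h1 : ∑ p', ∑ q', ∑ e : ι ≃ κ, (if p' ≠ q' then F (e p') (e q') else 0) =
      (Fintype.card ι * (Fintype.card ι - 1) : ℝ) * ∑ e : ι ≃ κ, F (e p) (e q) := by
    have h2 : ∀ p' ∈ (univ : Finset ι), ∑ q', ∑ e : ι ≃ κ,
        (if p' ≠ q' then F (e p') (e q') else 0) =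
        (Fintype.card ι - 1 : ℝ) * ∑ e : ι ≃ κ, F (e p) (e q) := by
      intro p' _
      have h3 : ∀ q' ∈ (univ : Finset ι), ∑ e : ι ≃ κ,
          (if p' ≠ q' then F (e p') (e q') else 0) =
          ∑ e : ι ≃ κ, F (e p) (e q) - if p' = q' then ∑ e : ι ≃ κ, F (e p) (e q) else 0 := by
        intro q' _
        by_cases h : p' = q'
        · simp [h]
        · simp [h, hT p' q' h]
      rw [sum_congr rfl h3, sum_sub_distrib, sum_ite_eq, if_pos (mem_univ _), sum_const, card_univ,
        nsmul_eq_mul]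
      ring
    rw [sum_congr rfl h2, sum_const, card_univ, nsmul_eq_mul]
    ring
  rw [← h1]
  have h4 : ∀ e ∈ (univ : Finset (ι ≃ κ)), ∑ p', ∑ q', (if p' ≠ q' then F (e p') (e q') else 0) =
      ∑ c, ∑ c', if c ≠ c' then F c c' else 0 := by
    intro e _
    rw [← e.sum_comp]
    refine sum_congr rfl fun p' _ => ?_
    rw [← e.sum_comp]
    refine sum_congr rfl fun q' _ => ?_
    simp only [ne_eq, e.apply_eq_iff_eq]
  rw [← nsmul_eq_mul, ← card_univ, ← sum_const, ← sum_congr rfl h4]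
  rw [sum_congr rfl (fun p' _ => sum_comm), sum_comm]

open Classical in
/-- The expected total weight of the pairs of labels at the places related by `R`. -/
theorem sum_equiv_related_le (F : κ → κ → ℝ) (hF : ∀ c c', 0 ≤ F c c') (R : ι → ι → Prop)
    (hι : 2 ≤ Fintype.card ι) :
    ∑ e : ι ≃ κ, ∑ p, ∑ q, (if R p q then F (e p) (e q) else 0) ≤
      Fintype.card (ι ≃ κ) * (∑ c, F c c + #{p : ι × ι | R p.1 p.2} *
        ((∑ c, ∑ c', F c c') / (Fintype.card ι * (Fintype.card ι - 1)))) := by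
  have hιr : (2 : ℝ) ≤ Fintype.card ι := by exact_mod_cast hι
  have hpos : (0 : ℝ) < Fintype.card ι * (Fintype.card ι - 1) :=
    mul_pos (by linarith) (by linarith)
  have h1 : ∀ e : ι ≃ κ, ∑ p, ∑ q, (if R p q then F (e p) (e q) else 0) ≤
      ∑ c, F c c + ∑ p, ∑ q, (if R p q ∧ p ≠ q then F (e p) (e q) else 0) := by
    intro e
    rw [← e.sum_comp, ← sum_add_distrib]
    refine sum_le_sum fun p _ => ?_
    have : F (e p) (e p) = ∑ q, if p = q then F (e p) (e q) else 0 := by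
      rw [sum_ite_eq, if_pos (mem_univ _)]
    rw [this, ← sum_add_distrib]
    refine sum_le_sum fun q _ => ?_
    by_cases h : p = q <;> by_cases hR : R p q <;> simp [h, hR]
    · rw [if_pos (h ▸ hR)]
    · split_ifs
      · exact le_rfl
      · exact hF _ _
  refine (sum_le_sum fun e _ => h1 e).trans ?_
  rw [sum_add_distrib, sum_const, card_univ, nsmul_eq_mul, mul_add]
  refine add_le_add le_rfl ?_
  rw [sum_comm, sum_congr rfl (fun p _ => sum_comm)]
  have h2 : ∀ p q, ∑ e : ι ≃ κ, (if R p q ∧ p ≠ q then F (e p) (e q) else 0) ≤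
      if R p q then Fintype.card (ι ≃ κ) *
        ((∑ c, ∑ c', F c c') / (Fintype.card ι * (Fintype.card ι - 1))) else 0 := by
    intro p q
    have hS : 0 ≤ ∑ c, ∑ c', F c c' := sum_nonneg fun _ _ => sum_nonneg fun _ _ => hF _ _
    by_cases hR : R p q
    · rw [if_pos hR]
      by_cases h : p = q
      · simp only [h, ne_eq, not_true_eq_false, and_false, if_false, sum_const_zero]
        exact mul_nonneg (Nat.cast_nonneg _) (div_nonneg hS hpos.le)
      · simp only [hR, ne_eq, h, not_false_eq_true, and_self, if_true]
        rw [mul_div_assoc', le_div_iff₀ hpos, mul_comm, sum_equiv_apply_pair F h]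
        refine mul_le_mul_of_nonneg_left ?_ (Nat.cast_nonneg _)
        refine sum_le_sum fun c _ => sum_le_sum fun c' _ => ?_
        split_ifs
        · exact le_rfl
        · exact hF _ _
    · simp [hR]
  refine (sum_le_sum fun p _ => sum_le_sum fun q _ => h2 p q).trans (le_of_eq ?_)
  rw [← Fintype.sum_prod_type' (f := fun p q => if R p q then (Fintype.card (ι ≃ κ) : ℝ) *
        ((∑ c, ∑ c', F c c') / (Fintype.card ι * (Fintype.card ι - 1))) else 0),
    ← sum_filter, sum_const, nsmul_eq_mul]
  ring

end Labellings

/-! ### The number of irregular pairs -/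

section Count

variable {μ r : ℕ}

open Classical in
/-- Only `O(μ r)` of the `4μ²` pairs of super-teams are irregular: every slot has at most `r + 1`
columns that are not normal, except for the last slot with its `μ` columns. -/
theorem card_irregularPair_le (μ r : ℕ) :
    #{p ∈ range (2 * μ) ×ˢ range (2 * μ) | IrregularPair μ r p.1 p.2} ≤ 2 * μ * (7 + 6 * r) := by
  set T : Finset (ℕ × ℕ) := range (2 * μ) ×ˢ Ico (μ - r) μ ∪ (range (2 * μ) ×ˢ {0} ∪
    {2 * μ - 2} ×ˢ range μ) with hT
  set sides : ℕ × ℕ → Finset (ℕ × ℕ) := fun c =>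
    {tailSide (2 * μ) c.1 c.2, headSide (2 * μ) c.1 c.2} ×ˢ
      {tailSide (2 * μ) c.1 c.2, headSide (2 * μ) c.1 c.2} with hsides
  have hsub : (range (2 * μ) ×ˢ range (2 * μ)).filter (fun p => IrregularPair μ r p.1 p.2) ⊆
      (range (2 * μ)).image (fun A => (A, A)) ∪ (T.biUnion sides ∪
        ((range (2 * μ) ×ˢ range r).image (fun c => (c.1, (c.1 + (2 * c.2 + 1)) % (2 * μ - 1))) ∪
        (range (2 * μ) ×ˢ range r).image
          (fun c => ((c.1 + (2 * c.2 + 1)) % (2 * μ - 1), c.1)))) := by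
    rintro ⟨A, B⟩ h
    simp only [mem_filter, mem_product, mem_range] at h
    obtain ⟨⟨hA, hB⟩, h⟩ := h
    rcases h with h | ⟨s, j, hs, hj, hc, hjA, hjB⟩ | ⟨i, hi, h⟩
    · subst h
      exact mem_union_left _ (mem_image.2 ⟨A, mem_range.2 hA, rfl⟩)
    · refine mem_union_right _ (mem_union_left _ (mem_biUnion.2 ⟨(s, j), ?_, ?_⟩))
      · simp only [hT, mem_union, mem_product, mem_range, mem_Ico, mem_singleton]
        omega
      · simp only [hsides, mem_product, mem_insert, mem_singleton]
        unfold InColumn at hjA hjB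
        exact ⟨hjA.imp Eq.symm Eq.symm, hjB.imp Eq.symm Eq.symm⟩
    · refine mem_union_right _ (mem_union_right _ ?_)
      rcases h with h | h
      · exact mem_union_left _ (mem_image.2 ⟨(A, i), mem_product.2 ⟨mem_range.2 hA, mem_range.2 hi⟩,
          by rw [h]⟩)
      · exact mem_union_right _ (mem_image.2 ⟨(B, i), mem_product.2 ⟨mem_range.2 hB,
          mem_range.2 hi⟩, by rw [h]⟩)
  have c1 : #((range (2 * μ)).image (fun A => (A, A))) ≤ 2 * μ :=
    card_image_le.trans (card_range _).le
  have c2 : #T ≤ 2 * μ * r + (2 * μ + μ) := by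
    refine (card_union_le _ _).trans (add_le_add ?_ ((card_union_le _ _).trans (add_le_add ?_ ?_)))
    · rw [card_product, card_range, Nat.card_Ico]
      exact Nat.mul_le_mul_left _ (by omega)
    · rw [card_product, card_range, card_singleton, mul_one]
    · rw [card_product, card_range, card_singleton, one_mul]
  have c3 : #(T.biUnion sides) ≤ #T * 4 := by
    refine card_biUnion_le_card_mul _ _ _ fun c _ => ?_
    rw [hsides, card_product]
    exact Nat.mul_le_mul card_le_two card_le_two
  have c4 : ∀ f : ℕ × ℕ → ℕ × ℕ, #((range (2 * μ) ×ˢ range r).image f) ≤ 2 * μ * r := fun f =>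
    card_image_le.trans (by rw [card_product, card_range, card_range])
  refine (card_le_card hsub).trans ((card_union_le _ _).trans ?_)
  have u1 := card_union_le (T.biUnion sides)
    ((range (2 * μ) ×ˢ range r).image (fun c => (c.1, (c.1 + (2 * c.2 + 1)) % (2 * μ - 1))) ∪
        (range (2 * μ) ×ˢ range r).image (fun c => ((c.1 + (2 * c.2 + 1)) % (2 * μ - 1), c.1)))
  have u2 := card_union_le
    ((range (2 * μ) ×ˢ range r).image (fun c => (c.1, (c.1 + (2 * c.2 + 1)) % (2 * μ - 1))))
    ((range (2 * μ) ×ˢ range r).image (fun c => ((c.1 + (2 * c.2 + 1)) % (2 * μ - 1), c.1)))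
  have c5 := c4 (fun c => (c.1, (c.1 + (2 * c.2 + 1)) % (2 * μ - 1)))
  have c6 := c4 (fun c => ((c.1 + (2 * c.2 + 1)) % (2 * μ - 1), c.1))
  have e : 2 * μ * (7 + 6 * r) =
      2 * μ + ((2 * μ * r + (2 * μ + μ)) * 4 + (2 * μ * r + 2 * μ * r)) := by
    ring
  omega

open Classical in
theorem card_irregular_cycles_le (μ r : ℕ) :
    #{p : (Fin (2 * μ) × Fin 2) × (Fin (2 * μ) × Fin 2) | IrregularPair μ r p.1.1 p.2.1} ≤
      8 * μ * (7 + 6 * r) := by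
  have h1 : #{p : (Fin (2 * μ) × Fin 2) × (Fin (2 * μ) × Fin 2) | IrregularPair μ r p.1.1 p.2.1} ≤
      #((((range (2 * μ) ×ˢ range (2 * μ)).filter (fun p => IrregularPair μ r p.1 p.2))) ×ˢ
        (univ : Finset (Fin 2 × Fin 2))) := by
    refine card_le_card_of_injOn (fun p => (((p.1.1 : ℕ), (p.2.1 : ℕ)), (p.1.2, p.2.2))) ?_ ?_
    · rintro ⟨⟨A, h⟩, ⟨B, h'⟩⟩ hp
      simp only [coe_filter, mem_univ, true_and, Set.mem_ofPred_eq] at hp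
      simp only [coe_product, coe_filter, coe_univ, Set.mem_prod, Set.mem_ofPred_eq, mem_product,
        mem_range, Set.mem_univ, and_true]
      exact ⟨⟨A.2, B.2⟩, hp⟩
    · rintro ⟨⟨A, h⟩, ⟨B, h'⟩⟩ - ⟨⟨A', g⟩, ⟨B', g'⟩⟩ - e
      simp only [Prod.mk.injEq] at e
      obtain ⟨⟨e1, e2⟩, e3, e4⟩ := e
      rw [Fin.ext e1, Fin.ext e2, e3, e4]
  rw [card_product, card_univ, Fintype.card_prod, Fintype.card_fin] at h1
  have := card_irregularPair_le μ r
  have e : 8 * μ * (7 + 6 * r) = 2 * μ * (7 + 6 * r) * (2 * 2) := by ring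
  rw [e]
  exact h1.trans (Nat.mul_le_mul_right _ this)

end Count

/-! ### The expected weight of the schedule -/

section Expectation

theorem pairSum_comp_equiv {V W : Type*} [Fintype V] [Fintype W] (e : V ≃ W) (x : W → ℝ) :
    pairSum (fun v => x (e v)) = pairSum x := by
  unfold pairSum
  rw [← e.sum_comp]
  exact sum_congr rfl fun u _ => e.sum_comp (fun v => |x (e u) - x v|)

variable {n k : ℕ} {x : Fin n → ℝ} {en : Arrangement n k}

/-- Total distance between two cycles of an arrangement. -/
noncomputable def cyclePairDist (x : Fin n → ℝ) (en : Arrangement n k)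
    (c c' : Fin (2 * numSuper n k)) : ℝ :=
  ∑ i, ∑ i', |x (en.cycles (c, i)) - x (en.cycles (c', i'))|

theorem cyclePairDist_nonneg (c c' : Fin (2 * numSuper n k)) : 0 ≤ cyclePairDist x en c c' :=
  sum_nonneg fun _ _ => sum_nonneg fun _ _ => abs_nonneg _

theorem sum_cyclePairDist_le (x : Fin n → ℝ) (en : Arrangement n k) :
    ∑ c, ∑ c', cyclePairDist x en c c' ≤ pairSum x := by
  have e : ∑ c, ∑ c', cyclePairDist x en c c' =
      ∑ p : Fin (2 * numSuper n k) × Fin k, ∑ p' : Fin (2 * numSuper n k) × Fin k,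
        |x (en (.inl p)) - x (en (.inl p'))| := by
    simp only [Fintype.sum_prod_type, cyclePairDist]
    exact sum_congr rfl fun c _ => sum_comm
  rw [e, ← pairSum_comp_equiv en, pairSum, Fintype.sum_sum_type]
  refine le_trans ?_ (le_add_of_nonneg_right (sum_nonneg fun _ _ => sum_nonneg fun _ _ =>
    abs_nonneg _))
  refine sum_le_sum fun p _ => ?_
  rw [Fintype.sum_sum_type]
  exact le_add_of_nonneg_right (sum_nonneg fun _ _ => abs_nonneg _)

theorem sum_cyclePairDist_self_le (x : Fin n → ℝ) (en : Arrangement n k) :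
    2 * ∑ c, cyclePairDist x en c c ≤ (k : ℝ) ^ 2 * packingWeight x en.cycles := by
  unfold packingWeight
  rw [mul_sum, mul_sum]
  refine sum_le_sum fun c _ => ?_
  unfold cyclePairDist
  rw [mul_sum]
  have h : ∀ i ∈ (univ : Finset (Fin k)), 2 * ∑ i', |x (en.cycles (c, i)) - x (en.cycles (c, i'))| ≤
      k * ∑ i, |x (en.cycles (c, i)) - x (en.cycles (c, rot i 1))| := by
    intro i _
    rw [mul_sum]
    refine (sum_le_sum fun i' _ => two_mul_le_cycle (fun i => x (en.cycles (c, i))) i i').trans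
      (le_of_eq ?_)
    rw [sum_const, card_univ, Fintype.card_fin, nsmul_eq_mul]
  refine (sum_le_sum h).trans (le_of_eq ?_)
  rw [sum_const, card_univ, Fintype.card_fin, nsmul_eq_mul]
  ring

/-- The teams outside the cycles have small weighted degree. -/
theorem IsConsecutive.sum_wdeg_le (h : IsConsecutive x en) :
    numSuper n k * k * ∑ p, wdeg x (en (.inr p)) ≤ numPairs n k * pairSum x := by
  have hle : ∀ p, 2 * (numSuper n k * k) * wdeg x (en (.inr p)) ≤ pairSum x := by
    intro p
    have hp : en (.inr p) ∉ univ.image en.cycles := by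
      intro hmem
      obtain ⟨q, -, hq⟩ := mem_image.1 hmem
      exact absurd (en.injective hq) (by simp)
    have h1 : #(univ.image en.cycles) • wdeg x (en (.inr p)) ≤
        ∑ u ∈ univ.image en.cycles, wdeg x u :=
      card_nsmul_le_sum _ _ _ fun u hu => wdeg_le_of_max_degree h.max_degree hu hp
    have h2 : ∑ u ∈ univ.image en.cycles, wdeg x u ≤ pairSum x :=
      sum_le_sum_of_subset_of_nonneg (subset_univ _)
        fun _ _ _ => sum_nonneg fun _ _ => abs_nonneg _
    rw [en.card_image_cycles, nsmul_eq_mul] at h1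
    push_cast at h1
    linarith
  have h3 := sum_le_sum fun p (_ : p ∈ (univ : Finset (Fin (numPairs n k) × Fin 2))) => hle p
  rw [← mul_sum, sum_const, card_univ, Fintype.card_prod, Fintype.card_fin, Fintype.card_fin,
    nsmul_eq_mul] at h3
  push_cast at h3
  linarith

/-- The labelled teams placed at the homes of the teams they stand for. -/
def labelledHomes (x : Fin n → ℝ) (en : Arrangement n k) (lab : Labelling n k) :
    Team k (2 * (n / (4 * k))) (numPairs n k) → ℝ :=
  fun t => x (assign en lab t)

theorem sum_cycleWeight_labelledHomes (x : Fin n → ℝ) (en : Arrangement n k)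
    (lab : Labelling n k) :
    ∑ A, ∑ h, cycleWeight (cycleHomes (labelledHomes x en lab) A h) =
      packingWeight x en.cycles := by
  unfold packingWeight
  rw [← lab.sum_comp, Fintype.sum_prod_type]
  rfl

open Classical in
/-- The irregular pairs of teams either involve a team-pair, or belong to two cycles at irregular
places. -/
theorem sum_irregular_le (x : Fin n → ℝ) (en : Arrangement n k) (lab : Labelling n k) :
    ∑ u, ∑ v,
        (if Irregular u v then |labelledHomes x en lab u - labelledHomes x en lab v| else 0) ≤
      2 * ∑ p, wdeg x (en (.inr p)) + ∑ p : Fin (numSuper n k) × Fin 2,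
        ∑ q : Fin (numSuper n k) × Fin 2, (if IrregularPair (n / (4 * k)) (numPairs n k) p.1 q.1
          then cyclePairDist x en (lab p) (lab q) else 0) := by
  set z := labelledHomes x en lab with hz
  have hdeg : ∀ p, ∑ v, |z (.inr p) - z v| = wdeg x (en (.inr p)) := fun p =>
    (assign en lab).sum_comp (fun v => |x (en (.inr p)) - x v|)
  have hite : ∀ u v, (if Irregular u v then |z u - z v| else 0) ≤ |z u - z v| := by
    intro u v
    split_ifs
    · exact le_rfl
    · exact abs_nonneg _
  rw [Fintype.sum_sum_type]
  have h1 : ∑ p, ∑ v, (if Irregular (.inr p) v then |z (.inr p) - z v| else 0) ≤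
      ∑ p, wdeg x (en (.inr p)) :=
    sum_le_sum fun p _ => (sum_le_sum fun v _ => hite _ _).trans (hdeg p).le
  have h2 : ∑ u, ∑ p, (if Irregular (.inl u) (.inr p) then |z (.inl u) - z (.inr p)| else 0) ≤
      ∑ p, wdeg x (en (.inr p)) := by
    rw [sum_comm]
    refine sum_le_sum fun p _ => ?_
    rw [← hdeg p, Fintype.sum_sum_type]
    refine le_trans ?_ (le_add_of_nonneg_right (sum_nonneg fun _ _ => abs_nonneg _))
    refine sum_le_sum fun u _ => (hite _ _).trans ?_
    rw [abs_sub_comm]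
  have h3 : ∑ u, ∑ v,
      (if Irregular (.inl u : Team k (2 * (n / (4 * k))) (numPairs n k)) (.inl v)
        then |z (.inl u) - z (.inl v)| else 0) =
      ∑ p : Fin (numSuper n k) × Fin 2,
        ∑ q : Fin (numSuper n k) × Fin 2, (if IrregularPair (n / (4 * k)) (numPairs n k) p.1 q.1
          then cyclePairDist x en (lab p) (lab q) else 0) := by
    simp only [Fintype.sum_prod_type]
    refine sum_congr rfl fun A _ => sum_congr rfl fun h _ => ?_
    rw [sum_comm]
    refine sum_congr rfl fun B _ => ?_
    rw [sum_comm]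
    refine sum_congr rfl fun h' _ => ?_
    by_cases hAB : IrregularPair (n / (4 * k)) (numPairs n k) A B
    · rw [if_pos hAB]
      exact sum_congr rfl fun i _ => sum_congr rfl fun i' _ => if_pos hAB
    · rw [if_neg hAB]
      exact sum_eq_zero fun i _ => sum_eq_zero fun i' _ => if_neg hAB
  have h4 : ∑ u, ∑ v, (if Irregular (.inl u) v then |z (.inl u) - z v| else 0) =
      ∑ u, ∑ v,
        (if Irregular (.inl u : Team k (2 * (n / (4 * k))) (numPairs n k)) (.inl v)
          then |z (.inl u) - z (.inl v)| else 0) +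
      ∑ u, ∑ p, (if Irregular (.inl u) (.inr p) then |z (.inl u) - z (.inr p)| else 0) := by
    rw [← sum_add_distrib]
    exact sum_congr rfl fun u _ => Fintype.sum_sum_type _
  rw [h4, ← h3]
  linarith

theorem Labelling.card_pos (n k : ℕ) : 0 < Fintype.card (Labelling n k) :=
  Fintype.card_pos_iff.2 ⟨finProdFinEquiv.trans (finCongr (mul_comm _ _))⟩

open Classical in
/-- Total distance between the cycles at irregular places of the labelling. -/
noncomputable def irregularDist (x : Fin n → ℝ) (en : Arrangement n k) (lab : Labelling n k) : ℝ :=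
  ∑ p : Fin (numSuper n k) × Fin 2, ∑ q : Fin (numSuper n k) × Fin 2,
    if IrregularPair (n / (4 * k)) (numPairs n k) p.1 q.1
    then cyclePairDist x en (lab p) (lab q) else 0

theorem travel_cyclePackingSchedule_le (hk : 0 < k) (hμ : 0 < n / (4 * k)) (lab : Labelling n k)
    {D₁ : ℕ → FixedTeam k (numPairs n k) → FixedTeam k (numPairs n k) → Prop}
    {D₂ : Fin (numSuper n k) → ℕ → SuperTeam k → SuperTeam k → Prop}
    (hG : IsTTP k (packGame (labelledHomes x en lab) D₁ D₂)) :
    travel x (cyclePackingSchedule x en lab D₁ D₂) ≤ 2 * irregularDist x en lab +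
      (4 * ∑ p, wdeg x (en (.inr p)) + 2 / k * pairSum x +
        2 * numSuper n k * (k - 1) * packingWeight x en.cycles) := by
  have e1 : travel x (cyclePackingSchedule x en lab D₁ D₂) =
      travel (labelledHomes x en lab) (packGame (labelledHomes x en lab) D₁ D₂) :=
    hG.travel_relabel (assign en lab) x
  have e2 := travel_packGame_le hk hμ hG
  rw [sum_cycleWeight_labelledHomes, show pairSum (labelledHomes x en lab) = pairSum x from
    pairSum_comp_equiv (assign en lab) x] at e2
  have e3 := sum_irregular_le x en lab
  have e4 : (numSuper n k : ℝ) = 2 * (n / (4 * k) : ℕ) := by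
    rw [numSuper]; push_cast; ring
  rw [e1, e4]
  unfold irregularDist
  linarith

theorem sum_irregularDist_le (x : Fin n → ℝ) (en : Arrangement n k) (hm : 1 ≤ numSuper n k) :
    ∑ lab, irregularDist x en lab ≤ Fintype.card (Labelling n k) * (∑ c, cyclePairDist x en c c +
      2 * (7 + 6 * numPairs n k) / numSuper n k * pairSum x) := by
  classical
  have hmr : (1 : ℝ) ≤ numSuper n k := by exact_mod_cast hm
  have hcard : Fintype.card (Fin (numSuper n k) × Fin 2) = numSuper n k * 2 := by
    rw [Fintype.card_prod, Fintype.card_fin, Fintype.card_fin]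
  have h3 := sum_equiv_related_le (ι := Fin (numSuper n k) × Fin 2) (cyclePairDist x en)
    cyclePairDist_nonneg
    (fun p q => IrregularPair (n / (4 * k)) (numPairs n k) p.1 q.1) (by rw [hcard]; omega)
  refine h3.trans (mul_le_mul_of_nonneg_left (add_le_add le_rfl ?_) (Nat.cast_nonneg _))
  rw [hcard]
  have h4 : (#{p : (Fin (numSuper n k) × Fin 2) × (Fin (numSuper n k) × Fin 2) |
      IrregularPair (n / (4 * k)) (numPairs n k) p.1.1 p.2.1} : ℝ) ≤
      4 * numSuper n k * (7 + 6 * numPairs n k) := by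
    have := card_irregular_cycles_le (n / (4 * k)) (numPairs n k)
    have e : 8 * (n / (4 * k)) * (7 + 6 * numPairs n k) =
        4 * numSuper n k * (7 + 6 * numPairs n k) := by
      rw [numSuper]; ring
    rw [e] at this
    exact_mod_cast this
  have h5 := sum_cyclePairDist_le x en
  have h6 : (0 : ℝ) ≤ ∑ c, ∑ c', cyclePairDist x en c c' :=
    sum_nonneg fun _ _ => sum_nonneg fun _ _ => cyclePairDist_nonneg _ _
  have hΩ0 := pairSum_nonneg x
  push_cast
  generalize (numSuper n k : ℝ) = m at *
  have hden : (0 : ℝ) < m * 2 * (m * 2 - 1) := mul_pos (by linarith) (by linarith)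
  refine (mul_le_mul h4 (div_le_div_of_nonneg_right h5 hden.le) (div_nonneg h6 hden.le)
    (by positivity)).trans ?_
  have h7 : pairSum x / (m * 2 * (m * 2 - 1)) ≤ pairSum x / (2 * m * m) := by
    refine div_le_div_of_nonneg_left hΩ0 (by positivity) ?_
    have := mul_nonneg (show 0 ≤ 2 * m by linarith) (show 0 ≤ m - 1 by linarith)
    linarith
  refine (mul_le_mul_of_nonneg_left h7 (by positivity)).trans (le_of_eq ?_)
  field_simp
  ring

/-- The expected weight of the cycle packing schedule; the last two terms account for the games
outside the normal super-games. -/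
theorem IsConsecutive.expectLabelling_travel_le (hk : 0 < k) (hμ : 0 < n / (4 * k))
    (hr : numPairs n k ≤ 2 * k) (h : IsConsecutive x en)
    {D₁ : Labelling n k → ℕ → FixedTeam k (numPairs n k) → FixedTeam k (numPairs n k) → Prop}
    {D₂ : Labelling n k → Fin (numSuper n k) → ℕ → SuperTeam k → SuperTeam k → Prop}
    (hG : ∀ lab, IsTTP k (packGame (labelledHomes x en lab) (D₁ lab) (D₂ lab))) :
    expectLabelling (fun lab => travel x (cyclePackingSchedule x en lab (D₁ lab) (D₂ lab))) ≤
      2 / k * pairSum x + 2 * numSuper n k * (k - 1) * packingWeight x en.cycles +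
        (k ^ 2 * packingWeight x en.cycles + (36 + 48 * k) / numSuper n k * pairSum x) := by
  have hm : 1 ≤ numSuper n k := by
    rw [numSuper]
    omega
  have hmr : (1 : ℝ) ≤ numSuper n k := by exact_mod_cast hm
  have hkr : (1 : ℝ) ≤ k := by exact_mod_cast hk
  have hrr : (numPairs n k : ℝ) ≤ 2 * k := by exact_mod_cast hr
  have hΩ0 : 0 ≤ pairSum x := pairSum_nonneg x
  have hL0 : (0 : ℝ) < Fintype.card (Labelling n k) := by exact_mod_cast Labelling.card_pos n k
  have h1 := fun lab => travel_cyclePackingSchedule_le hk hμ lab (hG lab)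
  have h2 := sum_irregularDist_le x en hm
  have h8 := sum_cyclePairDist_self_le x en
  have h10 := h.sum_wdeg_le
  unfold expectLabelling
  rw [div_le_iff₀ hL0]
  refine (sum_le_sum fun lab _ => h1 lab).trans ?_
  rw [sum_add_distrib, ← mul_sum, sum_const, card_univ, nsmul_eq_mul]
  clear h1 hG
  generalize ∑ lab, irregularDist x en lab = E at *
  generalize (numSuper n k : ℝ) = m at *
  generalize (numPairs n k : ℝ) = r at *
  generalize (Fintype.card (Labelling n k) : ℝ) = L at *
  generalize ∑ p, wdeg x (en (.inr p)) = W at *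
  generalize pairSum x = Ω at *
  generalize packingWeight x en.cycles = C at *
  generalize ∑ c, cyclePairDist x en c c = Z at *
  have h9 : 4 * W ≤ 8 / m * Ω := by
    have h11 := mul_le_mul_of_nonneg_right hrr hΩ0
    rw [div_mul_eq_mul_div, le_div_iff₀ (by linarith)]
    have h13 : k * (m * W) ≤ k * (2 * Ω) := by linarith
    have := le_of_mul_le_mul_left h13 (by linarith)
    linarith
  have h14 : 4 * (7 + 6 * r) / m * Ω ≤ (28 + 48 * k) / m * Ω :=
    mul_le_mul_of_nonneg_right (div_le_div_of_nonneg_right (by linarith) (by linarith)) hΩ0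
  have h15 : (36 + 48 * k : ℝ) / m * Ω = 8 / m * Ω + (28 + 48 * k) / m * Ω := by
    rw [← add_mul, ← add_div]
    ring
  have h16 : 2 * (Z + 2 * (7 + 6 * r) / m * Ω) +
      (4 * W + 2 / k * Ω + 2 * m * (k - 1) * C) ≤ 2 / k * Ω + 2 * m * (k - 1) * C +
        (k ^ 2 * C + (36 + 48 * k) / m * Ω) := by
    have : 2 * (2 * (7 + 6 * r) / m * Ω) = 4 * (7 + 6 * r) / m * Ω := by ring
    linarith
  have h17 := mul_le_mul_of_nonneg_left h16 hL0.le
  linarith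

/-- The error terms are a small fraction of the weight `T` of any feasible schedule. -/
theorem error_arith {k m Ω C T ρ ε : ℝ} (hk : 3 ≤ k) (hε : 0 < ε) (hρ : ρ ≤ 2) (hT : 0 ≤ T)
    (hΩ : 0 ≤ Ω) (hC : 0 ≤ C) (hΩT : 2 / k * Ω ≤ T)
    (hmain : 2 / k * Ω + 2 * m * (k - 1) * C ≤ (ρ + ε / 2) * T)
    (hm : 2 * (k ^ 2 * (2 + ε) + (18 + 24 * k) * k) / ε ≤ m) :
    2 / k * Ω + 2 * m * (k - 1) * C + (k ^ 2 * C + (36 + 48 * k) / m * Ω) ≤ (ρ + ε) * T := by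
  set K := k ^ 2 * (2 + ε) + (18 + 24 * k) * k with hK
  have hKpos : 0 < K := by positivity
  have hmpos : 0 < m := lt_of_lt_of_le (by positivity) hm
  rw [div_le_iff₀ hε] at hm
  have h1 : Ω ≤ k / 2 * T := by
    rw [div_mul_eq_mul_div, div_le_iff₀ (by linarith)] at hΩT
    linarith
  have h2 : m * C ≤ (2 + ε) * T := by
    have h0 : 0 ≤ 2 / k * Ω := by positivity
    have h3 := mul_nonneg (mul_nonneg hmpos.le hC) (show 0 ≤ 2 * k - 3 by linarith)
    have h4 := mul_le_mul_of_nonneg_right (show ρ + ε / 2 ≤ 2 + ε by linarith) hT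
    linarith
  have h3 : m * (k ^ 2 * C + (36 + 48 * k) / m * Ω) ≤ K * T := by
    have e : m * (k ^ 2 * C + (36 + 48 * k) / m * Ω) = k ^ 2 * (m * C) + (36 + 48 * k) * Ω := by
      field_simp
    rw [e, hK]
    have h4 := mul_le_mul_of_nonneg_left h2 (show 0 ≤ k ^ 2 by positivity)
    have h5 := mul_le_mul_of_nonneg_left h1 (show 0 ≤ 36 + 48 * k by linarith)
    linarith
  have h4 : m * (k ^ 2 * C + (36 + 48 * k) / m * Ω) ≤ m * (ε / 2 * T) := by
    have := mul_le_mul_of_nonneg_right hm hT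
    linarith
  have := le_of_mul_le_mul_left h4 hmpos
  linarith

end Expectation

end LDTTP

theorem mainTheorem5 (k : ℕ) (hk : 3 ≤ k) (ε : ℝ) (hε : 0 < ε) :
    ∃ N : ℕ, ∀ n : ℕ, Even n → 8 * k ^ 2 ≤ n → ∀ x : Fin n → ℝ,
      -- the ingredients of the construction exist
      (∃ en : LDTTP.Arrangement n k, LDTTP.IsConsecutive x en) ∧
      (∃ D : ℕ → LDTTP.FixedTeam k (LDTTP.numPairs n k) →
        LDTTP.FixedTeam k (LDTTP.numPairs n k) → Prop, LDTTP.IsTTP 2 D) ∧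
      (∃ D : ℕ → LDTTP.SuperTeam k → LDTTP.SuperTeam k → Prop, LDTTP.IsTTP 2 D) ∧
      ∀ en : LDTTP.Arrangement n k, LDTTP.IsConsecutive x en →
        -- the consecutive packing is an optimal `k`-cycle packing of its teams
        (∀ f : Fin (2 * LDTTP.numSuper n k) × Fin k → Fin n, Function.Injective f →
          Set.range f = Set.range en.cycles →
          LDTTP.packingWeight x en.cycles ≤ LDTTP.packingWeight x f) ∧
        ∀ (D₁ : LDTTP.Labelling n k → ℕ → LDTTP.FixedTeam k (LDTTP.numPairs n k) →
            LDTTP.FixedTeam k (LDTTP.numPairs n k) → Prop)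
          (D₂ : LDTTP.Labelling n k → Fin (LDTTP.numSuper n k) → ℕ →
            LDTTP.SuperTeam k → LDTTP.SuperTeam k → Prop),
          (∀ lab, LDTTP.IsTTP 2 (D₁ lab)) → (∀ lab A, LDTTP.IsTTP 2 (D₂ lab A)) →
          -- every schedule is feasible
          (∀ lab, LDTTP.IsTTP k
            (LDTTP.cyclePackingSchedule x en lab (D₁ lab) (D₂ lab))) ∧
          -- the approximation ratio
          (N ≤ n → ∀ G : ℕ → Fin n → Fin n → Prop, LDTTP.IsTTP k G →
            LDTTP.expectLabelling (fun lab => LDTTP.travel x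
                (LDTTP.cyclePackingSchedule x en lab (D₁ lab) (D₂ lab))) ≤
              ((3 * k - 3) / (2 * k - 1) + ε) * LDTTP.travel x G) := by
  obtain ⟨M, hM⟩ := exists_nat_ge
    ((2 * ((k : ℝ) ^ 2 * (2 + ε) + (18 + 24 * k) * k) + 2) / ε + 2)
  refine ⟨4 * k * M, fun n hn hnk x => ?_⟩
  have hk0 : 0 < k := by omega
  have hμk : 2 * k ≤ n / (4 * k) := by
    rw [Nat.le_div_iff_mul_le (by omega)]
    calc 2 * k * (4 * k) = 8 * k ^ 2 := by ring
      _ ≤ n := hnk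
  have hpairs : LDTTP.numPairs n k < 2 * k ∧
      2 * LDTTP.numSuper n k * k + 2 * LDTTP.numPairs n k = n := by
    have h1 := Nat.div_add_mod n (4 * k)
    have h2 := Nat.mod_lt n (show 0 < 4 * k by omega)
    have h3 : 2 * LDTTP.numSuper n k * k = 4 * k * (n / (4 * k)) := by
      rw [LDTTP.numSuper]
      ring
    have h4 : 2 * (2 * k * (n / (4 * k))) = 4 * k * (n / (4 * k)) := by ring
    obtain ⟨t, ht⟩ := hn
    unfold LDTTP.numPairs
    omega
  obtain ⟨hr, hcard⟩ := hpairs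
  refine ⟨LDTTP.exists_isConsecutive x hcard, ?_, ?_, fun en hen => ⟨?_, ?_⟩⟩
  · refine LDTTP.exists_isTTP_two (h := k + LDTTP.numPairs n k) (by omega) ?_
    simp only [Fintype.card_sum, Fintype.card_prod, Fintype.card_fin]
    ring
  · refine LDTTP.exists_isTTP_two (h := k) hk ?_
    simp only [Fintype.card_prod, Fintype.card_fin]
  · intro f hf hrange
    exact LDTTP.packingWeight_le_of_sorted hen.sorted en.cycles_injective hf hrange
  · intro D₁ D₂ hD₁ hD₂
    have hG : ∀ lab, LDTTP.IsTTP k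
        (LDTTP.packGame (LDTTP.labelledHomes x en lab) (D₁ lab) (D₂ lab)) := fun lab =>
      LDTTP.isTTP_packGame hk (by omega) _ (hD₁ lab) (hD₂ lab)
    refine ⟨fun lab => (hG lab).relabel (LDTTP.assign en lab), fun hNn G hGG => ?_⟩
    refine (hen.expectLabelling_travel_le hk0 (by omega) hr.le hG).trans ?_
    have hkr : (3 : ℝ) ≤ k := by exact_mod_cast hk
    have hm : 2 * M ≤ LDTTP.numSuper n k := by
      refine Nat.mul_le_mul_left 2 ?_
      rw [Nat.le_div_iff_mul_le (by omega), mul_comm]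
      exact hNn
    have hmr : 2 * (M : ℝ) ≤ LDTTP.numSuper n k := by exact_mod_cast hm
    have hK : 0 ≤ 2 * ((k : ℝ) ^ 2 * (2 + ε) + (18 + 24 * k) * k) / ε := by positivity
    have hε2 : 0 ≤ 2 / ε := by positivity
    rw [add_div] at hM
    refine LDTTP.error_arith hkr hε ?_ (LDTTP.travel_nonneg x G) (LDTTP.pairSum_nonneg x)
      (LDTTP.packingWeight_nonneg x _) (hGG.pairSum_le_travel hk0)
      (hen.ratio hk (by linarith) ?_ hGG) (by linarith)
    · rw [div_le_iff₀ (by linarith)]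
      linarith
    · have hcr : 2 * (LDTTP.numSuper n k : ℝ) * k + 2 * LDTTP.numPairs n k = n := by
        exact_mod_cast hcard
      have hrr : (LDTTP.numPairs n k : ℝ) ≤ 2 * k := by exact_mod_cast hr.le
      have h1 : 2 / ε ≤ (LDTTP.numSuper n k : ℝ) - 2 := by linarith
      rw [div_le_iff₀ hε] at h1
      have h2 : k * ((LDTTP.numSuper n k : ℝ) - 2) ≤ (n : ℝ) / 2 - 2 * LDTTP.numPairs n k := by
        linarith
      have h3 := mul_le_mul_of_nonneg_left h2 (show 0 ≤ ε / 2 by linarith)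
      have h4 := mul_le_mul_of_nonneg_left h1 (show 0 ≤ (k : ℝ) / 2 by linarith)
      linarith
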